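/- Let $d\ge 3$, let $a>0$ and let $\gamma:[-a,a]\to\mathbb{R}^d$ be a $C^2$ curve such that $\gamma'(t)$ and $\gamma''(t)$ are linearly independent for every $t\in[-a,a]$ (nonvanishing curvature). Suppose that there is an $N\in\mathbb{N}$ such that, for every unit vector $\omega$, the function $s\mapsto\langle\omega,\gamma''(s)\rangle$ changes sign at most $N$ times on $[-a,a]$. Let $\chi$ be a (complex valued) $C^1$ cutoff function with support in $(-a,a)$ and let $\mu$ be the measure given by $\langle\mu,g\rangle=\int_{-a}^{a} g(\gamma(t))\chi(t)\,dt$; if $\chi=\psi|\gamma'|$ on $[-a,a]$ with a smooth $\psi$ supported in $(-a,a)$, this is the arc length measure on the curve multiplied by the cutoff $\psi$. For $\sigma\in SO(d)$ let $\mu_\sigma$ be the rotated measure $\mu_\sigma(A)=\mu(\sigma A)$, and put $$Tf(x,\sigma)=(f*\mu_\sigma)(x)=\int_{-a}^{a} f(x-\sigma^{-1}\gamma(t))\,\chi(t)\,dt .$$ Let $p=\frac{2d-1}{d}$, $p'=\frac{p}{p-1}$ and $0<s<\frac{4d-2}{d-1}$, and let $SO(d)$ carry a Haar measure $d\sigma$.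 Then $T$ maps $L^p(\mathbb{R}^d)$ boundedly into $L^s(SO(d),L^{p'}(\mathbb{R}^d))$: there is a finite constant $C$ such that for every $f\in L^p(\mathbb{R}^d)$ the integral defining $Tf(x,\sigma)$ converges absolutely for almost every $(x,\sigma)\in\mathbb{R}^d\times SO(d)$, the function $Tf$ is measurable with respect to the completed product measure, and $$\Big(\int_{SO(d)}\|Tf(\cdot,\sigma)\|_{L^{p'}(\mathbb{R}^d)}^{s}\,d\sigma\Big)^{1/s}\le C\,\|f\|_{L^p(\mathbb{R}^d)} .$$ -/

import Mathlib

open MeasureTheory Set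
open scoped ENNReal NNReal

noncomputable section

namespace RotatedCurve

/-- `d`-dimensional Euclidean space. -/
abbrev E (d : ℕ) : Type := EuclideanSpace ℝ (Fin d)

/-- The rotation group `SO(d)`, with the topology of the entries of the matrices. -/
abbrev SO (d : ℕ) : Type := Matrix.specialOrthogonalGroup (Fin d) ℝ

/-- The action of `SO(d)` on `ℝ^d`: `rotate σ x` is the vector `σ x`. -/
def rotate {d : ℕ} (σ : SO d) (x : E d) : E d :=
  Matrix.toEuclideanLin (σ : Matrix (Fin d) (Fin d) ℝ) x

/-- The real function `g` changes sign at most `N` times on `S`: among any `N + 2` points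
`t 0 < t 1 < ... < t (N + 1)` of `S` there are two consecutive ones at which the values of `g` do
not have strictly opposite signs. -/
def SignChangesAtMost (N : ℕ) (g : ℝ → ℝ) (S : Set ℝ) : Prop :=
  ∀ t : Fin (N + 2) → ℝ, StrictMono t → (∀ i, t i ∈ S) →
    ∃ i : Fin (N + 1), 0 ≤ g (t i.castSucc) * g (t i.succ)

/-- The hypotheses on the curve `γ : [-a, a] → ℝ^d`: it is `C^2` on the closed interval (with
one-sided derivatives at the end points), it is regular with nonvanishing curvature, that is,
`γ'` and `γ''` are linearly independent at each point, and there is a bound, uniform in the unit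
vector `ω`, on the number of sign changes of `⟨ω, γ''⟩` on `[-a, a]`. -/
structure AdmissibleCurve {d : ℕ} (a : ℝ) (γ : ℝ → E d) : Prop where
  contDiffOn : ContDiffOn ℝ 2 γ (Icc (-a) a)
  curvature : ∀ t ∈ Icc (-a) a, LinearIndependent ℝ
    ![derivWithin γ (Icc (-a) a) t, iteratedDerivWithin 2 γ (Icc (-a) a) t]
  signChanges : ∃ N : ℕ, ∀ ω : E d, ‖ω‖ = 1 →
    SignChangesAtMost N
      (fun s => inner ℝ ω (iteratedDerivWithin 2 γ (Icc (-a) a) s)) (Icc (-a) a)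

/-- A cutoff function for the curve: `χ` is `C^1`, complex valued, and its support is contained in
the interior of `[-a, a]`. With `C^1` (rather than `C^∞`) functions, the densities `χ(t) dt` contain
both those with `χ` smooth and the arc length densities `ψ(t) |γ'(t)| dt` with `ψ` smooth. -/
structure IsCutoff (a : ℝ) (χ : ℝ → ℂ) : Prop where
  contDiff : ContDiff ℝ 1 χ
  tsupport_subset : tsupport χ ⊆ Ioo (-a) a

/-- `⟨μ, g⟩ = ∫ g(γ(t)) χ(t) dt`, the integral of `g` against the measure `μ` on the curve. -/
def pairing {d : ℕ} (a : ℝ) (γ : ℝ → E d) (χ : ℝ → ℂ) (g : E d → ℂ) : ℂ :=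
  ∫ t in Icc (-a) a, g (γ t) * χ t

/-- `⟨μ_σ, g⟩`, the integral of `g` against the rotated measure `μ_σ`, `μ_σ(A) = μ(σ A)`: this is
`⟨μ, g ∘ σ⁻¹⟩`. -/
def rotatedPairing {d : ℕ} (a : ℝ) (γ : ℝ → E d) (χ : ℝ → ℂ) (σ : SO d) (g : E d → ℂ) : ℂ :=
  pairing a γ χ (fun y => g (rotate σ⁻¹ y))

/-- `T f (x, σ) = (f * μ_σ)(x) = ∫ f(x - y) dμ_σ(y)`. -/
def T {d : ℕ} (a : ℝ) (γ : ℝ → E d) (χ : ℝ → ℂ) (f : E d → ℂ) (x : E d) (σ : SO d) : ℂ :=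
  rotatedPairing a γ χ σ (fun y => f (x - y))

/-- The mixed norm of `L^s(SO(d), L^q(ℝ^d))` with respect to the measure `ν` on `SO(d)`, with values
in `[0, ∞]`. -/
def mixedNorm {d : ℕ} [MeasurableSpace (SO d)] (ν : Measure (SO d)) (s q : ℝ≥0∞)
    (F : E d → SO d → ℂ) : ℝ≥0∞ :=
  eLpNorm (fun σ => eLpNorm (fun x => F x σ) q volume) s ν

/-- The definition of `rotatedPairing` says that `μ_σ(A) = μ(σ A)` for every set `A`. -/
theorem rotatedPairing_indicator {d : ℕ} (a : ℝ) (γ : ℝ → E d) (χ : ℝ → ℂ) (σ : SO d)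
    (A : Set (E d)) :
    rotatedPairing a γ χ σ (A.indicator 1) = pairing a γ χ ((rotate σ '' A).indicator 1) := by
  have h1 : ∀ (τ ρ : SO d) (x : E d), rotate τ (rotate ρ x) = rotate (τ * ρ) x := by
    intro τ ρ x
    simp [rotate, Matrix.toLpLin_apply]
  have h2 : ∀ x : E d, rotate (1 : SO d) x = x := by
    intro x
    simp [rotate]
  have h3 : ∀ y : E d, rotate σ⁻¹ y ∈ A ↔ y ∈ rotate σ '' A := by
    intro y
    constructor
    · intro h
      exact ⟨_, h, by rw [h1, mul_inv_cancel, h2]⟩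
    · rintro ⟨x, hx, rfl⟩
      rwa [h1, inv_mul_cancel, h2]
  unfold rotatedPairing
  congr 1
  funext y
  by_cases h : rotate σ⁻¹ y ∈ A
  · rw [indicator_of_mem h, indicator_of_mem ((h3 y).1 h)]
    rfl
  · rw [indicator_of_notMem h, indicator_of_notMem (fun h' => h ((h3 y).2 h'))]

end RotatedCurve

end

/-!
# Averages over rotated curves

After taking absolute values and bounding the cutoff, it suffices to treat the positive operator
`T⁺ f (x, σ) = ∫ f(x - σ⁻¹ γ(t)) dt` (`posAverage`) on nonnegative functions, for exponents
`p' < s < 2 p'` in the rotations, where `p = (2d - 1)/d` and `p' = (2d - 1)/(d - 1)`. The estimate is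
obtained by complex interpolation of an `L¹ → L^∞` bound and an `L² → L²` bound, applied to a
weighted measure `κ = W ν` on `SO(d)`.

*Decay on average.* Let `m(ξ)` be the Fourier transform of `dt` on the curve (`curveFourier`). On an
interval on which `⟨ξ, γ''⟩` does not change sign, van der Corput's argument bounds the oscillatory
integral in terms of the length of the set where `⟨ξ, γ'⟩` is small; the hypothesis on sign changes
bounds the number of such intervals. If `⟨ξ, γ'⟩` is small on a long interval, then so is
its difference quotient between separated points, and because of the curvature the tangent and its
difference quotient are independent, uniformly; so the unit vector `ξ/|ξ|` is close to a subspace of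
codimension two, and this is unlikely for a random rotation. Hence the `q`-th moment of `|m(σ ξ)|` over the rotations is
`O(|ξ|^(-q/2))` for `q < 4` (`AdmissibleCurve.exists_lintegral_curveFourier_le`). By Hölder's
inequality, for a weight `W` in `L^r(SO(d))` with `r = s/(s - p')`, the integral of `|m(σ ξ)|²`
against `W` is `O(‖W‖_r / |ξ|)`: this uses the moment of order `q = 2 s/p' < 4`.

*Analytic family.* Let `G = η + y · ∇η` with a bump function `η` (`lineDeriv`). The integral of
`G` over each line through the origin vanishes, while `∫ G = (1 - d) ∫ η ≠ 0`. With
`G_k(y) = 4^(kd) G(4^k y)`, consider `M_z = G_0 + ∑_{1 ≤ k < n} 4^(-kz) (G_k - G_{k-1})`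
(`kernelSum`). Near a point of closest approach the curve is almost a straight line, and the
cancellation along lines makes the sum over `k` of the averages of `4^(-k(d-1)) G_k` over the curve
bounded without a logarithmic loss (`AdmissibleCurve.exists_sum_integral_lineDeriv_le`). Hence for
`Re z = d - 1` the average of `M_z` over each rotated curve is bounded, which is an `L¹ → L^∞`
bound. For `Re z = -1/2` the Fourier transform of `M_z` is `O(|ξ|^(1/2))`, which is compensated by
the average decay of `m`; by Plancherel's theorem this is an `L² → L²(κ × dx)` bound
(`lintegral_curveAverage_sq_le`). All the bounds are uniform in `n` and in `Im z`.

*Interpolation.* At `z = 0` the sum telescopes to a single dilate of `G`, and the three lines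
theorem gives an `L^p → L^{p'}(κ × dx)` bound for it on simple functions
(`enorm_kernelForm_simpleFunc_le`); then `n → ∞` turns the dilates into a nonzero multiple of the
delta measure, so that the bound holds for `T⁺` on continuous functions of compact support
(`lintegral_posAverage_rpow_le`). The constant depends on the weight as `‖W‖_r^(1/p')`, and the
choice `W(σ) = ‖T⁺ f(·, σ)‖_{p'}^(s - p')` converts it into the mixed norm estimate
(`exists_lintegral_posAverage_le`). Density of the continuous functions and Fatou's lemma extend it
to `L^p`.
-/

noncomputable section

namespace RotatedCurve

variable {d : ℕ}

/-! ### The rotation group -/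

theorem rotate_rotate (τ ρ : SO d) (x : E d) : rotate τ (rotate ρ x) = rotate (τ * ρ) x := by
  simp [rotate, Matrix.toLpLin_apply]

theorem rotate_one (x : E d) : rotate (1 : SO d) x = x := by
  simp [rotate]

theorem rotate_inv_rotate (σ : SO d) (x : E d) : rotate σ⁻¹ (rotate σ x) = x := by
  rw [rotate_rotate, inv_mul_cancel, rotate_one]

theorem rotate_rotate_inv (σ : SO d) (x : E d) : rotate σ (rotate σ⁻¹ x) = x := by
  rw [rotate_rotate, mul_inv_cancel, rotate_one]

theorem coe_inv_eq (σ : SO d) :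
    ((σ⁻¹ : SO d) : Matrix (Fin d) (Fin d) ℝ) = (σ : Matrix (Fin d) (Fin d) ℝ).conjTranspose :=
  rfl

theorem inner_rotate (σ : SO d) (x y : E d) :
    inner ℝ (rotate σ x) y = inner ℝ x (rotate σ⁻¹ y) := by
  unfold rotate
  rw [coe_inv_eq, Matrix.toEuclideanLin_conjTranspose_eq_adjoint, LinearMap.adjoint_inner_right]

theorem norm_rotate (σ : SO d) (x : E d) : ‖rotate σ x‖ = ‖x‖ := by
  have h : ‖rotate σ x‖ ^ 2 = ‖x‖ ^ 2 := by
    rw [← real_inner_self_eq_norm_sq, ← real_inner_self_eq_norm_sq, inner_rotate,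
      rotate_inv_rotate]
  exact (pow_left_inj₀ (norm_nonneg _) (norm_nonneg _) two_ne_zero).1 h

/-- A rotation as a linear isometry of `ℝ^d`. -/
def rotateIsometry (σ : SO d) : E d ≃ₗᵢ[ℝ] E d where
  toFun := rotate σ
  invFun := rotate σ⁻¹
  left_inv := rotate_inv_rotate σ
  right_inv := rotate_rotate_inv σ
  map_add' x y := map_add (Matrix.toEuclideanLin (σ : Matrix (Fin d) (Fin d) ℝ)) x y
  map_smul' c x := map_smul (Matrix.toEuclideanLin (σ : Matrix (Fin d) (Fin d) ℝ)) c x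
  norm_map' := norm_rotate σ

@[simp]
theorem rotate_smul (σ : SO d) (c : ℝ) (x : E d) : rotate σ (c • x) = c • rotate σ x :=
  map_smul (rotateIsometry σ) c x

theorem rotate_sub (σ : SO d) (x y : E d) : rotate σ (x - y) = rotate σ x - rotate σ y :=
  map_sub (rotateIsometry σ) x y

theorem measurePreserving_rotate (σ : SO d) :
    MeasurePreserving (rotate σ) (volume : Measure (E d)) volume :=
  (rotateIsometry σ).measurePreserving

instance secondCountableTopology_SO : SecondCountableTopology (SO d) := by
  have : SecondCountableTopology (Matrix (Fin d) (Fin d) ℝ) :=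
    inferInstanceAs (SecondCountableTopology (Fin d → Fin d → ℝ))
  exact TopologicalSpace.Subtype.secondCountableTopology _

theorem continuous_inv_SO : Continuous fun σ : SO d => σ⁻¹ := by
  refine continuous_induced_rng.2 ?_
  exact continuous_subtype_val.matrix_conjTranspose

instance isTopologicalGroup_SO : IsTopologicalGroup (SO d) where
  continuous_mul := by
    refine continuous_induced_rng.2 ?_
    exact (continuous_subtype_val.comp continuous_fst).mul
      (continuous_subtype_val.comp continuous_snd)
  continuous_inv := continuous_inv_SO

instance compactSpace_SO : CompactSpace (SO d) := by
  refine isCompact_iff_compactSpace.1 ?_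
  have hK : IsCompact (Set.pi univ fun _ : Fin d => Set.pi univ fun _ : Fin d =>
      Icc (-1 : ℝ) 1) :=
    isCompact_univ_pi fun _ => isCompact_univ_pi fun _ => isCompact_Icc
  refine hK.of_isClosed_subset ?_ ?_
  · have : (Matrix.specialOrthogonalGroup (Fin d) ℝ : Set (Matrix (Fin d) (Fin d) ℝ)) =
        {A | A * A.conjTranspose = 1} ∩ {A | A.det = 1} := by
      ext A
      simp only [SetLike.mem_coe, Matrix.mem_specialOrthogonalGroup_iff,
        Matrix.mem_orthogonalGroup_iff, mem_inter_iff, mem_ofPred_eq]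
      rfl
    rw [this]
    refine IsClosed.inter ?_ ?_
    · exact isClosed_eq (continuous_id.mul continuous_id.matrix_conjTranspose) continuous_const
    · exact isClosed_eq continuous_id.matrix_det continuous_const
  · intro A hA i _ j _
    have h := entry_norm_bound_of_unitary (𝕜 := ℝ)
      (Matrix.mem_specialOrthogonalGroup_iff.1 hA).1 i j
    rw [Real.norm_eq_abs] at h
    exact abs_le.1 h

theorem continuous_rotate : Continuous fun q : SO d × E d => rotate q.1 q.2 := by
  unfold rotate
  simp only [Matrix.toLpLin_apply]
  refine (PiLp.continuous_toLp 2 _).comp ?_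
  exact Continuous.matrix_mulVec (continuous_subtype_val.comp continuous_fst)
    ((PiLp.continuous_ofLp 2 _).comp continuous_snd)

theorem continuous_rotate_inv : Continuous fun q : SO d × E d => rotate q.1⁻¹ q.2 := by
  have h : Continuous fun q : SO d × E d => ((q.1⁻¹, q.2) : SO d × E d) :=
    Continuous.prodMk (continuous_inv_SO.comp continuous_fst) continuous_snd
  have h' := Continuous.comp (continuous_rotate (d := d)) h
  exact h'

/-- A linear isometry of determinant one is a rotation. -/
theorem exists_rotate_eq (A : E d ≃ₗᵢ[ℝ] E d)
    (hA : LinearMap.det A.toLinearEquiv.toLinearMap = 1) :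
    ∃ σ : SO d, ∀ x, rotate σ x = A x := by
  set L   := A.toLinearEquiv.toLinearMap with hL
  set M : Matrix (Fin d) (Fin d) ℝ := Matrix.toEuclideanLin.symm L with hM
  have hML : Matrix.toEuclideanLin M = L := by simp [hM]
  have h1 : M.conjTranspose * M = 1 := by
    apply Matrix.toEuclideanLin.injective
    have e : Matrix.toEuclideanLin (M.conjTranspose * M) =
        Matrix.toEuclideanLin M.conjTranspose ∘ₗ Matrix.toEuclideanLin M := by
      ext x : 1
      simp [Matrix.toLpLin_apply]
    rw [e, Matrix.toEuclideanLin_conjTranspose_eq_adjoint, hML]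
    refine LinearMap.ext fun x => ?_
    refine ext_inner_right ℝ fun y => ?_
    rw [LinearMap.comp_apply, LinearMap.adjoint_inner_left]
    have : inner ℝ (L x) (L y) = inner ℝ x y := A.inner_map_map x y
    rw [this]
    simp
  have h2 : M.det = 1 := by
    rw [← hML] at hA
    rwa [Matrix.toEuclideanLin_eq_toLin_orthonormal, LinearMap.det_toLin] at hA
  refine ⟨⟨M, ?_⟩, fun x => ?_⟩
  · rw [Matrix.mem_specialOrthogonalGroup_iff, Matrix.mem_orthogonalGroup_iff']
    exact ⟨h1, h2⟩
  · change Matrix.toEuclideanLin M x = A x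
    rw [hML]
    rfl

/-- `SO(d)` acts transitively on spheres: a vector is moved to another one of the same length by
a product of two reflections, the first of which fixes it. -/
theorem exists_rotate_of_norm_eq (hd : 2 ≤ d) {x y : E d} (h : ‖x‖ = ‖y‖) :
    ∃ σ : SO d, rotate σ x = y := by
  by_cases hxy : x = y
  · exact ⟨1, by rw [rotate_one, hxy]⟩
  have hdet : ∀ e : E d, e ≠ 0 →
      LinearMap.det (Submodule.reflection (ℝ ∙ e)ᗮ).toLinearEquiv.toLinearMap = -1 := by
    intro e he
    rw [Submodule.det_reflection, Submodule.orthogonal_orthogonal, finrank_span_singleton he,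
      pow_one]
  obtain ⟨e, heo, he0⟩ : ∃ e ∈ (ℝ ∙ x)ᗮ, e ≠ 0 := by
    refine Submodule.exists_mem_ne_zero_of_ne_bot fun hb => ?_
    have h1 := Submodule.finrank_add_finrank_orthogonal (ℝ ∙ x)
    have h2 : Module.finrank ℝ (ℝ ∙ x) ≤ 1 := (finrank_span_le_card ({x} : Set (E d))).trans (by simp)
    rw [hb, finrank_bot, finrank_euclideanSpace, Fintype.card_fin] at h1
    omega
  set A := (Submodule.reflection (ℝ ∙ e)ᗮ).trans (Submodule.reflection (ℝ ∙ (x - y))ᗮ) with hA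
  obtain ⟨σ, hσ⟩ := exists_rotate_eq A (by
    have : A.toLinearEquiv.toLinearMap =
      (Submodule.reflection (ℝ ∙ (x - y))ᗮ).toLinearEquiv.toLinearMap ∘ₗ
      (Submodule.reflection (ℝ ∙ e)ᗮ).toLinearEquiv.toLinearMap := rfl
    rw [this, LinearMap.det_comp, hdet e he0, hdet (x - y) (sub_ne_zero.2 hxy)]
    norm_num)
  refine ⟨σ, ?_⟩
  rw [hσ, hA, LinearIsometryEquiv.trans_apply]
  have hfix : Submodule.reflection (ℝ ∙ e)ᗮ x = x := by
    refine Submodule.reflection_mem_subspace_eq_self ?_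
    rw [Submodule.mem_orthogonal_singleton_iff_inner_right]
    rw [Submodule.mem_orthogonal_singleton_iff_inner_right] at heo
    rw [real_inner_comm]
    exact heo
  rw [hfix, Submodule.reflection_sub h]

section Haar

variable [MeasurableSpace (SO d)] [BorelSpace (SO d)] (ν : Measure (SO d)) [ν.IsHaarMeasure]

theorem map_mul_right_haar (g : SO d) : ν.map (· * g) = ν := by
  have h := Measure.isMulInvariant_eq_smul_of_compactSpace (ν.map (· * g)) ν
  have hu : (ν.map (· * g)) univ = ν univ := by
    rw [Measure.map_apply (measurable_mul_const g) MeasurableSet.univ, preimage_univ]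
  rw [h] at hu ⊢
  have hν0 : ν univ ≠ 0 := (isOpen_univ.measure_pos ν univ_nonempty).ne'
  have hν1 : ν univ ≠ ∞ := measure_ne_top _ _
  have h3 : (Measure.haarScalarFactor (ν.map (· * g)) ν : ℝ≥0∞) = 1 := by
    rw [Measure.smul_apply, ENNReal.smul_def, smul_eq_mul] at hu
    rw [← ENNReal.mul_left_inj hν0 hν1, hu, one_mul]
  have h4 : Measure.haarScalarFactor (ν.map (· * g)) ν = 1 := by exact_mod_cast h3
  rw [h4, one_smul]

theorem measurePreserving_mul_right_haar (g : SO d) : MeasurePreserving (· * g) ν ν :=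
  ⟨measurable_mul_const g, map_mul_right_haar ν g⟩

/-- If `σ` is random then `σ ξ` is uniformly distributed on a sphere. Hence the probability that
`σ ξ`, `|ξ| = 1`, belongs to a closed star-shaped set is the proportion of the unit ball covered by
the cone over the part of the set in the unit sphere, which is at most the proportion covered
by the set. -/
theorem haar_rotate_mem_le (hd : 2 ≤ d) {P : Set (E d)} (hP : IsClosed P)
    (hstar : ∀ x ∈ P, ∀ c : ℝ, 0 ≤ c → c ≤ 1 → c • x ∈ P) {ξ : E d} (hξ : ‖ξ‖ = 1) :
    ν {σ | rotate σ ξ ∈ P} * volume (Metric.closedBall (0 : E d) 1) ≤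
      ν univ * volume (P ∩ Metric.closedBall (0 : E d) 1) := by
  set B : Set (E d) := Metric.closedBall (0 : E d) 1
  set Q : Set (SO d × E d) := {q | rotate q.1 q.2 ∈ P ∩ B} with hQ
  have hQm : MeasurableSet Q :=
    (hP.inter Metric.isClosed_closedBall).measurableSet.preimage continuous_rotate.measurable
  have hB : MeasurableSet B := Metric.isClosed_closedBall.measurableSet
  -- the measure of `Q` in both orders of integration
  have h1 : (ν.prod volume) Q = ν univ * volume (P ∩ B) := by
    rw [Measure.prod_apply hQm]
    have : ∀ σ : SO d, (volume : Measure (E d)) (Prod.mk σ ⁻¹' Q) = volume (P ∩ B) := fun σ =>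
      (measurePreserving_rotate σ).measure_preimage
        (hP.inter Metric.isClosed_closedBall).measurableSet.nullMeasurableSet
    simp_rw [this, lintegral_const, mul_comm]
  have h2 : (ν.prod volume) Q = ∫⁻ x : E d, ν {σ | rotate σ x ∈ P ∩ B} := by
    rw [Measure.prod_apply_symm hQm]
    rfl
  rw [← h1, h2, ← lintegral_indicator_const hB]
  refine lintegral_mono fun x => ?_
  by_cases hx : x ∈ B
  · rw [indicator_of_mem hx]
    have hx1 : ‖x‖ ≤ 1 := by simpa [B] using hx
    obtain ⟨τ, hτ⟩ := exists_rotate_of_norm_eq hd (x := ‖x‖ • ξ) (y := x) (by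
      rw [norm_smul, hξ, norm_norm, mul_one])
    have hS : MeasurableSet {σ : SO d | rotate σ ξ ∈ P} :=
      (hP.preimage (continuous_rotate.comp
        (continuous_id.prodMk continuous_const))).measurableSet
    rw [← (measurePreserving_mul_right_haar ν τ).measure_preimage hS.nullMeasurableSet]
    refine measure_mono fun σ hσ => ?_
    have h3 : rotate σ x = ‖x‖ • rotate (σ * τ) ξ := by
      rw [← rotate_rotate, ← rotate_smul, ← rotate_smul, hτ]
    refine ⟨?_, ?_⟩
    · rw [h3]
      exact hstar _ hσ _ (norm_nonneg _) hx1
    · simpa [B, norm_rotate] using hx1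
  · rw [indicator_of_notMem hx]
    exact zero_le

end Haar

/-! ### Volume of the part of the unit ball close to a subspace of codimension two -/

theorem volume_box_inter_ball_le {e₁ e₂ : E d} (h1 : ‖e₁‖ = 1) (h2 : ‖e₂‖ = 1)
    (h12 : inner ℝ e₁ e₂ = 0) {α β : ℝ} (hα : 0 ≤ α) (hβ : 0 ≤ β) :
    volume {x : E d | ‖x‖ ≤ 1 ∧ |inner ℝ x e₁| ≤ α ∧ |inner ℝ x e₂| ≤ β} ≤
      ENNReal.ofReal (2 ^ d * (α * β)) := by
  have hon : Orthonormal ℝ ![e₁, e₂] := by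
    rw [orthonormal_iff_ite]
    intro i j
    fin_cases i <;> fin_cases j <;> simp [h1, h2, h12, real_inner_comm]
  have hcard : 2 ≤ d := by
    have := hon.linearIndependent.fintype_card_le_finrank
    simpa using this
  set i₀ : Fin d := ⟨0, by omega⟩
  set i₁ : Fin d := ⟨1, by omega⟩
  have hi : i₁ ≠ i₀ := by simp [i₀, i₁]
  have hons : Orthonormal ℝ (({i₀, i₁} : Set (Fin d)).domRestrict
      fun i => if i = i₀ then e₁ else e₂) := by
    rw [orthonormal_iff_ite]
    rintro ⟨i, hi'⟩ ⟨j, hj'⟩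
    rcases hi' with rfl | hi' <;> rcases hj' with rfl | hj'
    · simp [h1]
    · rw [mem_singleton_iff] at hj'
      subst hj'
      rw [if_neg fun h => hi (congrArg Subtype.val h).symm]
      simp [hi, h12]
    · rw [mem_singleton_iff] at hi'
      subst hi'
      rw [if_neg fun h => hi (congrArg Subtype.val h)]
      simp [hi, h12, real_inner_comm]
    · rw [mem_singleton_iff] at hi' hj'
      subst hi'
      subst hj'
      simp [hi, h2]
  obtain ⟨b, hb⟩ := hons.exists_orthonormalBasis_extension_of_card_eq (by simp)
  have hb0 : b i₀ = e₁ := by rw [hb i₀ (by simp)]; simp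
  have hb1 : b i₁ = e₂ := by rw [hb i₁ (by simp)]; simp [hi]
  set r : Fin d → ℝ := fun i => (if i = i₀ then α else 1) * (if i = i₁ then β else 1)
  have hvol : (volume : Measure (E d)) ((fun x : E d => WithLp.ofLp (b.repr x)) ⁻¹'
      Set.pi univ fun i => Icc (-(r i)) (r i)) = ENNReal.ofReal (2 ^ d * (α * β)) := by
    have hmp : MeasurePreserving (fun x : E d => WithLp.ofLp (b.repr x)) volume volume :=
      (EuclideanSpace.volume_preserving_symm_measurableEquiv_toLp (Fin d)).comp
        b.repr.measurePreserving
    rw [hmp.measure_preimage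
      (MeasurableSet.univ_pi fun _ => measurableSet_Icc).nullMeasurableSet, volume_pi_pi]
    simp only [Real.volume_Icc]
    have hr : ∀ i, 0 ≤ r i := fun i => by
      apply mul_nonneg <;> split_ifs <;> first | assumption | norm_num
    rw [← ENNReal.ofReal_prod_of_nonneg (fun i _ => by linarith [hr i])]
    congr 1
    have : ∀ i, r i - -(r i) = 2 * r i := fun i => by ring
    simp_rw [this, r, Finset.prod_mul_distrib, Finset.prod_ite_eq']
    simp
  rw [← hvol]
  refine measure_mono fun x hx => ?_
  obtain ⟨hx1, hx2, hx3⟩ := hx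
  intro i _
  have hrepr : WithLp.ofLp (b.repr x) i = inner ℝ (b i) x := b.repr_apply_apply x i
  change WithLp.ofLp (b.repr x) i ∈ Icc (-(r i)) (r i)
  rw [mem_Icc, ← abs_le, hrepr, real_inner_comm]
  by_cases h0 : i = i₀
  · subst h0
    simpa [r, hb0, hi.symm] using hx2
  · by_cases h1' : i = i₁
    · subst h1'
      simpa [r, hb1, h0] using hx3
    · have := abs_real_inner_le_norm x (b i)
      rw [b.norm_eq_one, mul_one] at this
      simpa [r, h0, h1'] using this.trans hx1

/-- The quantity `|v|² |w|² - ⟨v, w⟩²`, the square of the area spanned by `v` and `w`. -/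
def gram (v w : E d) : ℝ := ‖v‖ ^ 2 * ‖w‖ ^ 2 - inner ℝ v w ^ 2

/-- The part of the unit ball where `⟨x, v⟩` and `⟨x, w⟩` are small has volume comparable
to that of a box, uniformly for `v` and `w` in a bounded set and away from linear dependence. -/
theorem volume_two_slabs_le {v w : E d} {M g l₁ l₂ : ℝ} (hg : 0 < g) (hM : 0 < M)
    (hv : ‖v‖ ≤ M) (hw : ‖w‖ ≤ M) (hvw : g ≤ gram v w) (hl₁ : 0 ≤ l₁) (hl : l₁ ≤ l₂) :
    volume {x : E d | ‖x‖ ≤ 1 ∧ |inner ℝ x v| ≤ l₁ ∧ |inner ℝ x w| ≤ l₂} ≤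
      ENNReal.ofReal (2 ^ d * (2 * M ^ 2 / g) * (l₁ * l₂)) := by
  unfold gram at hvw
  have hv0 : 0 < ‖v‖ := by
    rcases (norm_nonneg v).eq_or_lt with h | h
    · rw [← h] at hvw
      nlinarith [sq_nonneg (inner ℝ v w)]
    · exact h
  set n : E d := w - (inner ℝ v w / ‖v‖ ^ 2) • v with hn
  have hvn : inner ℝ v n = 0 := by
    rw [hn, inner_sub_right, inner_smul_right, real_inner_self_eq_norm_sq]
    field_simp
    ring
  have hnn : (‖v‖ * ‖n‖) ^ 2 = ‖v‖ ^ 2 * ‖w‖ ^ 2 - inner ℝ v w ^ 2 := by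
    have h1 : ‖n‖ ^ 2 = inner ℝ w n := by
      rw [← real_inner_self_eq_norm_sq]
      nth_rewrite 1 [hn]
      rw [inner_sub_left, inner_smul_left, hvn]
      simp
    rw [mul_pow, h1, hn, inner_sub_right, inner_smul_right, real_inner_self_eq_norm_sq,
      real_inner_comm w v]
    field_simp
  have hprod : Real.sqrt g ≤ ‖v‖ * ‖n‖ :=
    Real.sqrt_le_iff.2 ⟨by positivity, by rw [hnn]; exact hvw⟩
  have hsg : 0 < Real.sqrt g := Real.sqrt_pos.2 hg
  have hn0 : 0 < ‖n‖ := by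
    rcases (norm_nonneg n).eq_or_lt with h | h
    · rw [← h] at hprod
      linarith
    · exact h
  have hvM : Real.sqrt g ≤ ‖v‖ * M := by
    refine Real.sqrt_le_iff.2 ⟨by positivity, hvw.trans ?_⟩
    have : ‖w‖ ^ 2 ≤ M ^ 2 := by gcongr
    rw [mul_pow]
    nlinarith [sq_nonneg (inner ℝ v w), mul_le_mul_of_nonneg_left this (sq_nonneg ‖v‖)]
  have hl₂ : 0 ≤ l₂ := hl₁.trans hl
  have hbox := volume_box_inter_ball_le (e₁ := ‖v‖⁻¹ • v) (e₂ := ‖n‖⁻¹ • n)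
    (by rw [norm_smul, norm_inv, norm_norm, inv_mul_cancel₀ hv0.ne'])
    (by rw [norm_smul, norm_inv, norm_norm, inv_mul_cancel₀ hn0.ne'])
    (by rw [inner_smul_left, inner_smul_right, hvn]; simp)
    (α := l₁ / ‖v‖) (β := (2 * M / ‖v‖ * l₂) / ‖n‖) (by positivity) (by positivity)
  refine (measure_mono ?_).trans (hbox.trans (ENNReal.ofReal_le_ofReal ?_))
  · rintro x ⟨hx1, hx2, hx3⟩
    refine ⟨hx1, ?_, ?_⟩
    · rw [inner_smul_right, abs_mul, abs_of_pos (inv_pos.2 hv0), inv_mul_eq_div]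
      gcongr
    · rw [inner_smul_right, abs_mul, abs_of_pos (inv_pos.2 hn0), inv_mul_eq_div]
      gcongr
      rw [hn, inner_sub_right, inner_smul_right]
      have h1 : |inner ℝ v w / ‖v‖ ^ 2| ≤ ‖w‖ / ‖v‖ := by
        rw [abs_div, abs_of_nonneg (sq_nonneg ‖v‖), div_le_div_iff₀ (by positivity) hv0]
        nlinarith [abs_real_inner_le_norm v w]
      calc |inner ℝ x w - inner ℝ v w / ‖v‖ ^ 2 * inner ℝ x v|
          ≤ |inner ℝ x w| + |inner ℝ v w / ‖v‖ ^ 2 * inner ℝ x v| := abs_sub _ _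
        _ ≤ l₂ + ‖w‖ / ‖v‖ * l₁ := by
            rw [abs_mul]
            gcongr
        _ ≤ M / ‖v‖ * l₂ + M / ‖v‖ * l₂ := by
            have : 1 ≤ M / ‖v‖ := (one_le_div hv0).2 hv
            gcongr
            nlinarith
        _ = 2 * M / ‖v‖ * l₂ := by ring
  · rw [mul_assoc]
    refine mul_le_mul_of_nonneg_left ?_ (by positivity)
    have e : l₁ / ‖v‖ * (2 * M / ‖v‖ * l₂ / ‖n‖) =
        2 * M ^ 2 * (l₁ * l₂) * (1 / ((‖v‖ * M) * (‖v‖ * ‖n‖))) := by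
      field_simp
    have e' : 2 * M ^ 2 / g * (l₁ * l₂) =
        2 * M ^ 2 * (l₁ * l₂) * (1 / (Real.sqrt g * Real.sqrt g)) := by
      rw [Real.mul_self_sqrt hg.le]
      ring
    rw [e, e']
    gcongr

/-! ### Oscillatory integrals with `C²` phases -/

/-- Van der Corput's estimate with a first derivative bounded below, for a convex phase. -/
theorem norm_integral_exp_le_of_le_deriv {φ φ₁ φ₂ : ℝ → ℝ} {b c l : ℝ} (hbc : b ≤ c) (hl : 0 < l)
    (h1 : ∀ t ∈ Icc b c, HasDerivWithinAt φ (φ₁ t) (Icc b c) t)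
    (h2 : ∀ t ∈ Icc b c, HasDerivWithinAt φ₁ (φ₂ t) (Icc b c) t)
    (hc : ContinuousOn φ₂ (Icc b c)) (hpos : ∀ t ∈ Icc b c, 0 ≤ φ₂ t)
    (hlow : ∀ t ∈ Icc b c, l ≤ |φ₁ t|) :
    ‖∫ t in b..c, Complex.exp (φ t * Complex.I)‖ ≤ 4 / l := by
  have hne : ∀ t ∈ Icc b c, φ₁ t ≠ 0 := fun t ht h => by
    have := hlow t ht
    rw [h, abs_zero] at this
    linarith
  have hcφ : ContinuousOn φ (Icc b c) := fun t ht => (h1 t ht).continuousWithinAt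
  have hcφ₁ : ContinuousOn φ₁ (Icc b c) := fun t ht => (h2 t ht).continuousWithinAt
  have hinv : ∀ t ∈ Icc b c, |(φ₁ t)⁻¹| ≤ 1 / l := fun t ht => by
    rw [abs_inv, ← one_div]
    exact one_div_le_one_div_of_le hl (hlow t ht)
  have hnexp : ∀ t : ℝ, ‖Complex.exp (φ t * Complex.I)‖ = 1 := fun t =>
    Complex.norm_exp_ofReal_mul_I _
  -- the boundary function of the integration by parts
  set F : ℝ → ℂ := fun t => Complex.exp (φ t * Complex.I) * ((φ₁ t)⁻¹ : ℝ) * (-Complex.I) with hF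
  set H : ℝ → ℂ := fun t => Complex.exp (φ t * Complex.I) * ((φ₂ t / φ₁ t ^ 2 : ℝ)) *
    (-Complex.I) with hH
  have hcexp : ContinuousOn (fun t : ℝ => Complex.exp (φ t * Complex.I)) (Icc b c) :=
    Complex.continuous_exp.comp_continuousOn
      ((Complex.continuous_ofReal.comp_continuousOn hcφ).mul continuousOn_const)
  have hcinv : ContinuousOn (fun t => (φ₁ t)⁻¹) (Icc b c) := hcφ₁.inv₀ hne
  have hcq : ContinuousOn (fun t => φ₂ t / φ₁ t ^ 2) (Icc b c) :=
    hc.div (hcφ₁.pow 2) fun t ht => pow_ne_zero 2 (hne t ht)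
  have hcF : ContinuousOn F (Icc b c) :=
    (hcexp.mul (Complex.continuous_ofReal.comp_continuousOn hcinv)).mul continuousOn_const
  have hcH : ContinuousOn H (Icc b c) :=
    (hcexp.mul (Complex.continuous_ofReal.comp_continuousOn hcq)).mul continuousOn_const
  have hderF : ∀ t ∈ Ioo b c, HasDerivAt F (Complex.exp (φ t * Complex.I) - H t) t := by
    intro t ht
    have hm : Icc b c ∈ nhds t := Icc_mem_nhds ht.1 ht.2
    have ht' := Ioo_subset_Icc_self ht
    have d1 := (h1 t ht').hasDerivAt hm
    have d2 := (h2 t ht').hasDerivAt hm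
    have e1 := (d1.ofReal_comp.mul_const Complex.I).cexp
    have e2 := (d2.inv (hne t ht')).ofReal_comp
    refine ((e1.mul e2).mul_const (-Complex.I)).congr_deriv ?_
    have hne' : (φ₁ t : ℂ) ≠ 0 := Complex.ofReal_ne_zero.2 (hne t ht')
    simp only [hH, Pi.inv_apply]
    push_cast
    field_simp
    linear_combination (-(φ₁ t : ℂ) ^ 2) * Complex.I_sq
  have hint1 : IntervalIntegrable (fun t : ℝ => Complex.exp (φ t * Complex.I)) volume b c :=
    hcexp.intervalIntegrable_of_Icc hbc
  have hintH : IntervalIntegrable H volume b c := hcH.intervalIntegrable_of_Icc hbc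
  have hFTC := intervalIntegral.integral_eq_sub_of_hasDerivAt_of_le hbc hcF hderF
    (hint1.sub hintH)
  rw [intervalIntegral.integral_sub hint1 hintH, sub_eq_iff_eq_add] at hFTC
  have hFb : ∀ t ∈ Icc b c, ‖F t‖ ≤ 1 / l := fun t ht => by
    rw [hF]
    simp only [norm_mul, hnexp, norm_neg, Complex.norm_I, one_mul, mul_one, Complex.norm_real,
      Real.norm_eq_abs]
    exact hinv t ht
  have hHb : ‖∫ t in b..c, H t‖ ≤ 2 / l := by
    have hderG : ∀ t ∈ Ioo b c, HasDerivAt (fun t => -(φ₁ t)⁻¹) (φ₂ t / φ₁ t ^ 2) t := by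
      intro t ht
      have ht' := Ioo_subset_Icc_self ht
      have d2 := (h2 t ht').hasDerivAt (Icc_mem_nhds ht.1 ht.2)
      refine (d2.inv (hne t ht')).neg.congr_deriv ?_
      ring
    have hG := intervalIntegral.integral_eq_sub_of_hasDerivAt_of_le hbc hcinv.neg hderG
      (hcq.intervalIntegrable_of_Icc hbc)
    refine (intervalIntegral.norm_integral_le_of_norm_le hbc
      (g := fun t => φ₂ t / φ₁ t ^ 2) ?_ (hcq.intervalIntegrable_of_Icc hbc)).trans ?_
    · refine Filter.Eventually.of_forall fun t ht => ?_
      have ht' := Ioc_subset_Icc_self ht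
      rw [hH]
      simp only [norm_mul, hnexp, norm_neg, Complex.norm_I, one_mul, mul_one, Complex.norm_real,
        Real.norm_eq_abs]
      rw [abs_of_nonneg (div_nonneg (hpos t ht') (sq_nonneg _))]
    · rw [hG]
      have i1 := abs_le.1 (hinv b (left_mem_Icc.2 hbc))
      have i2 := abs_le.1 (hinv c (right_mem_Icc.2 hbc))
      have : 2 / l = 1 / l + 1 / l := by ring
      simp only [Pi.neg_apply]
      linarith [i1.2, i2.1]
  rw [hFTC]
  calc ‖F c - F b + ∫ t in b..c, H t‖ ≤ ‖F c‖ + ‖F b‖ + ‖∫ t in b..c, H t‖ :=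
        (norm_add_le _ _).trans (by gcongr; exact norm_sub_le _ _)
    _ ≤ 1 / l + 1 / l + 2 / l := by
        gcongr
        · exact hFb c (right_mem_Icc.2 hbc)
        · exact hFb b (left_mem_Icc.2 hbc)
    _ = 4 / l := by ring

/-- Van der Corput's estimate for a convex phase: the part of the interval on which the derivative
is at most `l` is an interval, and is estimated by its length. -/
theorem norm_integral_exp_le_of_convex {φ φ₁ φ₂ : ℝ → ℝ} {b c l m : ℝ} (hbc : b ≤ c) (hl : 0 < l)
    (hm : 0 ≤ m)
    (h1 : ∀ t ∈ Icc b c, HasDerivWithinAt φ (φ₁ t) (Icc b c) t)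
    (h2 : ∀ t ∈ Icc b c, HasDerivWithinAt φ₁ (φ₂ t) (Icc b c) t)
    (hc : ContinuousOn φ₂ (Icc b c)) (hpos : ∀ t ∈ Icc b c, 0 ≤ φ₂ t)
    (hlen : ∀ u v, Icc u v ⊆ Icc b c → u ≤ v → (∀ t ∈ Icc u v, |φ₁ t| ≤ l) → v - u ≤ m) :
    ‖∫ t in b..c, Complex.exp (φ t * Complex.I)‖ ≤ m + 8 / l := by
  have hcφ : ContinuousOn φ (Icc b c) := fun t ht => (h1 t ht).continuousWithinAt
  have hcφ₁ : ContinuousOn φ₁ (Icc b c) := fun t ht => (h2 t ht).continuousWithinAt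
  have hcexp : ContinuousOn (fun t : ℝ => Complex.exp (φ t * Complex.I)) (Icc b c) :=
    Complex.continuous_exp.comp_continuousOn
      ((Complex.continuous_ofReal.comp_continuousOn hcφ).mul continuousOn_const)
  have hmono : MonotoneOn φ₁ (Icc b c) := by
    refine monotoneOn_of_hasDerivWithinAt_nonneg (convex_Icc b c) hcφ₁ (f' := φ₂) ?_ ?_
    · intro x hx
      exact (h2 x (interior_subset hx)).mono interior_subset
    · intro x hx
      exact hpos x (interior_subset hx)
  -- the estimate on a subinterval in whose interior the derivative is large
  have hsub : ∀ u v, u ≤ v → Icc u v ⊆ Icc b c → (∀ t ∈ Ioo u v, l ≤ |φ₁ t|) →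
      ‖∫ t in u..v, Complex.exp (φ t * Complex.I)‖ ≤ 4 / l := by
    intro u v huv huvs hlow
    rcases huv.eq_or_lt with rfl | huv'
    · rw [intervalIntegral.integral_same, norm_zero]
      positivity
    refine norm_integral_exp_le_of_le_deriv huv hl (fun t ht => (h1 t (huvs ht)).mono huvs)
      (fun t ht => (h2 t (huvs ht)).mono huvs) (hc.mono huvs) (fun t ht => hpos t (huvs ht)) ?_
    intro t ht
    have hcl : closure (Ioo u v) = Icc u v := closure_Ioo huv'.ne
    refine le_on_closure (s := Ioo u v) (f := fun _ => l) (g := fun t => |φ₁ t|) hlow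
      continuousOn_const ?_ (by rwa [hcl])
    rw [hcl]
    exact (hcφ₁.mono huvs).abs
  set S : Set ℝ := {t ∈ Icc b c | |φ₁ t| ≤ l} with hS
  have hSc : IsCompact S := by
    have : S = Icc b c ∩ (fun t => |φ₁ t|) ⁻¹' Iic l := rfl
    rw [this]
    exact isCompact_Icc.of_isClosed_subset
      (hcφ₁.abs.preimage_isClosed_of_isClosed isClosed_Icc isClosed_Iic) inter_subset_left
  rcases S.eq_empty_or_nonempty with hem | hne
  · refine (hsub b c hbc le_rfl fun t ht => ?_).trans ?_
    · by_contra hcon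
      have : t ∈ S := ⟨Ioo_subset_Icc_self ht, (not_le.1 hcon).le⟩
      rw [hem] at this
      exact this
    · have : 4 / l ≤ 8 / l := by gcongr; norm_num
      linarith
  obtain ⟨u, hu⟩ := hSc.exists_isLeast hne
  obtain ⟨v, hv⟩ := hSc.exists_isGreatest hne
  have huv : u ≤ v := hu.2 hv.1
  have hub := hu.1.1
  have hvb := hv.1.1
  have huvs : Icc u v ⊆ Icc b c := Icc_subset_Icc hub.1 hvb.2
  have hmid : v - u ≤ m := by
    refine hlen u v huvs huv fun t ht => ?_
    have ht' := huvs ht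
    have i1 := hmono hub ht' ht.1
    have i2 := hmono ht' hvb ht.2
    have j1 := abs_le.1 hu.1.2
    have j2 := abs_le.1 hv.1.2
    exact abs_le.2 ⟨j1.1.trans i1, i2.trans j2.2⟩
  have hI : ∀ {x y : ℝ}, x ≤ y → Icc x y ⊆ Icc b c →
      IntervalIntegrable (fun t : ℝ => Complex.exp (φ t * Complex.I)) volume x y :=
    fun hxy hs => (hcexp.mono hs).intervalIntegrable_of_Icc hxy
  have s1 : Icc b u ⊆ Icc b c := Icc_subset_Icc_right hub.2
  have s3 : Icc v c ⊆ Icc b c := Icc_subset_Icc_left hvb.1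
  rw [← intervalIntegral.integral_add_adjacent_intervals (hI hub.1 s1)
    (hI hub.2 (Icc_subset_Icc_left hub.1)),
    ← intervalIntegral.integral_add_adjacent_intervals (hI huv huvs) (hI hvb.2 s3)]
  have b1 : ‖∫ t in b..u, Complex.exp (φ t * Complex.I)‖ ≤ 4 / l := by
    refine hsub b u hub.1 s1 fun t ht => ?_
    by_contra hcon
    exact absurd (hu.2 ⟨s1 (Ioo_subset_Icc_self ht), (not_le.1 hcon).le⟩) (not_le.2 ht.2)
  have b3 : ‖∫ t in v..c, Complex.exp (φ t * Complex.I)‖ ≤ 4 / l := by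
    refine hsub v c hvb.2 s3 fun t ht => ?_
    by_contra hcon
    exact absurd (hv.2 ⟨s3 (Ioo_subset_Icc_self ht), (not_le.1 hcon).le⟩) (not_le.2 ht.1)
  have b2 : ‖∫ t in u..v, Complex.exp (φ t * Complex.I)‖ ≤ v - u := by
    refine (intervalIntegral.norm_integral_le_of_norm_le_const (C := 1) fun t _ => ?_).trans ?_
    · exact (Complex.norm_exp_ofReal_mul_I _).le
    · rw [one_mul, abs_of_nonneg (sub_nonneg.2 huv)]
  refine (norm_add_le _ _).trans ((add_le_add b1 ((norm_add_le _ _).trans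
    (add_le_add b2 b3))).trans ?_)
  have : 8 / l = 4 / l + 4 / l := by ring
  linarith

/-- An interval on which a continuous function changes sign at most `N` times is made up of at most
`N + 1` intervals on which its sign is constant; hence the values of an additive interval function
are bounded by `N + 1` times its bound on the intervals of constant sign. -/
theorem SignChangesAtMost.norm_le {g : ℝ → ℝ} (F : ℝ → ℝ → ℂ) {B : ℝ} (hB : 0 ≤ B) (N : ℕ) {b c : ℝ}
    (hbc : b ≤ c) (hg : ContinuousOn g (Icc b c)) (hN : SignChangesAtMost N g (Icc b c))
    (hF : ∀ x y z, b ≤ x → x ≤ y → y ≤ z → z ≤ c → F x z = F x y + F y z)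
    (hpos : ∀ x y, b ≤ x → x ≤ y → y ≤ c → (∀ t ∈ Icc x y, 0 ≤ g t) → ‖F x y‖ ≤ B)
    (hneg : ∀ x y, b ≤ x → x ≤ y → y ≤ c → (∀ t ∈ Icc x y, g t ≤ 0) → ‖F x y‖ ≤ B) :
    ‖F b c‖ ≤ (N + 1) * B := by
  -- a subinterval on which no two values have opposite signs is estimated by `B`
  have hconst : ∀ x y, b ≤ x → x ≤ y → y ≤ c →
      (∀ t ∈ Icc x y, ∀ t' ∈ Icc t y, 0 ≤ g t * g t') → ‖F x y‖ ≤ B := by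
    intro x y hbx hxy hyc h
    have h' : ∀ t ∈ Icc x y, ∀ t' ∈ Icc x y, 0 ≤ g t * g t' := by
      intro t ht t' ht'
      rcases le_total t t' with hle | hle
      · exact h t ht t' ⟨hle, ht'.2⟩
      · rw [mul_comm]
        exact h t' ht' t ⟨hle, ht.2⟩
    by_cases hp : ∀ t ∈ Icc x y, 0 ≤ g t
    · exact hpos x y hbx hxy hyc hp
    · push Not at hp
      obtain ⟨t, ht, hgt⟩ := hp
      exact hneg x y hbx hxy hyc fun t' ht' => by
        by_contra hcon
        have := h' t ht t' ht'
        nlinarith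
  induction N generalizing b with
  | zero =>
    have := hconst b c le_rfl hbc le_rfl fun t ht t' ht' => by
      rcases ht'.1.eq_or_lt with rfl | hlt
      · exact mul_self_nonneg _
      obtain ⟨i, hi⟩ := hN ![t, t'] (by
          rw [Fin.strictMono_iff_lt_succ]
          intro i
          fin_cases i
          simpa using hlt)
        (by
          intro i
          fin_cases i
          · exact ht
          · exact ⟨ht.1.trans ht'.1, ht'.2⟩)
      fin_cases i
      simpa using hi
    simpa using this
  | succ N ih =>
    set Y : Set ℝ := {y ∈ Icc b c | ∃ x ∈ Icc b y, g x * g y < 0} with hY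
    rcases Y.eq_empty_or_nonempty with hem | hne
    · have := hconst b c le_rfl hbc le_rfl fun t ht t' ht' => by
        by_contra hcon
        have : t' ∈ Y := ⟨⟨ht.1.trans ht'.1, ht'.2⟩, t, ⟨ht.1, ht'.1⟩, not_le.1 hcon⟩
        rw [hem] at this
        exact this
      refine this.trans (le_mul_of_one_le_left hB ?_)
      push_cast
      linarith [(Nat.cast_nonneg N : (0 : ℝ) ≤ N)]
    have hbdd : BddBelow Y := ⟨b, fun y hy => hy.1.1⟩
    set m := sInf Y with hm
    have hbm : b ≤ m := le_csInf hne fun y hy => hy.1.1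
    have hmc : m ≤ c := (csInf_le hbdd hne.some_mem).trans hne.some_mem.1.2
    have hmI : m ∈ Icc b c := ⟨hbm, hmc⟩
    -- the sign is constant to the left of `m`
    have hleft : ∀ t ∈ Icc b m, ∀ t' ∈ Icc t m, 0 ≤ g t * g t' := by
      intro t ht t' ht'
      by_contra hcon
      rw [not_le] at hcon
      have htt : t < t' := by
        rcases ht'.1.eq_or_lt with h | h
        · rw [h] at hcon
          exact absurd (mul_self_nonneg (g t')) (not_le.2 hcon)
        · exact h
      have ht'c : t' ∈ Icc b c := ⟨ht.1.trans ht'.1, ht'.2.trans hmc⟩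
      have hcont : ContinuousWithinAt (fun z => g t * g z) (Icc b c) t' :=
        (hg t' ht'c).const_mul (g t)
      have hev := hcont.eventually_lt_const hcon
      have hsub : Ioo t t' ⊆ Icc b c := fun z hz =>
        ⟨ht.1.trans hz.1.le, hz.2.le.trans ht'c.2⟩
      have hev' := hev.filter_mono (nhdsWithin_mono t' hsub)
      have : (nhdsWithin t' (Ioo t t')).NeBot := right_nhdsWithin_Ioo_neBot htt
      obtain ⟨z, hz1, hz2⟩ := (hev'.and self_mem_nhdsWithin).exists
      have : z ∈ Y := ⟨hsub hz2, t, ⟨ht.1, hz2.1.le⟩, hz1⟩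
      exact absurd (csInf_le hbdd this) (not_le.2 (hz2.2.trans_le ht'.2))
    have hN' : SignChangesAtMost N g (Icc m c) := by
      intro t ht htI
      by_contra! hcon
      have hlt01 : g (t 0) * g (t 1) < 0 := by simpa using hcon 0
      have hg0 : g (t 0) ≠ 0 := fun h => by simp [h] at hlt01
      -- a point to the left of `t 0` at which `g` has the opposite sign
      obtain ⟨x, hx, hxt, hxg⟩ : ∃ x ∈ Icc b c, x < t 0 ∧ g x * g (t 0) < 0 := by
        have h0 := htI 0
        have h0' : t 0 ∈ Icc b c := ⟨hbm.trans h0.1, h0.2⟩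
        rcases h0.1.eq_or_lt with hmt | hmt
        · have hcont : ContinuousWithinAt (fun z => g (t 0) * g z) (Icc b c) (t 0) :=
            (hg (t 0) h0').const_mul (g (t 0))
          have hev := hcont.eventually_const_lt (mul_self_pos.2 hg0)
          obtain ⟨ε, hε, hball⟩ := Metric.mem_nhdsWithin_iff.1 hev
          obtain ⟨y, hy, hyε⟩ := exists_lt_of_csInf_lt hne (lt_add_of_pos_right m hε)
          have hmy : m ≤ y := csInf_le hbdd hy
          obtain ⟨x, hx, hxy⟩ := hy.2
          have hnear : ∀ z, m ≤ z → z ≤ y → 0 < g (t 0) * g z := fun z hz1 hz2 =>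
            hball ⟨by
              rw [Metric.mem_ball, Real.dist_eq, ← hmt, abs_of_nonneg (sub_nonneg.2 hz1)]
              linarith, hbm.trans hz1, hz2.trans hy.1.2⟩
          have hy1 := hnear y hmy le_rfl
          have hxm : x < m := by
            by_contra hcon'
            have hx1 := hnear x (not_lt.1 hcon') hx.2
            nlinarith [mul_pos hx1 hy1, mul_self_pos.2 hg0]
          refine ⟨x, ⟨hx.1, hxm.le.trans hmc⟩, hmt ▸ hxm, ?_⟩
          by_contra hcon'
          rw [not_lt] at hcon'
          nlinarith [mul_nonneg hcon' hy1.le, mul_self_pos.2 hg0]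
        · obtain ⟨y, hy, hyt⟩ := exists_lt_of_csInf_lt hne hmt
          obtain ⟨x, hx, hxy⟩ := hy.2
          by_cases h : g y * g (t 0) < 0
          · exact ⟨y, hy.1, hyt, h⟩
          · refine ⟨x, ⟨hx.1, hx.2.trans hy.1.2⟩, hx.2.trans_lt hyt, ?_⟩
            by_contra hcon'
            rw [not_lt] at h hcon'
            nlinarith [mul_nonneg h hcon', mul_self_pos.2 hg0]
      obtain ⟨i, hi⟩ := hN (Fin.cons x t) (by
          rw [Fin.strictMono_iff_lt_succ]
          intro i
          refine Fin.cases ?_ (fun j => ?_) i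
          · simpa using hxt
          · simpa [← Fin.succ_castSucc] using ht j.castSucc_lt_succ)
        (by
          intro i
          refine Fin.cases ?_ (fun j => ?_) i
          · simpa using hx
          · simpa using (⟨hbm.trans (htI j).1, (htI j).2⟩ : t j ∈ Icc b c))
      revert hi
      refine Fin.cases ?_ (fun j => ?_) i
      · intro hi
        have hi' : 0 ≤ g x * g (t 0) := by simpa using hi
        linarith
      · intro hi
        have hi' : 0 ≤ g (t j.castSucc) * g (t j.succ) := by
          simpa [← Fin.succ_castSucc] using hi
        linarith [hcon j]
    have key := ih hmc (hg.mono (Icc_subset_Icc_left hbm)) hN'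
      (fun x y z hx => hF x y z (hbm.trans hx)) (fun x y hx => hpos x y (hbm.trans hx))
      (fun x y hx => hneg x y (hbm.trans hx)) (fun x y hx => hconst x y (hbm.trans hx))
    have first := hconst b m le_rfl hbm hmc hleft
    rw [hF b m c le_rfl hbm hmc le_rfl]
    refine (norm_add_le _ _).trans ((add_le_add first key).trans ?_)
    push_cast
    linarith

/-- Van der Corput's estimate for a phase whose second derivative has at most `N` sign changes, when
the intervals on which the derivative is at most `l` have length at most `m`. -/
theorem norm_integral_exp_le_of_signChanges {φ φ₁ φ₂ : ℝ → ℝ} {b c l m : ℝ} {N : ℕ} (hbc : b ≤ c)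
    (hl : 0 < l) (hm : 0 ≤ m)
    (h1 : ∀ t ∈ Icc b c, HasDerivWithinAt φ (φ₁ t) (Icc b c) t)
    (h2 : ∀ t ∈ Icc b c, HasDerivWithinAt φ₁ (φ₂ t) (Icc b c) t)
    (hc : ContinuousOn φ₂ (Icc b c)) (hN : SignChangesAtMost N φ₂ (Icc b c))
    (hlen : ∀ u v, Icc u v ⊆ Icc b c → u ≤ v → (∀ t ∈ Icc u v, |φ₁ t| ≤ l) → v - u ≤ m) :
    ‖∫ t in b..c, Complex.exp (φ t * Complex.I)‖ ≤ (N + 1) * (m + 8 / l) := by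
  have hcφ : ContinuousOn φ (Icc b c) := fun t ht => (h1 t ht).continuousWithinAt
  have hcexp : ContinuousOn (fun t : ℝ => Complex.exp (φ t * Complex.I)) (Icc b c) :=
    Complex.continuous_exp.comp_continuousOn
      ((Complex.continuous_ofReal.comp_continuousOn hcφ).mul continuousOn_const)
  refine SignChangesAtMost.norm_le (fun x y => ∫ t in x..y, Complex.exp (φ t * Complex.I))
    (by positivity) N hbc hc hN ?_ ?_ ?_
  · intro x y z hx hxy hyz hz
    refine (intervalIntegral.integral_add_adjacent_intervals ?_ ?_).symm
    · exact (hcexp.mono (Icc_subset_Icc hx (hyz.trans hz))).intervalIntegrable_of_Icc hxy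
    · exact (hcexp.mono (Icc_subset_Icc (hx.trans hxy) hz)).intervalIntegrable_of_Icc hyz
  · intro x y hx hxy hy hsgn
    have hs : Icc x y ⊆ Icc b c := Icc_subset_Icc hx hy
    exact norm_integral_exp_le_of_convex hxy hl hm (fun t ht => (h1 t (hs ht)).mono hs)
      (fun t ht => (h2 t (hs ht)).mono hs) (hc.mono hs) hsgn
      fun u v huv => hlen u v (huv.trans hs)
  · intro x y hx hxy hy hsgn
    have hs : Icc x y ⊆ Icc b c := Icc_subset_Icc hx hy
    -- the conjugate integral has a convex phase
    have hconj : ‖∫ t in x..y, Complex.exp (φ t * Complex.I)‖ =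
        ‖∫ t in x..y, Complex.exp ((-φ t : ℝ) * Complex.I)‖ := by
      rw [← RCLike.norm_conj (∫ t in x..y, Complex.exp (φ t * Complex.I)),
        intervalIntegral.integral_of_le hxy, intervalIntegral.integral_of_le hxy, ← integral_conj]
      congr 2
      funext t
      rw [← Complex.exp_conj]
      simp
    rw [hconj]
    exact norm_integral_exp_le_of_convex hxy hl hm (fun t ht => ((h1 t (hs ht)).mono hs).neg)
      (fun t ht => ((h2 t (hs ht)).mono hs).neg) (hc.mono hs).neg
      (fun t ht => by simpa using hsgn t ht)
      fun u v huv huv' hle => hlen u v (huv.trans hs) huv' fun t ht => by simpa using hle t ht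

/-! ### Curves with nonvanishing curvature -/

/-- The first derivative of the curve, one-sided at the end points. -/
def tangent (a : ℝ) (γ : ℝ → E d) (t : ℝ) : E d := derivWithin γ (Icc (-a) a) t

/-- The second derivative of the curve, one-sided at the end points. -/
def accel (a : ℝ) (γ : ℝ → E d) (t : ℝ) : E d := iteratedDerivWithin 2 γ (Icc (-a) a) t

section Curve

variable {a : ℝ} {γ : ℝ → E d}

theorem AdmissibleCurve.continuousOn (hγ : AdmissibleCurve a γ) : ContinuousOn γ (Icc (-a) a) :=
  hγ.contDiffOn.continuousOn

theorem AdmissibleCurve.hasDerivWithinAt (hγ : AdmissibleCurve a γ) {t : ℝ} (ht : t ∈ Icc (-a) a) :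
    HasDerivWithinAt γ (tangent a γ t) (Icc (-a) a) t :=
  (hγ.contDiffOn.differentiableOn two_ne_zero t ht).hasDerivWithinAt

theorem AdmissibleCurve.hasDerivWithinAt_tangent (ha : 0 < a) (hγ : AdmissibleCurve a γ) {t : ℝ}
    (ht : t ∈ Icc (-a) a) : HasDerivWithinAt (tangent a γ) (accel a γ t) (Icc (-a) a) t := by
  have hu : UniqueDiffOn ℝ (Icc (-a) a) := uniqueDiffOn_Icc (by linarith)
  have h := hγ.contDiffOn.differentiableOn_iteratedDerivWithin (m := 1) (by norm_num) hu t ht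
  have h' := h.hasDerivWithinAt
  rw [iteratedDerivWithin_one] at h'
  have e : accel a γ t = derivWithin (iteratedDerivWithin 1 γ (Icc (-a) a)) (Icc (-a) a) t := by
    unfold accel
    rw [iteratedDerivWithin_succ]
  rw [e, iteratedDerivWithin_one]
  exact h'

theorem AdmissibleCurve.continuousOn_tangent (ha : 0 < a) (hγ : AdmissibleCurve a γ) :
    ContinuousOn (tangent a γ) (Icc (-a) a) := fun _ ht =>
  (hγ.hasDerivWithinAt_tangent ha ht).continuousWithinAt

theorem AdmissibleCurve.continuousOn_accel (ha : 0 < a) (hγ : AdmissibleCurve a γ) :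
    ContinuousOn (accel a γ) (Icc (-a) a) :=
  hγ.contDiffOn.continuousOn_iteratedDerivWithin le_rfl (uniqueDiffOn_Icc (by linarith))

theorem gram_pos {v w : E d} (h : LinearIndependent ℝ ![v, w]) : 0 < gram v w := by
  rw [LinearIndependent.pair_iff] at h
  have hv : v ≠ 0 := fun h0 => one_ne_zero (h 1 0 (by simp [h0])).1
  set n : E d := (-(inner ℝ v w)) • v + (‖v‖ ^ 2) • w with hn
  have hn0 : n ≠ 0 := fun h0 => by
    have := (h _ _ h0).2
    exact hv (norm_eq_zero.1 (pow_eq_zero_iff two_ne_zero |>.1 this))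
  have hnn : ‖n‖ ^ 2 = ‖v‖ ^ 2 * gram v w := by
    rw [← real_inner_self_eq_norm_sq, hn, gram]
    simp only [inner_add_left, inner_add_right, inner_smul_left, inner_smul_right,
      real_inner_self_eq_norm_sq, real_inner_comm w v, map_neg, RCLike.conj_to_real]
    ring
  have h1 : 0 < ‖n‖ ^ 2 := by positivity
  rw [hnn] at h1
  exact pos_of_mul_pos_right h1 (sq_nonneg _)

/-- Difference quotients of `γ'` are uniformly independent of `γ'`. -/
theorem AdmissibleCurve.exists_gram_le (ha : 0 < a) (hγ : AdmissibleCurve a γ) :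
    ∃ g > 0, ∃ M > 0, ∃ r > 0, r ≤ 1 ∧ ∀ t ∈ Icc (-a) a, ∀ t' ∈ Icc (-a) a, t < t' → t' - t ≤ r →
      ‖tangent a γ t‖ ≤ M ∧ ‖(t' - t)⁻¹ • (tangent a γ t' - tangent a γ t)‖ ≤ M ∧
      g ≤ gram (tangent a γ t) ((t' - t)⁻¹ • (tangent a γ t' - tangent a γ t)) := by
  have hne : (Icc (-a) a).Nonempty := ⟨0, by constructor <;> linarith⟩
  have hgc : Continuous fun q : E d × E d => gram q.1 q.2 := by
    unfold gram
    fun_prop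
  have hpair : ContinuousOn (fun t => (tangent a γ t, accel a γ t)) (Icc (-a) a) :=
    (hγ.continuousOn_tangent ha).prodMk (hγ.continuousOn_accel ha)
  obtain ⟨t₀, ht₀, hmin⟩ := isCompact_Icc.exists_isMinOn hne (hgc.comp_continuousOn hpair)
  set g := gram (tangent a γ t₀) (accel a γ t₀) with hg
  have hg0 : 0 < g := gram_pos (hγ.curvature t₀ ht₀)
  obtain ⟨M₁, hM₁⟩ := isCompact_Icc.exists_bound_of_continuousOn (hγ.continuousOn_tangent ha)
  obtain ⟨M₂, hM₂⟩ := isCompact_Icc.exists_bound_of_continuousOn (hγ.continuousOn_accel ha)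
  have hM₁0 : 0 ≤ M₁ := (norm_nonneg _).trans (hM₁ t₀ ht₀)
  have hM₂0 : 0 ≤ M₂ := (norm_nonneg _).trans (hM₂ t₀ ht₀)
  set M := M₁ + M₂ + 1 with hM
  have hK : IsCompact (Metric.closedBall (0 : E d) M ×ˢ Metric.closedBall (0 : E d) M) :=
    (isCompact_closedBall _ _).prod (isCompact_closedBall _ _)
  obtain ⟨δ, hδ, hδg⟩ := Metric.uniformContinuousOn_iff.1
    (hK.uniformContinuousOn_of_continuous hgc.continuousOn) (g / 2) (by positivity)
  set ε := min (δ / 2) 1 with hε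
  have hε0 : 0 < ε := by positivity
  obtain ⟨r, hr, hru⟩ := Metric.uniformContinuousOn_iff.1
    (isCompact_Icc.uniformContinuousOn_of_continuous (hγ.continuousOn_accel ha)) ε hε0
  refine ⟨g / 2, by positivity, M, by positivity, min (r / 2) 1, by positivity, min_le_right _ _,
    fun t ht t' ht' htt hr' => ?_⟩
  have hsub : Icc t t' ⊆ Icc (-a) a := Icc_subset_Icc ht.1 ht'.2
  -- the difference quotient is close to the second derivative
  have hclose : ‖(t' - t)⁻¹ • (tangent a γ t' - tangent a γ t) - accel a γ t‖ ≤ ε := by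
    have hmv := (convex_Icc t t').norm_image_sub_le_of_norm_hasDerivWithin_le
      (f := fun s => tangent a γ s - s • accel a γ t) (f' := fun s => accel a γ s - accel a γ t)
      (C := ε) (x := t) (y := t')
      (fun s hs => ((hγ.hasDerivWithinAt_tangent ha (hsub hs)).mono hsub).sub (by
        simpa using (hasDerivWithinAt_id s (Icc t t')).smul_const (accel a γ t)))
      (fun s hs => by
        rw [← dist_eq_norm]
        refine (hru s (hsub hs) t ht ?_).le
        rw [Real.dist_eq, abs_of_nonneg (sub_nonneg.2 hs.1)]
        have := hr'.trans (min_le_left _ _)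
        linarith [hs.2])
      (left_mem_Icc.2 htt.le) (right_mem_Icc.2 htt.le)
    have hpos : 0 < t' - t := sub_pos.2 htt
    have e : (t' - t)⁻¹ • (tangent a γ t' - tangent a γ t) - accel a γ t =
        (t' - t)⁻¹ • ((tangent a γ t' - t' • accel a γ t) - (tangent a γ t - t • accel a γ t)) := by
      have : accel a γ t = (t' - t)⁻¹ • ((t' - t) • accel a γ t) := by
        rw [smul_smul, inv_mul_cancel₀ hpos.ne', one_smul]
      nth_rewrite 1 [this]
      rw [← smul_sub, sub_smul]
      congr 1
      abel
    rw [e, norm_smul, norm_inv, Real.norm_eq_abs, abs_of_pos hpos, inv_mul_le_iff₀ hpos]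
    rw [Real.norm_eq_abs, abs_of_pos hpos] at hmv
    linarith
  have hw : ‖(t' - t)⁻¹ • (tangent a γ t' - tangent a γ t)‖ ≤ M := by
    have := norm_le_norm_add_norm_sub' ((t' - t)⁻¹ • (tangent a γ t' - tangent a γ t)) (accel a γ t)
    have h1 : ε ≤ 1 := min_le_right _ _
    have := hM₂ t ht
    linarith
  have hv : ‖tangent a γ t‖ ≤ M := (hM₁ t ht).trans (by linarith)
  refine ⟨hv, hw, ?_⟩
  have hd := hδg (tangent a γ t, (t' - t)⁻¹ • (tangent a γ t' - tangent a γ t))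
    ⟨by simpa using hv, by simpa using hw⟩ (tangent a γ t, accel a γ t)
    ⟨by simpa using hv, by simpa using (hM₂ t ht).trans (by linarith)⟩ (by
      rw [Prod.dist_eq, dist_self, dist_eq_norm]
      have : ε ≤ δ / 2 := min_le_left _ _
      exact max_lt hδ (by simp only; linarith))
  have hmin' : g ≤ gram (tangent a γ t) (accel a γ t) := hmin ht
  rw [Real.dist_eq] at hd
  have := (abs_lt.1 hd).1
  simp only at this
  linarith

/-! ### Average decay of the Fourier transform -/

/-- The Fourier transform `∫ exp (-2 π i ⟨γ(t), ξ⟩) dt` of the measure `dt` on the curve. -/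
def curveFourier (a : ℝ) (γ : ℝ → E d) (ξ : E d) : ℂ :=
  ∫ t in Icc (-a) a, Complex.exp ((-(2 * Real.pi * inner ℝ (γ t) ξ) : ℝ) * Complex.I)

theorem AdmissibleCurve.continuous_curveFourier (hγ : AdmissibleCurve a γ) :
    Continuous (curveFourier a γ) := by
  refine continuous_of_dominated (bound := fun _ => 1) ?_ ?_ ?_ ?_
  · intro ξ
    have hi : ContinuousOn (fun t => inner ℝ (γ t) ξ) (Icc (-a) a) :=
      hγ.continuousOn.inner continuousOn_const
    refine ContinuousOn.aestronglyMeasurable ?_ measurableSet_Icc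
    exact Complex.continuous_exp.comp_continuousOn ((Complex.continuous_ofReal.comp_continuousOn
      (continuousOn_const.mul hi).neg).mul continuousOn_const)
  · exact fun ξ => Filter.Eventually.of_forall fun t => (Complex.norm_exp_ofReal_mul_I _).le
  · exact integrable_const _
  · refine Filter.Eventually.of_forall fun t => ?_
    fun_prop

theorem norm_curveFourier_le (ha : 0 < a) (ξ : E d) : ‖curveFourier a γ ξ‖ ≤ 2 * a := by
  refine (norm_setIntegral_le_of_norm_le_const (C := 1) (by simp)
    fun t _ => (Complex.norm_exp_ofReal_mul_I _).le).trans (le_of_eq ?_)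
  rw [measureReal_def, Real.volume_Icc, ENNReal.toReal_ofReal (by linarith)]
  ring

/-- The directions `ω` for which `⟨γ', ω⟩` is at most `l` on an interval of length greater
than `m`. -/
def flatDirections (a : ℝ) (γ : ℝ → E d) (l m : ℝ) : Set (E d) :=
  {ω | ∃ u v, Icc u v ⊆ Icc (-a) a ∧ u ≤ v ∧ m < v - u ∧
    ∀ t ∈ Icc u v, |inner ℝ (tangent a γ t) ω| ≤ l}

/-- Off the flat directions, the Fourier transform is bounded by van der Corput's estimate. -/
theorem AdmissibleCurve.exists_norm_curveFourier_le (ha : 0 < a) (hγ : AdmissibleCurve a γ) :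
    ∃ C > 0, ∀ (ω : E d) (R l m : ℝ), ‖ω‖ = 1 → 0 < R → 0 < l → 0 ≤ m →
      ω ∉ flatDirections a γ l m → ‖curveFourier a γ (R • ω)‖ ≤ C * (m + 1 / (l * R)) := by
  obtain ⟨N, hN⟩ := hγ.signChanges
  refine ⟨(N + 1) * 2, by positivity, fun ω R l m hω hR hl hm hflat => ?_⟩
  set k : ℝ := -(2 * Real.pi * R) with hk
  have hk0 : |k| = 2 * Real.pi * R := by
    rw [hk, abs_neg, abs_of_pos (by positivity)]
  have key := norm_integral_exp_le_of_signChanges (b := -a) (c := a)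
    (φ := fun t => k * inner ℝ (γ t) ω) (φ₁ := fun t => k * inner ℝ (tangent a γ t) ω)
    (φ₂ := fun t => k * inner ℝ (accel a γ t) ω) (l := 2 * Real.pi * R * l) (m := m) (N := N)
    (by linarith) (by positivity) hm
    (fun t ht => by
      have := (hγ.hasDerivWithinAt ht).inner ℝ (hasDerivWithinAt_const t (Icc (-a) a) ω)
      simpa using this.const_mul k)
    (fun t ht => by
      have := (hγ.hasDerivWithinAt_tangent ha ht).inner ℝ (hasDerivWithinAt_const t (Icc (-a) a) ω)
      simpa using this.const_mul k)
    (continuousOn_const.mul ((hγ.continuousOn_accel ha).inner continuousOn_const))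
    (fun t ht htI => by
      obtain ⟨i, hi⟩ := hN ω hω t ht htI
      refine ⟨i, ?_⟩
      have e : k * inner ℝ (accel a γ (t i.castSucc)) ω * (k * inner ℝ (accel a γ (t i.succ)) ω) =
          k ^ 2 * (inner ℝ ω (accel a γ (t i.castSucc)) * inner ℝ ω (accel a γ (t i.succ))) := by
        rw [real_inner_comm ω (accel a γ (t i.castSucc)), real_inner_comm ω (accel a γ (t i.succ))]
        ring
      simp only
      rw [e]
      exact mul_nonneg (sq_nonneg k) hi)
    (fun u v huv huv' hle => by
      by_contra hcon
      refine hflat ⟨u, v, huv, huv', not_le.1 hcon, fun t ht => ?_⟩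
      have := hle t ht
      rw [abs_mul, hk0] at this
      exact le_of_mul_le_mul_left this (by positivity))
  have e : curveFourier a γ (R • ω) =
      ∫ t in (-a)..a, Complex.exp ((k * inner ℝ (γ t) ω : ℝ) * Complex.I) := by
    rw [intervalIntegral.integral_of_le (by linarith), curveFourier, integral_Icc_eq_integral_Ioc]
    congr 1
    funext t
    rw [inner_smul_right, hk]
    congr 3
    ring
  rw [e]
  refine key.trans ?_
  rw [mul_assoc ((N : ℝ) + 1)]
  refine mul_le_mul_of_nonneg_left ?_ (by positivity : (0 : ℝ) ≤ N + 1)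
  have h1 : 8 / (2 * Real.pi * R * l) ≤ 2 * (1 / (l * R)) := by
    rw [mul_one_div, div_le_div_iff₀ (by positivity) (by positivity)]
    have : 0 < l * R := by positivity
    nlinarith [Real.pi_gt_three]
  linarith

section Haar

variable [MeasurableSpace (SO d)] [BorelSpace (SO d)] (ν : Measure (SO d)) [ν.IsHaarMeasure]

/-- The measure of the flat directions. An interval of length greater than `m` contains two
consecutive points of a grid of mesh comparable to `m`. For each such pair of points, `γ'` and its
difference quotient are uniformly independent, and their inner products with `ω` are bounded by
multiples of `l` and `l / m`. -/
theorem AdmissibleCurve.exists_haar_flatDirections_le (hd : 2 ≤ d) (ha : 0 < a)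
    (hγ : AdmissibleCurve a γ) :
    ∃ C > 0, ∀ (ξ : E d) (l m : ℝ), ‖ξ‖ = 1 → 0 < l → 0 < m →
      ν {σ | rotate σ ξ ∈ flatDirections a γ l m} ≤ ENNReal.ofReal (C * (l ^ 2 / m ^ 2)) := by
  obtain ⟨g, hg, M, hM, r, hr, hr1, hgr⟩ := hγ.exists_gram_le ha
  have hB0 : volume (Metric.closedBall (0 : E d) 1) ≠ 0 :=
    (Metric.measure_closedBall_pos volume _ one_pos).ne'
  have hBt : volume (Metric.closedBall (0 : E d) 1) ≠ ∞ :=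
    (isCompact_closedBall _ _).measure_lt_top.ne
  set K : ℝ := (ν univ / volume (Metric.closedBall (0 : E d) 1)).toReal * (2 ^ d * (2 * M ^ 2 / g))
    with hK
  have hK0 : 0 ≤ K := by positivity
  have hpair : ∀ (ξ : E d) (l h t : ℝ), ‖ξ‖ = 1 → 0 < l → 0 < h → h ≤ r → t ∈ Icc (-a) a →
      t + h ∈ Icc (-a) a →
      ν {σ | |inner ℝ (tangent a γ t) (rotate σ ξ)| ≤ l ∧
        |inner ℝ (tangent a γ (t + h)) (rotate σ ξ)| ≤ l} ≤ ENNReal.ofReal (K * (2 * (l ^ 2 / h))) := by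
    intro ξ l h t hξ hl hh hhr ht hth
    obtain ⟨h1, h2, h3⟩ := hgr t ht (t + h) hth (by linarith) (by linarith)
    rw [add_sub_cancel_left] at h2 h3
    set v := tangent a γ t with hv
    set w := h⁻¹ • (tangent a γ (t + h) - tangent a γ t) with hw
    set P : Set (E d) := {x | |inner ℝ x v| ≤ l ∧ |inner ℝ x w| ≤ 2 * l / h} with hP
    have habs : ∀ y : E d, Continuous fun x : E d => |inner ℝ x y| := fun y => by fun_prop
    have hPc : IsClosed P := (isClosed_le (habs v) continuous_const).inter
      (isClosed_le (habs w) continuous_const)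
    have hstar : ∀ x ∈ P, ∀ c : ℝ, 0 ≤ c → c ≤ 1 → c • x ∈ P := by
      rintro x ⟨hx1, hx2⟩ c hc0 hc1
      constructor
      · rw [inner_smul_left, RCLike.conj_to_real, abs_mul, abs_of_nonneg hc0]
        exact (mul_le_of_le_one_left (abs_nonneg _) hc1).trans hx1
      · rw [inner_smul_left, RCLike.conj_to_real, abs_mul, abs_of_nonneg hc0]
        exact (mul_le_of_le_one_left (abs_nonneg _) hc1).trans hx2
    have hle := haar_rotate_mem_le ν hd hPc hstar hξ
    have hvol := volume_two_slabs_le hg hM h1 h2 h3 hl.le (l₂ := 2 * l / h) (by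
      rw [le_div_iff₀ hh]
      nlinarith)
    have hPB : P ∩ Metric.closedBall (0 : E d) 1 =
        {x : E d | ‖x‖ ≤ 1 ∧ |inner ℝ x v| ≤ l ∧ |inner ℝ x w| ≤ 2 * l / h} := by
      ext x
      simp only [hP, mem_inter_iff, mem_ofPred_eq, Metric.mem_closedBall, dist_zero_right]
      tauto
    rw [hPB] at hle
    calc ν {σ | |inner ℝ (tangent a γ t) (rotate σ ξ)| ≤ l ∧
          |inner ℝ (tangent a γ (t + h)) (rotate σ ξ)| ≤ l}
        ≤ ν {σ | rotate σ ξ ∈ P} := by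
          refine measure_mono fun σ hσ => ?_
          obtain ⟨hσ1, hσ2⟩ := hσ
          refine ⟨by rwa [real_inner_comm], ?_⟩
          rw [hw, inner_smul_right, abs_mul, abs_of_pos (inv_pos.2 hh), inv_mul_eq_div,
            inner_sub_right]
          gcongr
          rw [real_inner_comm] at hσ1 hσ2
          calc _ ≤ _ := abs_sub _ _
            _ ≤ 2 * l := by linarith
      _ ≤ ν univ * ENNReal.ofReal (2 ^ d * (2 * M ^ 2 / g) * (l * (2 * l / h))) /
          volume (Metric.closedBall (0 : E d) 1) := by
          rw [ENNReal.le_div_iff_mul_le (Or.inl hB0) (Or.inl hBt)]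
          exact hle.trans (by gcongr)
      _ = ENNReal.ofReal (K * (2 * (l ^ 2 / h))) := by
          have e : K * (2 * (l ^ 2 / h)) =
              (ν univ / volume (Metric.closedBall (0 : E d) 1)).toReal *
              (2 ^ d * (2 * M ^ 2 / g) * (l * (2 * l / h))) := by
            rw [hK]
            ring
          rw [e, ENNReal.ofReal_mul ENNReal.toReal_nonneg,
            ENNReal.ofReal_toReal (ENNReal.div_ne_top (measure_ne_top ν _) hB0)]
          rw [ENNReal.div_eq_inv_mul, ENNReal.div_eq_inv_mul]
          ring
  set ρ : ℝ := min 1 (r / (2 * a)) with hρ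
  have hρ0 : 0 < ρ := by positivity
  refine ⟨(K + 1) * (2 * (2 * a + 1)) * (4 / ρ ^ 2), by positivity, fun ξ l m hξ hl hm => ?_⟩
  rcases le_or_gt (2 * a) m with hma | hma
  · have : {σ : SO d | rotate σ ξ ∈ flatDirections a γ l m} = ∅ := by
      refine eq_empty_of_forall_notMem ?_
      rintro σ ⟨u, v, huv, huv', hlt, -⟩
      have h1 := huv (left_mem_Icc.2 huv')
      have h2 := huv (right_mem_Icc.2 huv')
      linarith [h1.1, h2.2]
    rw [this, measure_empty]
    exact zero_le
  set h : ℝ := min m r / 2 with hh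
  have hh0 : 0 < h := by positivity
  have hhr : h ≤ r := by
    have := min_le_right m r
    rw [hh]; linarith
  have hhm : 2 * h ≤ m := by
    have := min_le_left m r
    rw [hh]; linarith
  have hmh : m * ρ / 2 ≤ h := by
    rw [hh]
    gcongr
    refine le_min ?_ ?_
    · exact mul_le_of_le_one_right hm.le (min_le_left _ _)
    · calc m * ρ ≤ (2 * a) * (r / (2 * a)) := by
            gcongr
            exact min_le_right _ _
        _ = r := by field_simp
  set n : ℕ := ⌈2 * a / h⌉₊ with hn
  have hcover : {σ : SO d | rotate σ ξ ∈ flatDirections a γ l m} ⊆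
      ⋃ j ∈ Finset.range n, {σ | (-a + j * h + h ≤ a) ∧
        (|inner ℝ (tangent a γ (-a + j * h)) (rotate σ ξ)| ≤ l ∧
        |inner ℝ (tangent a γ (-a + j * h + h)) (rotate σ ξ)| ≤ l)} := by
    rintro σ ⟨u, v, huv, huv', hlt, hle⟩
    have hu := huv (left_mem_Icc.2 huv')
    have hv := huv (right_mem_Icc.2 huv')
    set j : ℕ := ⌈(u + a) / h⌉₊ with hj
    have hj1 : (u + a) / h ≤ j := Nat.le_ceil _
    have hj2 : (j : ℝ) < (u + a) / h + 1 :=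
      Nat.ceil_lt_add_one (div_nonneg (by linarith [hu.1]) hh0.le)
    rw [div_le_iff₀ hh0] at hj1
    have hj3 : j * h < u + a + h := by
      calc j * h < ((u + a) / h + 1) * h := by gcongr
        _ = u + a + h := by field_simp
    have hjn : j < n := by
      have : (j : ℝ) < 2 * a / h := by
        rw [lt_div_iff₀ hh0]
        linarith [hv.2]
      exact_mod_cast this.trans_le (Nat.le_ceil _)
    simp only [mem_iUnion, Finset.mem_range, mem_ofPred_eq]
    refine ⟨j, hjn, by linarith [hv.2], hle _ ⟨by linarith, by linarith⟩,
      hle _ ⟨by linarith, by linarith⟩⟩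
  refine (measure_mono hcover).trans ((measure_biUnion_finset_le _ _).trans ?_)
  have hterm : ∀ j ∈ Finset.range n, ν {σ : SO d | (-a + j * h + h ≤ a) ∧
        (|inner ℝ (tangent a γ (-a + j * h)) (rotate σ ξ)| ≤ l ∧
        |inner ℝ (tangent a γ (-a + j * h + h)) (rotate σ ξ)| ≤ l)} ≤
      ENNReal.ofReal (K * (2 * (l ^ 2 / h))) := by
    intro j _
    have hjh : 0 ≤ (j : ℝ) * h := by positivity
    by_cases hja : -a + j * h + h ≤ a
    · simp only [hja, true_and]
      exact hpair ξ l h _ hξ hl hh0 hhr ⟨by linarith, by linarith⟩ ⟨by linarith, by linarith⟩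
    · simp only [hja, false_and]
      simp
  refine (Finset.sum_le_sum hterm).trans ?_
  rw [Finset.sum_const, Finset.card_range, nsmul_eq_mul, ← ENNReal.ofReal_natCast,
    ← ENNReal.ofReal_mul (by positivity)]
  refine ENNReal.ofReal_le_ofReal ?_
  have hn1 : (n : ℝ) ≤ (2 * a + 1) / h := by
    have h1 : (n : ℝ) < 2 * a / h + 1 := Nat.ceil_lt_add_one (by positivity)
    have h2 : 1 ≤ 1 / h := by
      rw [one_le_div hh0]
      linarith
    rw [add_div]
    linarith
  calc (n : ℝ) * (K * (2 * (l ^ 2 / h))) ≤ (2 * a + 1) / h * ((K + 1) * (2 * (l ^ 2 / h))) := by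
        gcongr
        linarith
    _ = (K + 1) * (2 * (2 * a + 1)) * (l ^ 2 / h ^ 2) := by
        field_simp
    _ ≤ (K + 1) * (2 * (2 * a + 1)) * (l ^ 2 / (m * ρ / 2) ^ 2) := by
        gcongr
    _ = (K + 1) * (2 * (2 * a + 1)) * (4 / ρ ^ 2) * (l ^ 2 / m ^ 2) := by
        field_simp
        norm_num

/-- The Fourier transform on a sphere of radius `R` is in weak `L⁴`, with norm
comparable to `R ^ (-1/2)`. -/
theorem AdmissibleCurve.exists_haar_lt_norm_curveFourier_le (hd : 2 ≤ d) (ha : 0 < a)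
    (hγ : AdmissibleCurve a γ) :
    ∃ C > 0, ∀ (ξ : E d) (τ : ℝ), ξ ≠ 0 → 0 < τ →
      ν {σ | τ < ‖curveFourier a γ (rotate σ ξ)‖} ≤
        ENNReal.ofReal (C / ‖ξ‖ ^ 2 * (τ ^ 4)⁻¹) := by
  obtain ⟨A, hA, hdec⟩ := hγ.exists_norm_curveFourier_le ha
  obtain ⟨C, hC, hflat⟩ := hγ.exists_haar_flatDirections_le ν hd ha
  refine ⟨C * (16 * A ^ 4), by positivity, fun ξ τ hξ hτ => ?_⟩
  have hR : 0 < ‖ξ‖ := norm_pos_iff.2 hξ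
  set ω : E d := ‖ξ‖⁻¹ • ξ with hω
  have hω1 : ‖ω‖ = 1 := by rw [hω, norm_smul, norm_inv, norm_norm, inv_mul_cancel₀ hR.ne']
  have hξω : ξ = ‖ξ‖ • ω := by rw [hω, smul_smul, mul_inv_cancel₀ hR.ne', one_smul]
  -- the parameters for which the estimate off the flat directions is `τ`
  set m : ℝ := τ / (2 * A) with hm
  set l : ℝ := 2 * A / (τ * ‖ξ‖) with hl
  refine (measure_mono fun σ hσ => ?_).trans ((hflat ω l m hω1 (by positivity)
    (by positivity)).trans (le_of_eq ?_))
  · by_contra hcon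
    have h1 := hdec (rotate σ ω) ‖ξ‖ l m (by rw [norm_rotate, hω1]) hR (by positivity)
      (by positivity) hcon
    rw [← rotate_smul, ← hξω] at h1
    have e : A * (m + 1 / (l * ‖ξ‖)) = τ := by
      rw [hm, hl]
      field_simp
      ring
    rw [e] at h1
    exact absurd hσ (not_lt.2 h1)
  · congr 1
    rw [hm, hl]
    field_simp
    ring

end Haar

end Curve

/-- The part of the layer cake formula for `f ^ q` above the height `T`, for a function in weak `L⁴`
and `q < 4`. -/
theorem lintegral_rpow_le_of_weak_type {α : Type*} [MeasurableSpace α] (μ : Measure α) {f : α → ℝ}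
    (hf : AEMeasurable f μ) (hf0 : ∀ x, 0 ≤ f x) {A q T : ℝ} (hA : 0 ≤ A) (hq0 : 0 < q) (hq : q < 4)
    (hT : 0 < T) (hweak : ∀ τ, 0 < τ → μ {x | τ < f x} ≤ ENNReal.ofReal (A * (τ ^ 4)⁻¹)) :
    ∫⁻ x, ENNReal.ofReal (f x ^ q) ∂μ ≤
      ENNReal.ofReal (T ^ q) * μ univ + ENNReal.ofReal (q * A / (4 - q) * T ^ (q - 4)) := by
  rw [lintegral_rpow_eq_lintegral_meas_lt_mul μ (Filter.Eventually.of_forall hf0) hf hq0,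
    ← Ioc_union_Ioi_eq_Ioi hT.le, lintegral_union measurableSet_Ioi
      (disjoint_left.2 fun x hx hx' => absurd hx.2 (not_le.2 hx')), mul_add]
  refine add_le_add ?_ ?_
  · calc ENNReal.ofReal q * ∫⁻ t in Ioc 0 T, μ {x | t < f x} * ENNReal.ofReal (t ^ (q - 1))
        ≤ ENNReal.ofReal q * ∫⁻ t in Ioc 0 T, μ univ * ENNReal.ofReal (t ^ (q - 1)) := by
          gcongr
          exact subset_univ _
      _ = ENNReal.ofReal q * (μ univ * ENNReal.ofReal (T ^ q / q)) := by
          rw [lintegral_const_mul _ (by fun_prop)]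
          congr 2
          rw [← ofReal_integral_eq_lintegral_ofReal]
          · rw [← intervalIntegral.integral_of_le hT.le, integral_rpow (Or.inl (by linarith))]
            simp [Real.zero_rpow hq0.ne']
          · rw [← IntegrableOn, ← intervalIntegrable_iff_integrableOn_Ioc_of_le hT.le]
            exact intervalIntegral.intervalIntegrable_rpow' (by linarith)
          · filter_upwards [ae_restrict_mem measurableSet_Ioc] with t ht
            exact Real.rpow_nonneg ht.1.le _
      _ = ENNReal.ofReal (T ^ q) * μ univ := by
          have : T ^ q = q * (T ^ q / q) := by field_simp
          conv_rhs => rw [this]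
          rw [ENNReal.ofReal_mul hq0.le]
          ring
  · calc ENNReal.ofReal q * ∫⁻ t in Ioi T, μ {x | t < f x} * ENNReal.ofReal (t ^ (q - 1))
        ≤ ENNReal.ofReal q * ∫⁻ t in Ioi T, ENNReal.ofReal (A * t ^ (q - 5)) := by
          gcongr ENNReal.ofReal q * ?_
          refine setLIntegral_mono' measurableSet_Ioi fun t ht => ?_
          have ht0 : 0 < t := hT.trans ht
          refine (mul_le_mul_left (hweak t ht0) _).trans ?_
          rw [← ENNReal.ofReal_mul (by positivity)]
          refine ENNReal.ofReal_le_ofReal (le_of_eq ?_)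
          rw [mul_assoc]
          congr 1
          have : q - 5 = (q - 1) - (4 : ℕ) := by push_cast; ring
          rw [this, Real.rpow_sub_natCast ht0.ne']
          field_simp
      _ = ENNReal.ofReal (q * A / (4 - q) * T ^ (q - 4)) := by
          rw [← ofReal_integral_eq_lintegral_ofReal, ← ENNReal.ofReal_mul hq0.le]
          · congr 1
            rw [integral_const_mul, integral_Ioi_rpow_of_lt (by linarith) hT]
            have e : q - 5 + 1 = -(4 - q) := by ring
            rw [e, neg_div_neg_eq]
            have e' : -(4 - q) = q - 4 := by ring
            rw [e']
            ring
          · exact (integrableOn_Ioi_rpow_of_lt (by linarith) hT).const_mul A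
          · filter_upwards [ae_restrict_mem measurableSet_Ioi] with t ht
            exact mul_nonneg hA (Real.rpow_nonneg (hT.trans ht).le _)

/-- The average over rotations of a power, less than the fourth, of the Fourier transform. -/
theorem AdmissibleCurve.exists_lintegral_curveFourier_le {a : ℝ} {γ : ℝ → E d}
    [MeasurableSpace (SO d)] [BorelSpace (SO d)] (ν : Measure (SO d)) [ν.IsHaarMeasure]
    (hd : 2 ≤ d) (ha : 0 < a) (hγ : AdmissibleCurve a γ) {q : ℝ} (hq0 : 0 < q) (hq : q < 4) :
    ∃ C > 0, ∀ ξ : E d, ∫⁻ σ, ENNReal.ofReal (‖curveFourier a γ (rotate σ ξ)‖ ^ q) ∂ν ≤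
      ENNReal.ofReal (C * max 1 ‖ξ‖ ^ (-(q / 2))) := by
  obtain ⟨C, hC, hweak⟩ := hγ.exists_haar_lt_norm_curveFourier_le ν hd ha
  set V : ℝ := (ν univ).toReal with hV
  have hVe : ν univ = ENNReal.ofReal V := (ENNReal.ofReal_toReal (measure_ne_top ν _)).symm
  have hV0 : 0 ≤ V := ENNReal.toReal_nonneg
  refine ⟨(2 * a) ^ q * V + (V + q * C / (4 - q)) + 1, ?_, fun ξ => ?_⟩
  · have : 0 < 4 - q := by linarith
    positivity
  have h4 : 0 < 4 - q := by linarith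
  rcases le_or_gt ‖ξ‖ 1 with hξ | hξ
  · rw [max_eq_left hξ, Real.one_rpow, mul_one]
    calc ∫⁻ σ, ENNReal.ofReal (‖curveFourier a γ (rotate σ ξ)‖ ^ q) ∂ν
        ≤ ∫⁻ _, ENNReal.ofReal ((2 * a) ^ q) ∂ν := by
          refine lintegral_mono fun σ => ENNReal.ofReal_le_ofReal ?_
          exact Real.rpow_le_rpow (norm_nonneg _) (norm_curveFourier_le ha _) hq0.le
      _ = ENNReal.ofReal ((2 * a) ^ q * V) := by
          rw [lintegral_const, hVe, ENNReal.ofReal_mul (by positivity)]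
      _ ≤ _ := ENNReal.ofReal_le_ofReal (by
          have : 0 ≤ q * C / (4 - q) := by positivity
          linarith)
  · rw [max_eq_right hξ.le]
    have hR : 0 < ‖ξ‖ := by linarith
    have hmeas : Continuous fun σ : SO d => ‖curveFourier a γ (rotate σ ξ)‖ :=
      (hγ.continuous_curveFourier.comp
        (continuous_rotate.comp (continuous_id.prodMk continuous_const))).norm
    refine (lintegral_rpow_le_of_weak_type ν hmeas.aemeasurable (fun _ => norm_nonneg _)
      (A := C / ‖ξ‖ ^ 2) (q := q) (T := ‖ξ‖ ^ (-(1 / 2) : ℝ)) (by positivity) hq0 hq (by positivity)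
      fun τ hτ => hweak ξ τ (norm_pos_iff.1 hR) hτ).trans ?_
    rw [hVe, ← ENNReal.ofReal_mul (by positivity), ← ENNReal.ofReal_add (by positivity)
      (by positivity)]
    refine ENNReal.ofReal_le_ofReal ?_
    have e1 : (‖ξ‖ ^ (-(1 / 2) : ℝ)) ^ q = ‖ξ‖ ^ (-(q / 2)) := by
      rw [← Real.rpow_mul hR.le]
      congr 1
      ring
    have e2 : q * (C / ‖ξ‖ ^ 2) / (4 - q) * (‖ξ‖ ^ (-(1 / 2) : ℝ)) ^ (q - 4) =
        q * C / (4 - q) * ‖ξ‖ ^ (-(q / 2)) := by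
      rw [← Real.rpow_mul hR.le]
      have : -(1 / 2) * (q - 4) = -(q / 2) + (2 : ℕ) := by push_cast; ring
      rw [this, Real.rpow_add_natCast hR.ne']
      field_simp
    rw [e1, e2]
    have : 0 ≤ ‖ξ‖ ^ (-(q / 2)) := by positivity
    have : 0 ≤ (2 * a) ^ q * V * ‖ξ‖ ^ (-(q / 2)) := by positivity
    nlinarith

/-! ### Averages over the curve of functions with vanishing integrals along lines -/

/-- The function `y ↦ η y + (y · ∇) η y`. On each line through the origin it is the derivative of
`r ↦ r η(r θ)`, so that its integral vanishes if `η` has compact support. -/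
def lineDeriv (η : E d → ℝ) (y : E d) : ℝ := η y + fderiv ℝ η y y

theorem sum_geometric_le {r A τ : ℝ} (hr : 2 ≤ r) (hA : 0 ≤ A) (hτ : 0 ≤ τ) (n : ℕ) :
    ∑ k ∈ Finset.range n, (if r ^ k * τ ≤ A then r ^ k * τ else 0) ≤ 2 * A := by
  have h : ∑ k ∈ Finset.range n, (if r ^ k * τ ≤ A then r ^ k * τ else 0) ≤ 2 * A ∧
      ∑ k ∈ Finset.range n, (if r ^ k * τ ≤ A then r ^ k * τ else 0) ≤ r ^ n * τ := by
    induction n with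
    | zero => simpa using ⟨hA, hτ⟩
    | succ n ih =>
      rw [Finset.sum_range_succ]
      have hp : 0 ≤ r ^ n * τ := by positivity
      have hs : 2 * (r ^ n * τ) ≤ r ^ (n + 1) * τ := by
        rw [pow_succ]
        nlinarith
      split_ifs with h
      · exact ⟨by linarith [ih.2], by linarith [ih.2]⟩
      · exact ⟨by linarith [ih.1], by linarith [ih.2]⟩
  exact h.1

/-- The companion of `sum_geometric_le` for the reciprocals of the large terms. -/
theorem sum_geometric_inv_le {τ : ℝ} (hτ : 0 < τ) (n : ℕ) :
    ∑ k ∈ Finset.range n, (if (2 : ℝ) ^ k * τ ≤ 1 then 0 else ((2 : ℝ) ^ k * τ)⁻¹) ≤ 2 := by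
  have h : ∑ k ∈ Finset.range n, (if (2 : ℝ) ^ k * τ ≤ 1 then 0 else ((2 : ℝ) ^ k * τ)⁻¹) ≤
      max 0 (2 - 2 * ((2 : ℝ) ^ n * τ)⁻¹) := by
    induction n with
    | zero => simp
    | succ n ih =>
      rw [Finset.sum_range_succ]
      have hp : 0 < (2 : ℝ) ^ n * τ := by positivity
      have e : 2 * ((2 : ℝ) ^ (n + 1) * τ)⁻¹ = ((2 : ℝ) ^ n * τ)⁻¹ := by
        rw [pow_succ]
        field_simp
      rw [e]
      split_ifs with h
      · have h1 : 1 ≤ ((2 : ℝ) ^ n * τ)⁻¹ := (one_le_inv₀ hp).2 h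
        rw [max_eq_left (by linarith)] at ih
        rw [add_zero]
        exact ih.trans (le_max_left _ _)
      · have h1 : ((2 : ℝ) ^ n * τ)⁻¹ < 1 := inv_lt_one_of_one_lt₀ (not_le.1 h)
        refine le_max_of_le_right ?_
        rcases max_cases 0 (2 - 2 * ((2 : ℝ) ^ n * τ)⁻¹) with ⟨hm, -⟩ | ⟨hm, -⟩ <;>
          rw [hm] at ih <;> linarith
  refine h.trans (max_le zero_le_two ?_)
  have : 0 < ((2 : ℝ) ^ n * τ)⁻¹ := by positivity
  linarith

/-- A short arc: the curve does not come back to itself, and satisfies a Taylor estimate of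
order two. -/
structure IsShortArc (c M : ℝ) (δ δ₁ : ℝ → E d) (b e : ℝ) : Prop where
  deriv : ∀ t ∈ Icc b e, HasDerivWithinAt δ (δ₁ t) (Icc b e) t
  cont : ContinuousOn δ₁ (Icc b e)
  chord : ∀ t ∈ Icc b e, ∀ t' ∈ Icc b e, c * |t - t'| ≤ ‖δ t - δ t'‖
  taylor : ∀ t ∈ Icc b e, ∀ t' ∈ Icc b e, ‖δ t - δ t' - (t - t') • δ₁ t‖ ≤ M * (t - t') ^ 2

section

variable {δ δ₁ : ℝ → E d} {b e c M K : ℝ} {η : E d → ℝ}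

/-- The average of a dilate of `lineDeriv η` over a short arc. If `t₀` is the parameter of the point
of the arc closest to `x`, the derivative of `(t - t₀) η(s (x - δ t))` is subtracted; the
remainder is small because `δ t` is close to its tangent line at `t₀`, and because the distance from
`x` to the arc cannot exceed `1 / s`. -/
theorem IsShortArc.norm_integral_lineDeriv_le (hδ : IsShortArc c M δ δ₁ b e) (hbe : b ≤ e)
    (hc : 0 < c) (hM : 0 ≤ M) (hη : ContDiff ℝ 1 η) (hK : 0 ≤ K) (hb : ∀ y, |η y| ≤ K)
    (hb' : ∀ y, ‖fderiv ℝ η y‖ ≤ K) (hsupp : ∀ y, 1 < ‖y‖ → η y = 0 ∧ fderiv ℝ η y = 0)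
    (x : E d) :
    ∃ τ₁ τ₂ ρ : ℝ, 0 ≤ τ₁ ∧ 0 ≤ τ₂ ∧ 0 ≤ ρ ∧ ∀ s : ℝ, 0 < s →
      s * |∫ t in b..e, lineDeriv η (s • (x - δ t))| ≤
        K * ((if s * τ₁ ≤ 2 / c then s * τ₁ else 0) + (if s * τ₂ ≤ 2 / c then s * τ₂ else 0)) +
        4 * K / c * ((if s * ρ ≤ 1 then s * ρ else 0) + 4 * M / c ^ 2 * s⁻¹) := by
  have hcδ : ContinuousOn δ (Icc b e) := fun t ht => (hδ.deriv t ht).continuousWithinAt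
  obtain ⟨t₀, ht₀, hmin⟩ := isCompact_Icc.exists_isMinOn (nonempty_Icc.2 hbe)
    (continuousOn_const.sub hcδ).norm (f := fun t => ‖x - δ t‖)
  set ρ := ‖x - δ t₀‖ with hρ
  have hρt : ∀ t ∈ Icc b e, ρ ≤ ‖x - δ t‖ := fun t ht => hmin ht
  refine ⟨|e - t₀|, |b - t₀|, ρ, abs_nonneg _, abs_nonneg _, norm_nonneg _, fun s hs => ?_⟩
  have hnear : ∀ t ∈ Icc b e, ‖s • (x - δ t)‖ ≤ 1 → s * ρ ≤ 1 ∧ s * |t - t₀| ≤ 2 / c := by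
    intro t ht hle
    rw [norm_smul, Real.norm_eq_abs, abs_of_pos hs] at hle
    have h1 := hρt t ht
    refine ⟨(mul_le_mul_of_nonneg_left h1 hs.le).trans hle, ?_⟩
    rw [le_div_iff₀ hc]
    have h2 : ‖δ t - δ t₀‖ ≤ ‖x - δ t‖ + ρ := by
      have : δ t - δ t₀ = (x - δ t₀) - (x - δ t) := by abel
      rw [this, add_comm]
      exact norm_sub_le _ _
    have h3 := hδ.chord t ht t₀ ht₀
    nlinarith
  set X : ℝ → E d := fun t => s • (x - δ t) with hX
  have hcX : ContinuousOn X (Icc b e) := (continuousOn_const.sub hcδ).const_smul s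
  have hcη : ContinuousOn (fun t => η (X t)) (Icc b e) := hη.continuous.comp_continuousOn hcX
  have hcD : ContinuousOn (fun t => fderiv ℝ η (X t)) (Icc b e) :=
    (hη.continuous_fderiv one_ne_zero).comp_continuousOn hcX
  set F : ℝ → ℝ := fun t => (t - t₀) * η (X t) with hF
  set F' : ℝ → ℝ := fun t => η (X t) + (t - t₀) * fderiv ℝ η (X t) (-(s • δ₁ t)) with hF'
  set H : ℝ → ℝ := fun t => s * fderiv ℝ η (X t) ((x - δ t) + (t - t₀) • δ₁ t) with hH
  have hcF : ContinuousOn F (Icc b e) := (continuousOn_id.sub continuousOn_const).mul hcη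
  have hcF' : ContinuousOn F' (Icc b e) := hcη.add ((continuousOn_id.sub continuousOn_const).mul
    (hcD.clm_apply (hδ.cont.const_smul s).neg))
  have hcH : ContinuousOn H (Icc b e) := continuousOn_const.mul (hcD.clm_apply
    ((continuousOn_const.sub hcδ).add ((continuousOn_id.sub continuousOn_const).smul hδ.cont)))
  have hder : ∀ t ∈ Ioo b e, HasDerivAt F (F' t) t := by
    intro t ht
    have d1 := (hδ.deriv t (Ioo_subset_Icc_self ht)).hasDerivAt (Icc_mem_nhds ht.1 ht.2)
    have d2 : HasDerivAt X (-(s • δ₁ t)) t := by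
      refine ((d1.const_sub x).const_smul s).congr_deriv ?_
      rw [smul_neg]
    have d3 := ((hη.differentiable one_ne_zero (X t)).hasFDerivAt).comp_hasDerivAt t d2
    have d4 := ((hasDerivAt_id t).sub_const t₀).mul d3
    refine d4.congr_deriv ?_
    simp [hF']
  have hI : ∀ t, lineDeriv η (X t) = F' t + H t := by
    intro t
    simp only [lineDeriv, hF', hH]
    have : X t = s • (x - δ t) := rfl
    conv_lhs => rw [show fderiv ℝ η (X t) (X t) = fderiv ℝ η (X t) (s • (x - δ t)) from rfl]
    simp only [map_smul, map_neg, map_add, smul_eq_mul]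
    ring
  have hFTC := intervalIntegral.integral_eq_sub_of_hasDerivAt_of_le hbe hcF hder
    (hcF'.intervalIntegrable_of_Icc hbe)
  have hsplit : ∫ t in b..e, lineDeriv η (s • (x - δ t)) = F e - F b + ∫ t in b..e, H t := by
    rw [← hFTC, ← intervalIntegral.integral_add (hcF'.intervalIntegrable_of_Icc hbe)
      (hcH.intervalIntegrable_of_Icc hbe)]
    exact intervalIntegral.integral_congr fun t _ => hI t
  have hbdry : ∀ t ∈ Icc b e, s * |F t| ≤
      K * (if s * |t - t₀| ≤ 2 / c then s * |t - t₀| else 0) := by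
    intro t ht
    rcases le_or_gt ‖X t‖ 1 with hle | hgt
    · rw [if_pos (hnear t ht hle).2, hF]
      simp only
      rw [abs_mul]
      have := mul_le_mul_of_nonneg_left (hb (X t)) (by positivity : 0 ≤ s * |t - t₀|)
      linarith
    · rw [hF]
      simp only
      rw [(hsupp _ hgt).1, mul_zero, abs_zero, mul_zero]
      split_ifs <;> positivity
  set r : ℝ := 2 / c / s with hr
  have hr0 : 0 < r := by positivity
  have hHb : s * |∫ t in b..e, H t| ≤
      4 * K / c * ((if s * ρ ≤ 1 then s * ρ else 0) + 4 * M / c ^ 2 * s⁻¹) := by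
    by_cases hsρ : s * ρ ≤ 1
    · rw [if_pos hsρ]
      set L : ℝ := s * (K * (ρ + M * r ^ 2)) with hL
      have hL0 : 0 ≤ L := by positivity
      set g : ℝ → ℝ := (Icc (t₀ - r) (t₀ + r)).indicator fun _ => L with hg
      have hgi : Integrable g volume :=
        (integrable_indicator_iff measurableSet_Icc).2 (integrableOn_const (by simp))
      have hg0 : ∀ t, 0 ≤ g t := fun t => indicator_nonneg (fun _ _ => hL0) t
      have hle : ‖∫ t in b..e, H t‖ ≤ ∫ t in b..e, g t := by
        refine intervalIntegral.norm_integral_le_of_norm_le hbe ?_ hgi.intervalIntegrable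
        refine Filter.Eventually.of_forall fun t ht => ?_
        have ht' := Ioc_subset_Icc_self ht
        rcases le_or_gt ‖X t‖ 1 with hle | hgt
        · have hn := (hnear t ht' hle).2
          have htr : |t - t₀| ≤ r := by
            rw [hr, le_div_iff₀ hs, mul_comm]
            exact hn
          have htm : t ∈ Icc (t₀ - r) (t₀ + r) := by
            have := abs_le.1 htr
            constructor <;> linarith
          rw [hg, indicator_of_mem htm, hH]
          simp only [norm_mul, Real.norm_eq_abs, abs_of_pos hs]
          rw [hL]
          refine mul_le_mul_of_nonneg_left ?_ hs.le
          rw [← Real.norm_eq_abs]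
          refine (ContinuousLinearMap.le_opNorm _ _).trans ?_
          refine mul_le_mul (hb' _) ?_ (norm_nonneg _) hK
          have e1 : (x - δ t) + (t - t₀) • δ₁ t =
              (x - δ t₀) - (δ t - δ t₀ - (t - t₀) • δ₁ t) := by abel
          rw [e1]
          refine (norm_sub_le _ _).trans (add_le_add le_rfl
            ((hδ.taylor t ht' t₀ ht₀).trans ?_))
          refine mul_le_mul_of_nonneg_left ?_ hM
          rw [← sq_abs (t - t₀)]
          gcongr
        · rw [hH]
          simp only
          rw [(hsupp _ hgt).2]
          simpa using hg0 t
      have hint : ∫ t in b..e, g t ≤ 2 * r * L := by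
        rw [intervalIntegral.integral_of_le hbe]
        refine (setIntegral_le_integral hgi (Filter.Eventually.of_forall hg0)).trans ?_
        rw [hg, integral_indicator measurableSet_Icc, setIntegral_const, measureReal_def,
          Real.volume_Icc, ENNReal.toReal_ofReal (by linarith), smul_eq_mul]
        refine le_of_eq ?_
        ring
      rw [Real.norm_eq_abs] at hle
      calc s * |∫ t in b..e, H t| ≤ s * (2 * r * L) :=
            mul_le_mul_of_nonneg_left (hle.trans hint) hs.le
        _ = _ := by
            rw [hL, hr]
            field_simp
            ring
    · rw [if_neg hsρ]
      have : ∫ t in b..e, H t = 0 := by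
        rw [intervalIntegral.integral_congr (g := fun _ => (0 : ℝ))]
        · simp
        · intro t ht
          rw [uIcc_of_le hbe] at ht
          have hgt : 1 < ‖X t‖ := by
            by_contra hcon
            exact hsρ (hnear t ht (not_lt.1 hcon)).1
          simp only [hH]
          rw [(hsupp _ hgt).2]
          simp
      rw [this, abs_zero, mul_zero]
      positivity
  rw [hsplit]
  calc s * |F e - F b + ∫ t in b..e, H t|
      ≤ s * (|F e| + |F b| + |∫ t in b..e, H t|) := by
        refine mul_le_mul_of_nonneg_left ?_ hs.le
        exact (abs_add_le _ _).trans (by gcongr; exact abs_sub _ _)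
    _ = s * |F e| + s * |F b| + s * |∫ t in b..e, H t| := by ring
    _ ≤ _ := by
        have i1 := hbdry e (right_mem_Icc.2 hbe)
        have i2 := hbdry b (left_mem_Icc.2 hbe)
        rw [mul_add K]
        linarith

/-- The averages over a short arc of the dilates by powers of four of `lineDeriv η` are uniformly
summable. -/
theorem IsShortArc.sum_integral_lineDeriv_le (hδ : IsShortArc c M δ δ₁ b e) (hbe : b ≤ e)
    (hc : 0 < c) (hM : 0 ≤ M) (hη : ContDiff ℝ 1 η) (hK : 0 ≤ K) (hb : ∀ y, |η y| ≤ K)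
    (hb' : ∀ y, ‖fderiv ℝ η y‖ ≤ K) (hsupp : ∀ y, 1 < ‖y‖ → η y = 0 ∧ fderiv ℝ η y = 0)
    (x : E d) (n : ℕ) :
    ∑ k ∈ Finset.range n, 4 ^ k * |∫ t in b..e, lineDeriv η ((4 : ℝ) ^ k • (x - δ t))| ≤
      K * (8 / c) + 4 * K / c * (2 + 4 * M / c ^ 2 * 2) := by
  obtain ⟨τ₁, τ₂, ρ, hτ₁, hτ₂, hρ, h⟩ :=
    hδ.norm_integral_lineDeriv_le hbe hc hM hη hK hb hb' hsupp x
  refine (Finset.sum_le_sum fun k _ => h ((4 : ℝ) ^ k) (by positivity)).trans ?_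
  rw [Finset.sum_add_distrib, ← Finset.mul_sum, ← Finset.mul_sum, Finset.sum_add_distrib,
    Finset.sum_add_distrib, ← Finset.mul_sum]
  have s1 := sum_geometric_le (r := 4) (by norm_num) (A := 2 / c) (by positivity) hτ₁ n
  have s2 := sum_geometric_le (r := 4) (by norm_num) (A := 2 / c) (by positivity) hτ₂ n
  have s3 := sum_geometric_le (r := 4) (by norm_num) zero_le_one hρ n
  have s4 : ∑ k ∈ Finset.range n, ((4 : ℝ) ^ k)⁻¹ ≤ 2 := by
    have := sum_geometric_two_le n
    refine le_trans (Finset.sum_le_sum fun k _ => ?_) this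
    rw [one_div, inv_pow]
    gcongr
    norm_num
  have s5 : 2 * (2 / c) + 2 * (2 / c) = 8 / c := by ring
  gcongr
  · linarith
  · linarith

end

/-- The curve is a finite union of short arcs, with constants which are invariant under rotations. -/
theorem AdmissibleCurve.exists_shortArc {a : ℝ} {γ : ℝ → E d} (ha : 0 < a)
    (hγ : AdmissibleCurve a γ) :
    ∃ c > 0, ∃ M ≥ 0, ∃ r > 0, ∀ b e, -a ≤ b → b ≤ e → e ≤ a → e - b ≤ r →
      IsShortArc c M γ (tangent a γ) b e := by
  obtain ⟨M, hM⟩ := isCompact_Icc.exists_bound_of_continuousOn (hγ.continuousOn_accel ha)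
  have h0 : (0 : ℝ) ∈ Icc (-a) a := by constructor <;> linarith
  have hM0 : 0 ≤ M := (norm_nonneg _).trans (hM 0 h0)
  obtain ⟨t₀, ht₀, hmin⟩ := isCompact_Icc.exists_isMinOn ⟨0, h0⟩ (hγ.continuousOn_tangent ha).norm
  set m := ‖tangent a γ t₀‖ with hm
  have hm0 : 0 < m := by
    rw [hm, norm_pos_iff]
    exact (hγ.curvature t₀ ht₀).ne_zero 0
  have hmt : ∀ t ∈ Icc (-a) a, m ≤ ‖tangent a γ t‖ := fun t ht => hmin ht
  refine ⟨m / 2, by positivity, M, hM0, m / (2 * (M + 1)), by positivity,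
    fun b e hb hbe he her => ?_⟩
  have hsub : Icc b e ⊆ Icc (-a) a := Icc_subset_Icc hb he
  have hlip : ∀ t ∈ Icc (-a) a, ∀ t' ∈ Icc (-a) a,
      ‖tangent a γ t - tangent a γ t'‖ ≤ M * |t - t'| := by
    intro t ht t' ht'
    have := (convex_Icc (-a) a).norm_image_sub_le_of_norm_hasDerivWithin_le
      (fun s hs => hγ.hasDerivWithinAt_tangent ha hs) hM ht' ht
    rwa [Real.norm_eq_abs] at this
  have htaylor : ∀ t ∈ Icc (-a) a, ∀ t' ∈ Icc (-a) a,
      ‖γ t - γ t' - (t - t') • tangent a γ t‖ ≤ M * (t - t') ^ 2 := by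
    intro t ht t' ht'
    have hs' : uIcc t' t ⊆ Icc (-a) a :=
      ordConnected_Icc.uIcc_subset ht' ht
    have := (convex_uIcc t' t).norm_image_sub_le_of_norm_hasDerivWithin_le
      (f := fun s => γ s - s • tangent a γ t) (f' := fun s => tangent a γ s - tangent a γ t)
      (C := M * |t - t'|)
      (fun s hs => ((hγ.hasDerivWithinAt (hs' hs)).mono hs').sub (by
        simpa using (hasDerivWithinAt_id s (uIcc t' t)).smul_const (tangent a γ t)))
      (fun s hs => (hlip s (hs' hs) t ht).trans (by
        gcongr M * ?_
        rw [abs_sub_comm s t]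
        exact abs_sub_right_of_mem_uIcc hs))
      left_mem_uIcc right_mem_uIcc
    have e1 : γ t - γ t' - (t - t') • tangent a γ t =
        (γ t - t • tangent a γ t) - (γ t' - t' • tangent a γ t) := by
      rw [sub_smul]
      abel
    rw [e1]
    refine this.trans (le_of_eq ?_)
    rw [Real.norm_eq_abs, mul_assoc, ← sq, sq_abs]
  refine ⟨fun t ht => (hγ.hasDerivWithinAt (hsub ht)).mono hsub,
    (hγ.continuousOn_tangent ha).mono hsub, fun t ht t' ht' => ?_,
    fun t ht t' ht' => htaylor t (hsub ht) t' (hsub ht')⟩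
  have h1 := htaylor t (hsub ht) t' (hsub ht')
  have h2 : ‖(t - t') • tangent a γ t‖ ≤ ‖γ t - γ t'‖ + ‖γ t - γ t' - (t - t') • tangent a γ t‖ := by
    have : (t - t') • tangent a γ t =
        (γ t - γ t') - (γ t - γ t' - (t - t') • tangent a γ t) := by abel
    nth_rewrite 1 [this]
    exact norm_sub_le _ _
  rw [norm_smul, Real.norm_eq_abs] at h2
  have h3 : |t - t'| ≤ m / (2 * (M + 1)) :=
    (abs_sub_le_of_le_of_le ht.1 ht.2 ht'.1 ht'.2).trans her
  have h4 : M * (t - t') ^ 2 ≤ m / 2 * |t - t'| := by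
    rw [← sq_abs, sq, ← mul_assoc]
    gcongr
    calc M * |t - t'| ≤ M * (m / (2 * (M + 1))) := by gcongr
      _ ≤ m / 2 := by
        rw [← mul_div_assoc, div_le_div_iff₀ (by positivity) (by norm_num)]
        nlinarith
  have h5 := mul_le_mul_of_nonneg_left (hmt t (hsub ht)) (abs_nonneg (t - t'))
  linarith

theorem IsShortArc.rotate {c M : ℝ} {δ δ₁ : ℝ → E d} {b e : ℝ} (hδ : IsShortArc c M δ δ₁ b e)
    (σ : SO d) :
    IsShortArc c M (fun t => RotatedCurve.rotate σ (δ t)) (fun t => RotatedCurve.rotate σ (δ₁ t))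
      b e where
  deriv t ht :=
    ((rotateIsometry σ).toContinuousLinearEquiv.hasFDerivAt (x := δ t)).comp_hasDerivWithinAt t
      (hδ.deriv t ht)
  cont := (rotateIsometry σ).continuous.comp_continuousOn hδ.cont
  chord t ht t' ht' := by
    rw [← rotate_sub, norm_rotate]
    exact hδ.chord t ht t' ht'
  taylor t ht t' ht' := by
    rw [← rotate_sub, ← rotate_smul, ← rotate_sub, norm_rotate]
    exact hδ.taylor t ht t' ht'

/-- The averages over a rotated curve of the dilates by powers of four of `lineDeriv η` are
summable, uniformly in the rotation and in the position. -/
theorem AdmissibleCurve.exists_sum_integral_lineDeriv_le {a : ℝ} {γ : ℝ → E d} (ha : 0 < a)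
    (hγ : AdmissibleCurve a γ) {η : E d → ℝ} (hη : ContDiff ℝ 1 η) {K : ℝ} (hb : ∀ y, |η y| ≤ K)
    (hb' : ∀ y, ‖fderiv ℝ η y‖ ≤ K) (hsupp : ∀ y, 1 < ‖y‖ → η y = 0 ∧ fderiv ℝ η y = 0) :
    ∃ C > 0, ∀ (σ : SO d) (x : E d) (n : ℕ), ∑ k ∈ Finset.range n,
      4 ^ k * |∫ t in Icc (-a) a, lineDeriv η ((4 : ℝ) ^ k • (x - rotate σ (γ t)))| ≤ C := by
  obtain ⟨c, hc, M, hM, r, hr, harc⟩ := hγ.exists_shortArc ha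
  have hK : 0 ≤ K := (abs_nonneg _).trans (hb 0)
  set C₁ : ℝ := K * (8 / c) + 4 * K / c * (2 + 4 * M / c ^ 2 * 2) with hC₁
  set m : ℕ := ⌈2 * a / r⌉₊ + 1 with hm
  have hm0 : (0 : ℝ) < m := by positivity
  set p : ℕ → ℝ := fun j => -a + j * (2 * a / m) with hp
  have hp0 : p 0 = -a := by simp [hp]
  have hpm : p m = a := by
    simp only [hp]
    field_simp
    ring
  have hstep : ∀ j, p (j + 1) - p j = 2 * a / m := fun j => by
    simp only [hp]
    push_cast
    ring
  have hmono : Monotone p := monotone_nat_of_le_succ fun j => by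
    have := hstep j
    have : 0 ≤ 2 * a / m := by positivity
    linarith
  have hsm : 2 * a / m ≤ r := by
    rw [div_le_iff₀ hm0, mul_comm r, ← div_le_iff₀ hr]
    refine (Nat.le_ceil _).trans ?_
    rw [hm]
    push_cast
    linarith
  refine ⟨m * C₁ + 1, by positivity, fun σ x n => ?_⟩
  have hcγ : ContinuousOn (fun t => rotate σ (γ t)) (Icc (-a) a) :=
    (rotateIsometry σ).continuous.comp_continuousOn hγ.continuousOn
  have hlc : Continuous (lineDeriv η) :=
    hη.continuous.add ((hη.continuous_fderiv one_ne_zero).clm_apply continuous_id)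
  have hint : ∀ k : ℕ, ∀ j < m, IntervalIntegrable
      (fun t => lineDeriv η ((4 : ℝ) ^ k • (x - rotate σ (γ t)))) volume (p j) (p (j + 1)) := by
    intro k j hj
    refine ContinuousOn.intervalIntegrable_of_Icc (hmono j.le_succ) ?_
    have hX : ContinuousOn (fun t => (4 : ℝ) ^ k • (x - rotate σ (γ t))) (Icc (-a) a) :=
      (continuousOn_const.sub hcγ).const_smul ((4 : ℝ) ^ k)
    refine hlc.comp_continuousOn (hX.mono ?_)
    exact Icc_subset_Icc (hp0 ▸ hmono (Nat.zero_le j)) (hpm ▸ hmono hj)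
  have hsplit : ∀ k : ℕ,
      4 ^ k * |∫ t in Icc (-a) a, lineDeriv η ((4 : ℝ) ^ k • (x - rotate σ (γ t)))| ≤
      ∑ j ∈ Finset.range m, 4 ^ k *
        |∫ t in (p j)..(p (j + 1)), lineDeriv η ((4 : ℝ) ^ k • (x - rotate σ (γ t)))| := by
    intro k
    have := intervalIntegral.sum_integral_adjacent_intervals (hint k)
    rw [hp0, hpm, intervalIntegral.integral_of_le (by linarith)] at this
    rw [integral_Icc_eq_integral_Ioc, ← this, ← Finset.mul_sum]
    gcongr
    exact Finset.abs_sum_le_sum_abs _ _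
  calc ∑ k ∈ Finset.range n,
      4 ^ k * |∫ t in Icc (-a) a, lineDeriv η ((4 : ℝ) ^ k • (x - rotate σ (γ t)))|
      ≤ ∑ k ∈ Finset.range n, ∑ j ∈ Finset.range m, 4 ^ k *
        |∫ t in (p j)..(p (j + 1)), lineDeriv η ((4 : ℝ) ^ k • (x - rotate σ (γ t)))| :=
        Finset.sum_le_sum fun k _ => hsplit k
    _ = ∑ j ∈ Finset.range m, ∑ k ∈ Finset.range n, 4 ^ k *
        |∫ t in (p j)..(p (j + 1)), lineDeriv η ((4 : ℝ) ^ k • (x - rotate σ (γ t)))| :=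
        Finset.sum_comm
    _ ≤ ∑ j ∈ Finset.range m, C₁ := by
        refine Finset.sum_le_sum fun j hj => ?_
        have hj' := Finset.mem_range.1 hj
        refine ((harc (p j) (p (j + 1)) (hp0 ▸ hmono (Nat.zero_le j)) (hmono j.le_succ)
          (hpm ▸ hmono hj') ((hstep j).le.trans hsm)).rotate σ).sum_integral_lineDeriv_le
          (hmono j.le_succ) hc hM hη hK hb hb' hsupp x n
    _ = m * C₁ := by rw [Finset.sum_const, Finset.card_range, nsmul_eq_mul]
    _ ≤ m * C₁ + 1 := by linarith

section FourierAnalysis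

open scoped FourierTransform SchwartzMap Convolution ContDiff

/-! ### Plancherel's theorem and averages over rotated curves -/

theorem continuous_fourier_of_integrable {f : E d → ℂ} (hf : Integrable f) : Continuous (𝓕 f) :=
  VectorFourier.fourierIntegral_continuous Real.continuous_fourierChar
    (L := innerₗ (E d)) continuous_inner hf

theorem integral_fourier_mul_eq {f g : E d → ℂ} (hf : Integrable f) (hg : Integrable g) :
    ∫ ξ, 𝓕 f ξ * g ξ = ∫ x, f x * 𝓕 g x := by
  have := VectorFourier.integral_fourierIntegral_smul_eq_flip (μ := volume) (ν := volume)
    (L := innerₗ (E d)) Real.continuous_fourierChar continuous_inner hf hg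
  rw [flip_innerₗ] at this
  exact this

/-- On integrable functions, the Fourier transform on `L²` is given by the Fourier integral. -/
theorem fourier_toLp_ae_eq {f : E d → ℂ} (hf : Integrable f) (hf2 : MemLp f 2) :
    (𝓕 (hf2.toLp f) : Lp ℂ 2 (volume : Measure (E d))) =ᵐ[volume] 𝓕 f := by
  set F : Lp ℂ 2 (volume : Measure (E d)) := 𝓕 (hf2.toLp f) with hF
  have hFl : LocallyIntegrable F (volume : Measure (E d)) :=
    (Lp.memLp F).locallyIntegrable one_le_two
  have hfl : LocallyIntegrable (𝓕 f) (volume : Measure (E d)) :=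
    (continuous_fourier_of_integrable hf).locallyIntegrable
  have key : ∀ᵐ x ∂(volume : Measure (E d)), F x - 𝓕 f x = 0 := by
    refine ae_eq_zero_of_integral_contDiff_smul_eq_zero (hFl.sub hfl) fun g hg hgc => ?_
    have hg₁ : HasCompactSupport (Complex.ofRealCLM ∘ g) := hgc.comp_left rfl
    have hg₂ : ContDiff ℝ ∞ (Complex.ofRealCLM ∘ g) := by fun_prop
    set G : 𝓢(E d, ℂ) := hg₁.toSchwartzMap hg₂ with hG
    have hGg : ∀ x, G x = (g x : ℂ) := fun x => rfl
    have h1 := congrArg (fun L : 𝓢'(E d, ℂ) => L G)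
      (Lp.fourier_toTemperedDistribution_eq (hf2.toLp f))
    simp only [TemperedDistribution.fourier_apply, Lp.toTemperedDistribution_apply] at h1
    have h2 : ∫ x, (𝓕 G) x • (hf2.toLp f) x = ∫ x, f x * 𝓕 (G : E d → ℂ) x := by
      refine integral_congr_ae ?_
      filter_upwards [hf2.coeFn_toLp] with x hx
      rw [hx, smul_eq_mul, mul_comm, SchwartzMap.fourier_coe]
    rw [h2, ← integral_fourier_mul_eq hf G.integrable] at h1
    have i1 : Integrable fun x => g x • F x :=
      hFl.integrable_smul_left_of_hasCompactSupport hg.continuous hgc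
    have i2 : Integrable fun x => g x • 𝓕 f x :=
      hfl.integrable_smul_left_of_hasCompactSupport hg.continuous hgc
    have e : (fun x => g x • (F x - 𝓕 f x)) = fun x => g x • F x - g x • 𝓕 f x := by
      funext x
      rw [smul_sub]
    rw [e, integral_sub i1 i2, sub_eq_zero]
    have e1 : ∫ x, g x • F x = ∫ x, G x • F x := rfl
    have e2 : ∫ x, g x • 𝓕 f x = ∫ x, 𝓕 f x * G x := by
      congr 1
      funext x
      rw [hGg, Complex.real_smul, mul_comm]
    rw [e1, e2, ← h1]
  filter_upwards [key] with x hx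
  exact sub_eq_zero.1 hx

/-- Plancherel's theorem for functions in `L¹ ∩ L²`. -/
theorem lintegral_enorm_fourier_sq {f : E d → ℂ} (hf : Integrable f) (hf2 : MemLp f 2) :
    ∫⁻ ξ, ‖𝓕 f ξ‖ₑ ^ 2 = ∫⁻ x, ‖f x‖ₑ ^ 2 := by
  have h1 : eLpNorm (𝓕 f) 2 (volume : Measure (E d)) = eLpNorm f 2 volume := by
    rw [← eLpNorm_congr_ae (fourier_toLp_ae_eq hf hf2), ← eLpNorm_congr_ae hf2.coeFn_toLp]
    have := Lp.norm_fourier_eq (hf2.toLp f)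
    rw [Lp.norm_def, Lp.norm_def, ENNReal.toReal_eq_toReal_iff' (Lp.eLpNorm_ne_top _)
      (Lp.eLpNorm_ne_top _)] at this
    exact this
  have h2 : ∀ g : E d → ℂ, ∫⁻ x, ‖g x‖ₑ ^ 2 = eLpNorm g 2 volume ^ 2 := by
    intro g
    rw [eLpNorm_eq_lintegral_rpow_enorm_toReal two_ne_zero ENNReal.ofNat_ne_top]
    simp only [ENNReal.toReal_ofNat, ENNReal.rpow_two]
    rw [← ENNReal.rpow_two, ← ENNReal.rpow_mul]
    simp
  rw [h2, h2, h1]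

/-- The average `∫ H(x - σ⁻¹ γ(t)) dt` of a function over a rotated curve. -/
def curveAverage (a : ℝ) (γ : ℝ → E d) (H : E d → ℂ) (σ : SO d) (x : E d) : ℂ :=
  ∫ t in Icc (-a) a, H (x - rotate σ⁻¹ (γ t))

section Average

variable {a : ℝ} {γ : ℝ → E d}

theorem continuous_arg (hγ : Continuous γ) :
    Continuous fun q : (SO d × E d) × ℝ => q.1.2 - rotate q.1.1⁻¹ (γ q.2) := by
  have h : Continuous fun q : (SO d × E d) × ℝ => ((q.1.1, γ q.2) : SO d × E d) :=
    (continuous_fst.comp continuous_fst).prodMk (hγ.comp continuous_snd)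
  have h' := Continuous.comp (continuous_rotate_inv (d := d)) h
  exact (continuous_snd.comp continuous_fst).sub h'

theorem norm_curveAverage_le (ha : 0 < a) {H : E d → ℂ} {B : ℝ} (hB : ∀ x, ‖H x‖ ≤ B) (σ : SO d)
    (x : E d) : ‖curveAverage a γ H σ x‖ ≤ 2 * a * B := by
  refine (norm_setIntegral_le_of_norm_le_const (C := B) (by simp) fun t _ => hB _).trans
    (le_of_eq ?_)
  rw [measureReal_def, Real.volume_Icc, ENNReal.toReal_ofReal]
  · ring
  · linarith

theorem continuous_curveAverage (hγ : Continuous γ) {H : E d → ℂ} (hH : Continuous H) {B : ℝ}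
    (hB : ∀ x, ‖H x‖ ≤ B) : Continuous fun q : SO d × E d => curveAverage a γ H q.1 q.2 := by
  refine continuous_of_dominated (bound := fun _ => B) (fun q => ?_)
    (fun q => Filter.Eventually.of_forall fun t => hB _) (integrable_const _)
    (Filter.Eventually.of_forall fun t => ?_)
  · exact ((hH.comp (continuous_arg hγ)).comp (Continuous.prodMk_right q)).aestronglyMeasurable
  · exact (hH.comp (continuous_arg hγ)).comp (Continuous.prodMk_left t)

theorem integrable_curveAverage_integrand (hγ : Continuous γ) {H : E d → ℂ} (hH : Continuous H)
    (hHi : Integrable H) (σ : SO d) :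
    Integrable (fun q : E d × ℝ => H (q.1 - rotate σ⁻¹ (γ q.2)))
      ((volume : Measure (E d)).prod (volume.restrict (Icc (-a) a))) := by
  have hm : Continuous fun q : E d × ℝ => (((σ, q.1), q.2) : (SO d × E d) × ℝ) :=
    (continuous_const.prodMk continuous_fst).prodMk continuous_snd
  have hc := Continuous.comp (hH.comp (continuous_arg (d := d) hγ)) hm
  simp only [Function.comp_def] at hc
  rw [integrable_prod_iff' hc.aestronglyMeasurable]
  refine ⟨Filter.Eventually.of_forall fun t => hHi.comp_sub_right (rotate σ⁻¹ (γ t)), ?_⟩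
  have : (fun t : ℝ => ∫ x : E d, ‖H (x - rotate σ⁻¹ (γ t))‖) = fun _ => ∫ x : E d, ‖H x‖ := by
    funext t
    exact integral_sub_right_eq_self (fun x => ‖H x‖) _
  simp only
  rw [this]
  exact integrable_const _

theorem integrable_curveAverage (hγ : Continuous γ) {H : E d → ℂ} (hH : Continuous H)
    (hHi : Integrable H) (σ : SO d) : Integrable (curveAverage a γ H σ) :=
  (integrable_curveAverage_integrand hγ hH hHi σ).integral_prod_left

theorem fourier_curveAverage (hγ : Continuous γ) {H : E d → ℂ} (hH : Continuous H)
    (hHi : Integrable H) (σ : SO d) (ξ : E d) :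
    𝓕 (curveAverage a γ H σ) ξ = curveFourier a γ (rotate σ ξ) * 𝓕 H ξ := by
  rw [Real.fourier_eq, Real.fourier_eq]
  simp only [curveAverage]
  have h1 : ∀ x : E d, Real.fourierChar (-inner ℝ x ξ) •
      (∫ t in Icc (-a) a, H (x - rotate σ⁻¹ (γ t))) =
      ∫ t in Icc (-a) a, Real.fourierChar (-inner ℝ x ξ) • H (x - rotate σ⁻¹ (γ t)) := fun x => by
    simp_rw [Circle.smul_def]
    rw [integral_smul]
  simp_rw [h1]
  rw [integral_integral_swap]
  · rw [curveFourier, ← integral_mul_const]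
    refine integral_congr_ae (Filter.Eventually.of_forall fun t => ?_)
    simp only
    have h2 := integral_add_right_eq_self (μ := (volume : Measure (E d)))
      (fun x : E d => Real.fourierChar (-inner ℝ x ξ) • H (x - rotate σ⁻¹ (γ t)))
      (rotate σ⁻¹ (γ t))
    rw [← h2, ← integral_const_mul]
    congr 1
    funext x
    rw [add_sub_cancel_right, inner_add_left, neg_add_rev, AddChar.map_add_eq_mul, mul_smul,
      Circle.smul_def, smul_eq_mul, inner_rotate, inv_inv, Real.fourierChar_apply]
    congr 3
    push_cast
    ring
  · have hi := integrable_curveAverage_integrand (a := a) hγ hH hHi σ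
    refine hi.mono ?_ (Filter.Eventually.of_forall fun q => ?_)
    · refine AEStronglyMeasurable.smul ?_ hi.aestronglyMeasurable
      have hin : Continuous fun q : E d × ℝ => -inner ℝ q.1 ξ := by fun_prop
      exact (continuous_subtype_val.comp
        (Real.continuous_fourierChar.comp hin)).aestronglyMeasurable
    · simp [Function.uncurry]

theorem memLp_two_of_bounded {X : Type*} [MeasurableSpace X] {μ : Measure X} {f : X → ℂ}
    (hf : Integrable f μ) {B : ℝ} (hB : ∀ x, ‖f x‖ ≤ B) : MemLp f 2 μ := by
  rw [memLp_two_iff_integrable_sq_norm hf.aestronglyMeasurable]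
  have := hf.norm.bdd_mul hf.norm.aestronglyMeasurable (c := B)
    (Filter.Eventually.of_forall fun x => by simpa using hB x)
  simpa [sq] using this

theorem norm_convolution_le {M f : E d → ℂ} {B : ℝ} (hB : ∀ x, ‖M x‖ ≤ B) (hf : Integrable f)
    (x : E d) : ‖(M ⋆[ContinuousLinearMap.mul ℂ ℂ] f) x‖ ≤ B * ∫ y, ‖f y‖ := by
  rw [convolution_eq_swap, ← integral_const_mul]
  refine norm_integral_le_of_norm_le (hf.norm.const_mul B) (Filter.Eventually.of_forall fun y => ?_)
  rw [ContinuousLinearMap.mul_apply', norm_mul]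
  exact mul_le_mul_of_nonneg_right (hB _) (norm_nonneg _)

/-- The `L²` estimate for averages over randomly rotated curves: by Plancherel's theorem, the decay
of the Fourier transform of the curve is needed only on average over the rotations. -/
theorem lintegral_curveAverage_sq_le (ha : 0 < a) (hγ : Continuous γ) [MeasurableSpace (SO d)]
    [BorelSpace (SO d)] (κ : Measure (SO d)) [IsFiniteMeasure κ] {M : E d → ℂ} (hM : Continuous M)
    (hMc : HasCompactSupport M) {f : E d → ℂ} (hf : Integrable f) (hf2 : MemLp f 2) {A : ℝ≥0∞}
    (hcF : Continuous (curveFourier a γ))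
    (hA : ∀ ξ, ‖𝓕 M ξ‖ₑ ^ 2 * ∫⁻ σ, ‖curveFourier a γ (rotate σ ξ)‖ₑ ^ 2 ∂κ ≤ A) :
    ∫⁻ q, ‖curveAverage a γ (M ⋆[ContinuousLinearMap.mul ℂ ℂ] f) q.1 q.2‖ₑ ^ 2
      ∂(κ.prod (volume : Measure (E d))) ≤ A * ∫⁻ x, ‖f x‖ₑ ^ 2 := by
  obtain ⟨B, hB⟩ := hM.bounded_above_of_compact_support hMc
  have hMi : Integrable M := hM.integrable_of_hasCompactSupport hMc
  set H := M ⋆[ContinuousLinearMap.mul ℂ ℂ] f with hH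
  have hHc : Continuous H := hMc.continuous_convolution_left _ hM hf.locallyIntegrable
  have hHi : Integrable H := hMi.integrable_convolution _ hf
  have hHb := norm_convolution_le hB hf
  have hUc := continuous_curveAverage (a := a) hγ hHc hHb
  rw [lintegral_prod _ (hUc.enorm.measurable.pow_const 2).aemeasurable]
  have h1 : ∀ σ : SO d, ∫⁻ x, ‖curveAverage a γ H σ x‖ₑ ^ 2 =
      ∫⁻ ξ, ‖curveFourier a γ (rotate σ ξ)‖ₑ ^ 2 * (‖𝓕 M ξ‖ₑ ^ 2 * ‖𝓕 f ξ‖ₑ ^ 2) := by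
    intro σ
    have hUi := integrable_curveAverage (a := a) hγ hHc hHi σ
    rw [← lintegral_enorm_fourier_sq hUi
      (memLp_two_of_bounded hUi fun x => norm_curveAverage_le ha hHb σ x)]
    congr 1
    funext ξ
    rw [fourier_curveAverage hγ hHc hHi, hH, Real.fourier_mul_convolution_eq hMi hf, enorm_mul,
      enorm_mul, mul_pow, mul_pow]
  have hMF : Continuous (𝓕 M) := continuous_fourier_of_integrable hMi
  have hfF : Continuous (𝓕 f) := continuous_fourier_of_integrable hf
  have hjoint : Measurable fun q : SO d × E d =>
      ‖curveFourier a γ (rotate q.1 q.2)‖ₑ ^ 2 * (‖𝓕 M q.2‖ₑ ^ 2 * ‖𝓕 f q.2‖ₑ ^ 2) :=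
    ((hcF.comp continuous_rotate).enorm.measurable.pow_const 2).mul
      (((hMF.enorm.measurable.comp measurable_snd).pow_const 2).mul
        ((hfF.enorm.measurable.comp measurable_snd).pow_const 2))
  simp_rw [h1]
  rw [lintegral_lintegral_swap hjoint.aemeasurable]
  calc ∫⁻ ξ, ∫⁻ σ, ‖curveFourier a γ (rotate σ ξ)‖ₑ ^ 2 * (‖𝓕 M ξ‖ₑ ^ 2 * ‖𝓕 f ξ‖ₑ ^ 2) ∂κ
      ≤ ∫⁻ ξ, A * ‖𝓕 f ξ‖ₑ ^ 2 := by
        refine lintegral_mono fun ξ => ?_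
        have hm : Measurable fun σ : SO d => ‖curveFourier a γ (rotate σ ξ)‖ₑ ^ 2 :=
          ((hcF.comp (continuous_rotate.comp
            (continuous_id.prodMk continuous_const))).enorm.measurable).pow_const 2
        rw [lintegral_mul_const _ hm]
        calc _ = (‖𝓕 M ξ‖ₑ ^ 2 * ∫⁻ σ, ‖curveFourier a γ (rotate σ ξ)‖ₑ ^ 2 ∂κ) *
              ‖𝓕 f ξ‖ₑ ^ 2 := by ring
          _ ≤ _ := by
              gcongr
              exact hA ξ
    _ = A * ∫⁻ x, ‖f x‖ₑ ^ 2 := by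
        rw [lintegral_const_mul _ (hfF.enorm.measurable.pow_const 2),
          lintegral_enorm_fourier_sq hf hf2]

end Average

/-! ### The analytic family of kernels -/

/-- A smooth bump function supported in the unit ball. -/
def unitBump (d : ℕ) : ContDiffBump (0 : E d) where
  rIn := 1 / 2
  rOut := 1
  rIn_pos := by norm_num
  rIn_lt_rOut := by norm_num

theorem contDiff_unitBump : ContDiff ℝ ∞ (unitBump d) := (unitBump d).contDiff

theorem unitBump_eq_zero {y : E d} (hy : 1 < ‖y‖) :
    unitBump d y = 0 ∧ fderiv ℝ (unitBump d) y = 0 := by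
  have h : ∀ z : E d, 1 < ‖z‖ → unitBump d z = 0 := fun z hz =>
    (unitBump d).zero_of_le_dist (by
      rw [dist_zero_right]
      exact hz.le)
  refine ⟨h y hy, ?_⟩
  have he : (unitBump d : E d → ℝ) =ᶠ[nhds y] fun _ => 0 := by
    filter_upwards [(isOpen_lt continuous_const continuous_norm).mem_nhds hy] with z hz
    exact h z hz
  rw [he.fderiv_eq]
  simp

theorem exists_unitBump_bound : ∃ K : ℝ, (∀ y : E d, |unitBump d y| ≤ K) ∧
    ∀ y : E d, ‖fderiv ℝ (unitBump d) y‖ ≤ K := by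
  have hc : HasCompactSupport (unitBump d) := (unitBump d).hasCompactSupport
  obtain ⟨K₁, h1⟩ := (unitBump d).continuous.bounded_above_of_compact_support hc
  obtain ⟨K₂, h2⟩ := (contDiff_unitBump.continuous_fderiv
    (by simp)).bounded_above_of_compact_support (hc.fderiv (𝕜 := ℝ))
  exact ⟨max K₁ K₂, fun y => (h1 y).trans (le_max_left _ _),
    fun y => (h2 y).trans (le_max_right _ _)⟩

/-- The function `(1 + y · ∇) η` for the bump function `η`, complex valued. -/
def lineKernel (d : ℕ) (y : E d) : ℂ := (lineDeriv (unitBump d) y : ℝ)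

theorem contDiff_lineDeriv_unitBump : ContDiff ℝ ∞ (lineDeriv (unitBump d)) := by
  have h : ContDiff ℝ ∞ (unitBump d) := contDiff_unitBump
  exact h.add ((h.fderiv_right (by simp)).clm_apply contDiff_id)

theorem hasCompactSupport_lineDeriv_unitBump : HasCompactSupport (lineDeriv (unitBump d)) := by
  refine HasCompactSupport.intro (isCompact_closedBall (0 : E d) 1) fun y hy => ?_
  have hy' : 1 < ‖y‖ := by simpa using hy
  obtain ⟨h1, h2⟩ := unitBump_eq_zero hy'
  simp [lineDeriv, h1, h2]

theorem contDiff_lineKernel : ContDiff ℝ ∞ (lineKernel d) :=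
  Complex.ofRealCLM.contDiff.comp contDiff_lineDeriv_unitBump

theorem hasCompactSupport_lineKernel : HasCompactSupport (lineKernel d) :=
  hasCompactSupport_lineDeriv_unitBump.comp_left (g := Complex.ofReal) Complex.ofReal_zero

theorem integral_lineDeriv_unitBump :
    ∫ y, lineDeriv (unitBump d) y = (1 - d) * ∫ y, unitBump d y := by
  set η : E d → ℝ := ⇑(unitBump d) with hη
  have hs : ContDiff ℝ ∞ η := contDiff_unitBump
  have hc : HasCompactSupport η := (unitBump d).hasCompactSupport
  have hi : Integrable η := hs.continuous.integrable_of_hasCompactSupport hc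
  set b : Fin d → E d := fun i => EuclideanSpace.single i 1 with hb
  have hDc : HasCompactSupport (fderiv ℝ η) := hc.fderiv (𝕜 := ℝ)
  have hDcont : Continuous (fderiv ℝ η) := hs.continuous_fderiv (by simp)
  have hterm : ∀ i : Fin d, Integrable (fun y : E d => y i * fderiv ℝ η y (b i)) ∧
      ∫ y : E d, y i * fderiv ℝ η y (b i) = -∫ y, η y := by
    intro i
    set p : E d →L[ℝ] ℝ := EuclideanSpace.proj i with hp
    have hpy : ∀ y : E d, p y = y i := fun y => rfl
    have hcont : Continuous fun y : E d => fderiv ℝ η y (b i) :=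
      hDcont.clm_apply continuous_const
    have hcs : HasCompactSupport fun y : E d => fderiv ℝ η y (b i) :=
      hDc.comp_left (g := fun L : E d →L[ℝ] ℝ => L (b i)) rfl
    have i1 : Integrable fun y : E d => p y * fderiv ℝ η y (b i) :=
      (p.continuous.mul hcont).integrable_of_hasCompactSupport hcs.mul_left
    have i2 : Integrable fun y : E d => fderiv ℝ p y (b i) * η y := by
      simp only [ContinuousLinearMap.fderiv]
      exact hi.const_mul _
    have i3 : Integrable fun y : E d => p y * η y :=
      (p.continuous.mul hs.continuous).integrable_of_hasCompactSupport hc.mul_left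
    refine ⟨i1, ?_⟩
    have := integral_mul_fderiv_eq_neg_fderiv_mul_of_integrable (μ := volume) (v := b i) i2 i1 i3
      (fun y _ => p.differentiableAt) (fun y _ => (hs.differentiable (by simp)) y)
    simp only [ContinuousLinearMap.fderiv] at this
    have hpb : p (b i) = 1 := by simp [hp, hb]
    rw [hpb] at this
    simp only [one_mul] at this
    exact this
  have hsum : ∀ y : E d, fderiv ℝ η y y = ∑ i, y i * fderiv ℝ η y (b i) := by
    intro y
    have hy : y = ∑ i, y i • b i := by
      have := (EuclideanSpace.basisFun (Fin d) ℝ).sum_repr y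
      simpa [hb] using this.symm
    conv_lhs =>
      arg 2
      rw [hy]
    simp [map_sum]
  simp only [lineDeriv]
  simp_rw [hsum]
  rw [integral_add hi (integrable_finsetSum _ fun i _ => (hterm i).1),
    integral_finsetSum _ fun i _ => (hterm i).1]
  simp_rw [fun i => (hterm i).2]
  simp
  ring

theorem integral_lineKernel_ne_zero (hd : 2 ≤ d) : ∫ y, lineKernel d y ≠ 0 := by
  have e : ∫ y, lineKernel d y = ((∫ y, lineDeriv (unitBump d) y : ℝ) : ℂ) := integral_ofReal
  rw [e, integral_lineDeriv_unitBump]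
  have h1 : 0 < ∫ y, unitBump d y := (unitBump d).integral_pos
  have h2 : (2 : ℝ) ≤ d := by exact_mod_cast hd
  have h3 : (1 - (d : ℝ)) * ∫ y, unitBump d y ≠ 0 :=
    mul_ne_zero (by linarith) h1.ne'
  exact_mod_cast h3

/-- The dilate `4 ^ (k d) h(4 ^ k y)`, which has the same integral as `h`. -/
def dilate (k : ℕ) (h : E d → ℂ) (y : E d) : ℂ := ((4 : ℝ) ^ (k * d) : ℝ) * h ((4 : ℝ) ^ k • y)

theorem fourier_dilate (k : ℕ) (h : E d → ℂ) (ξ : E d) :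
    𝓕 (dilate k h) ξ = 𝓕 h (((4 : ℝ) ^ k)⁻¹ • ξ) := by
  rw [Real.fourier_eq, Real.fourier_eq]
  set c : ℝ := 4 ^ k with hc
  have hc0 : 0 < c := by positivity
  have h1 := Measure.integral_comp_smul (volume : Measure (E d))
    (fun y : E d => Real.fourierChar (-inner ℝ y (c⁻¹ • ξ)) • h y) c
  have e : ∀ y : E d, inner ℝ (c • y) (c⁻¹ • ξ) = inner ℝ y ξ := fun y => by
    rw [inner_smul_left, inner_smul_right, RCLike.conj_to_real]
    field_simp
  simp only [e] at h1
  have h2 : ∀ y : E d, Real.fourierChar (-inner ℝ y ξ) • dilate k h y =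
      ((4 : ℝ) ^ (k * d) : ℝ) • (Real.fourierChar (-inner ℝ y ξ) • h (c • y)) := fun y => by
    rw [dilate, Circle.smul_def, Circle.smul_def, smul_eq_mul, smul_eq_mul, Complex.real_smul]
    ring
  simp_rw [h2]
  rw [integral_smul, h1, smul_smul, finrank_euclideanSpace, Fintype.card_fin, abs_inv,
    abs_of_pos (by positivity), hc, ← pow_mul, mul_inv_cancel₀ (by positivity), one_smul]

theorem continuous_dilate (k : ℕ) {h : E d → ℂ} (hh : Continuous h) : Continuous (dilate k h) :=
  continuous_const.mul (hh.comp (continuous_const_smul _))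

theorem hasCompactSupport_dilate (k : ℕ) {h : E d → ℂ} (hh : HasCompactSupport h) :
    HasCompactSupport (dilate k h) :=
  (hh.comp_smul (by positivity : (4 : ℝ) ^ k ≠ 0)).mul_left

/-- The differences of consecutive dilates of the kernel. -/
def kernelDiff (d : ℕ) : ℕ → E d → ℂ
  | 0 => dilate 0 (lineKernel d)
  | k + 1 => fun y => dilate (k + 1) (lineKernel d) y - dilate k (lineKernel d) y

theorem continuous_kernelDiff (k : ℕ) : Continuous (kernelDiff d k) := by
  cases k with
  | zero => exact continuous_dilate 0 contDiff_lineKernel.continuous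
  | succ k =>
    have h := (continuous_dilate (k + 1) (contDiff_lineKernel (d := d)).continuous).sub
      (continuous_dilate k contDiff_lineKernel.continuous)
    exact h

theorem hasCompactSupport_kernelDiff (k : ℕ) : HasCompactSupport (kernelDiff d k) := by
  cases k with
  | zero => exact hasCompactSupport_dilate 0 hasCompactSupport_lineKernel
  | succ k =>
    have h := (hasCompactSupport_dilate (k + 1) (hasCompactSupport_lineKernel (d := d))).sub
      (hasCompactSupport_dilate k hasCompactSupport_lineKernel)
    exact h

/-- The analytic family of kernels: a sum of differences of dilates, weighted by `4 ^ (-k z)`. -/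
def kernelSum (d n : ℕ) (z : ℂ) (y : E d) : ℂ :=
  ∑ k ∈ Finset.range n, Complex.exp ((-(k * Real.log 4) : ℝ) * z) * kernelDiff d k y

theorem continuous_kernelSum (n : ℕ) (z : ℂ) : Continuous (kernelSum d n z) :=
  continuous_finsetSum _ fun k _ => continuous_const.mul (continuous_kernelDiff k)

theorem hasCompactSupport_kernelSum (n : ℕ) (z : ℂ) : HasCompactSupport (kernelSum d n z) := by
  unfold kernelSum
  induction n with
  | zero =>
    simp only [Finset.range_zero, Finset.sum_empty]
    exact HasCompactSupport.zero
  | succ n ih =>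
    simp_rw [Finset.sum_range_succ]
    exact ih.add (hasCompactSupport_kernelDiff n).mul_left

theorem kernelSum_zero (n : ℕ) (y : E d) :
    kernelSum d (n + 1) 0 y = dilate n (lineKernel d) y := by
  induction n with
  | zero => simp [kernelSum, kernelDiff]
  | succ n ih =>
    rw [kernelSum, Finset.sum_range_succ]
    have := ih
    rw [kernelSum] at this
    rw [this]
    simp [kernelDiff]

theorem norm_exp_weight (k : ℕ) (z : ℂ) :
    ‖Complex.exp ((-(k * Real.log 4) : ℝ) * z)‖ = (4 : ℝ) ^ (-(k * z.re)) := by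
  rw [Complex.norm_exp, Complex.re_ofReal_mul, Real.rpow_def_of_pos (by norm_num)]
  congr 1
  ring

/-- The Fourier transforms of the differences are concentrated at frequencies comparable
to `4 ^ k`. -/
theorem exists_norm_fourier_kernelDiff_le :
    ∃ C > 0, ∀ (k : ℕ) (ξ : E d), ‖𝓕 (kernelDiff d k) ξ‖ ≤ C * (max 1 ‖ξ‖ / 4 ^ k) ∧
      ‖𝓕 (kernelDiff d k) ξ‖ ≤ C * (4 ^ k / max 1 ‖ξ‖) := by
  set S : 𝓢(E d, ℂ) := hasCompactSupport_lineKernel.toSchwartzMap contDiff_lineKernel with hS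
  have hSe : ((𝓕 S : 𝓢(E d, ℂ)) : E d → ℂ) = 𝓕 (lineKernel d) := by
    rw [SchwartzMap.fourier_coe]
    rfl
  obtain ⟨C₀, hC₀, h0⟩ := (𝓕 S : 𝓢(E d, ℂ)).decay 0 0
  obtain ⟨C₁, hC₁, h1⟩ := (𝓕 S : 𝓢(E d, ℂ)).decay 1 0
  obtain ⟨C₂, hC₂, h2⟩ := (𝓕 S : 𝓢(E d, ℂ)).decay 0 1
  have b0 : ∀ ξ, ‖𝓕 (lineKernel d) ξ‖ ≤ C₀ := fun ξ => by simpa [hSe] using h0 ξ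
  have b1 : ∀ ξ, ‖ξ‖ * ‖𝓕 (lineKernel d) ξ‖ ≤ C₁ := fun ξ => by simpa [hSe] using h1 ξ
  have b2 : ∀ ξ ξ', ‖𝓕 (lineKernel d) ξ - 𝓕 (lineKernel d) ξ'‖ ≤ C₂ * ‖ξ - ξ'‖ := by
    intro ξ ξ'
    rw [← hSe]
    refine convex_univ.norm_image_sub_le_of_norm_fderiv_le (𝕜 := ℝ)
      (fun x _ => (𝓕 S : 𝓢(E d, ℂ)).differentiableAt) (fun x _ => ?_) (mem_univ ξ') (mem_univ ξ)
    have := h2 x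
    rwa [pow_zero, one_mul, norm_iteratedFDeriv_one] at this
  have hG : Integrable (lineKernel d) :=
    contDiff_lineKernel.continuous.integrable_of_hasCompactSupport hasCompactSupport_lineKernel
  have hGk : ∀ k, Integrable (dilate k (lineKernel d)) := fun k =>
    (continuous_dilate k contDiff_lineKernel.continuous).integrable_of_hasCompactSupport
      (hasCompactSupport_dilate k hasCompactSupport_lineKernel)
  -- a bound for all frequencies which decays at infinity
  have b3 : ∀ (k : ℕ) (ξ : E d),
      ‖𝓕 (dilate k (lineKernel d)) ξ‖ ≤ (C₀ + C₁) * (4 ^ k / max 1 ‖ξ‖) := by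
    intro k ξ
    have hk : (1 : ℝ) ≤ 4 ^ k := one_le_pow₀ (by norm_num)
    rw [fourier_dilate, ← mul_div_assoc, le_div_iff₀ (by positivity)]
    have i1 := b1 (((4 : ℝ) ^ k)⁻¹ • ξ)
    have i0 := b0 (((4 : ℝ) ^ k)⁻¹ • ξ)
    rw [norm_smul, norm_inv, norm_pow, Real.norm_ofNat, mul_assoc,
      inv_mul_le_iff₀ (by positivity)] at i1
    rcases max_cases 1 ‖ξ‖ with ⟨hm, -⟩ | ⟨hm, -⟩ <;> rw [hm] <;> nlinarith
  refine ⟨2 * (C₀ + C₁) + 3 * C₂ + 1, by positivity, fun k ξ => ?_⟩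
  have hm1 : 1 ≤ max 1 ‖ξ‖ := le_max_left _ _
  have hmξ : ‖ξ‖ ≤ max 1 ‖ξ‖ := le_max_right _ _
  have hp : 0 ≤ max 1 ‖ξ‖ / 4 ^ k := by positivity
  have hp' : 0 ≤ (4 : ℝ) ^ k / max 1 ‖ξ‖ := by positivity
  cases k with
  | zero =>
    have i3 := b3 0 ξ
    have i0 : ‖𝓕 (dilate 0 (lineKernel d)) ξ‖ ≤ C₀ := by
      rw [fourier_dilate]
      exact b0 _
    simp only [kernelDiff]
    constructor
    · rw [pow_zero, div_one]
      nlinarith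
    · nlinarith
  | succ k =>
    have e : 𝓕 (kernelDiff d (k + 1)) ξ =
        𝓕 (dilate (k + 1) (lineKernel d)) ξ - 𝓕 (dilate k (lineKernel d)) ξ := by
      rw [Real.fourier_eq, Real.fourier_eq, Real.fourier_eq, ← integral_sub]
      · congr 1
        funext y
        simp only [kernelDiff]
        rw [smul_sub]
      · exact (Real.fourierIntegral_convergent_iff ξ).2 (hGk (k + 1))
      · exact (Real.fourierIntegral_convergent_iff ξ).2 (hGk k)
    rw [e]
    constructor
    · rw [fourier_dilate, fourier_dilate]
      refine (b2 _ _).trans ?_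
      have e1 : ((4 : ℝ) ^ (k + 1))⁻¹ • ξ - ((4 : ℝ) ^ k)⁻¹ • ξ =
          (-(3 * ((4 : ℝ) ^ (k + 1))⁻¹)) • ξ := by
        rw [← sub_smul]
        congr 1
        rw [pow_succ]
        field_simp
        norm_num
      rw [e1, norm_smul, norm_neg, norm_mul, norm_inv, norm_pow, Real.norm_ofNat, Real.norm_ofNat]
      have e2 : C₂ * (3 * ((4 : ℝ) ^ (k + 1))⁻¹ * ‖ξ‖) = 3 * C₂ * (‖ξ‖ / 4 ^ (k + 1)) := by
        field_simp
      rw [e2]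
      have e3 : ‖ξ‖ / (4 : ℝ) ^ (k + 1) ≤ max 1 ‖ξ‖ / 4 ^ (k + 1) := by gcongr
      have e4 : 0 ≤ ‖ξ‖ / (4 : ℝ) ^ (k + 1) := by positivity
      nlinarith
    · have i1 := b3 (k + 1) ξ
      have i2 := b3 k ξ
      have i3 : (4 : ℝ) ^ k / max 1 ‖ξ‖ ≤ 4 ^ (k + 1) / max 1 ‖ξ‖ := by
        gcongr
        · norm_num
        · exact k.le_succ
      have := norm_sub_le (𝓕 (dilate (k + 1) (lineKernel d)) ξ) (𝓕 (dilate k (lineKernel d)) ξ)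
      nlinarith

/-- On the line `Re z = -1/2` the Fourier transform of the kernel grows like the square root of the
frequency. -/
theorem exists_norm_fourier_kernelSum_le :
    ∃ C > 0, ∀ (n : ℕ) (z : ℂ) (ξ : E d), z.re = -(1 / 2) →
      ‖𝓕 (kernelSum d n z) ξ‖ ≤ C * Real.sqrt (max 1 ‖ξ‖) := by
  obtain ⟨C, hC, h⟩ := exists_norm_fourier_kernelDiff_le (d := d)
  refine ⟨4 * C, by positivity, fun n z ξ hz => ?_⟩
  have hF : 𝓕 (kernelSum d n z) ξ = ∑ k ∈ Finset.range n,
      Complex.exp ((-(k * Real.log 4) : ℝ) * z) * 𝓕 (kernelDiff d k) ξ := by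
    simp only [Real.fourier_eq, kernelSum]
    simp_rw [Finset.smul_sum, Circle.smul_def, smul_eq_mul]
    rw [integral_finsetSum]
    · refine Finset.sum_congr rfl fun k _ => ?_
      rw [← integral_const_mul]
      congr 1
      funext y
      ring
    · intro k _
      have hi : Integrable (kernelDiff d k) :=
        (continuous_kernelDiff k).integrable_of_hasCompactSupport (hasCompactSupport_kernelDiff k)
      have := ((Real.fourierIntegral_convergent_iff ξ).2 hi).const_mul
        (Complex.exp ((-(k * Real.log 4) : ℝ) * z))
      refine this.congr (Filter.Eventually.of_forall fun y => ?_)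
      simp only [Circle.smul_def, smul_eq_mul]
      ring
  set R := max 1 ‖ξ‖ with hR
  have hR0 : 0 < R := lt_max_of_lt_left one_pos
  set s := Real.sqrt R with hs
  have hs0 : 0 < s := Real.sqrt_pos.2 hR0
  have hsR : s * s = R := Real.mul_self_sqrt hR0.le
  have hterm : ∀ k : ℕ, ‖Complex.exp ((-(k * Real.log 4) : ℝ) * z) * 𝓕 (kernelDiff d k) ξ‖ ≤
      C * s * ((if (2 : ℝ) ^ k * s⁻¹ ≤ 1 then (2 : ℝ) ^ k * s⁻¹ else 0) +
        (if (2 : ℝ) ^ k * s⁻¹ ≤ 1 then 0 else ((2 : ℝ) ^ k * s⁻¹)⁻¹)) := by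
    intro k
    obtain ⟨h1, h2⟩ := h k ξ
    have e1 : (4 : ℝ) ^ (-(k * z.re)) = 2 ^ k := by
      rw [hz]
      have : (4 : ℝ) = 2 ^ (2 : ℝ) := by norm_num
      rw [this, ← Real.rpow_mul (by norm_num), ← Real.rpow_natCast]
      congr 1
      ring
    have e2 : (4 : ℝ) ^ k = 2 ^ k * 2 ^ k := by
      rw [← mul_pow]
      norm_num
    rw [norm_mul, norm_exp_weight, e1]
    have hp : (0 : ℝ) < 2 ^ k := by positivity
    set u : ℝ := 2 ^ k with hu
    rw [← hR, e2, ← hsR] at h1 h2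
    split_ifs with hcase
    · rw [add_zero]
      have : u * u / (s * s) ≤ 1 := by
        have e3 : u * u / (s * s) = (u * s⁻¹) * (u * s⁻¹) := by field_simp
        rw [e3]
        exact mul_le_one₀ hcase (by positivity) hcase
      calc u * ‖𝓕 (kernelDiff d k) ξ‖ ≤ u * (C * (u * u / (s * s))) := by gcongr
        _ ≤ u * (C * 1) := by gcongr
        _ = C * s * (u * s⁻¹) := by field_simp
    · rw [zero_add]
      calc u * ‖𝓕 (kernelDiff d k) ξ‖ ≤ u * (C * (s * s / (u * u))) := by gcongr
        _ = C * s * (u * s⁻¹)⁻¹ := by field_simp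
  rw [hF]
  refine (norm_sum_le _ _).trans ((Finset.sum_le_sum fun k _ => hterm k).trans ?_)
  rw [← Finset.mul_sum, Finset.sum_add_distrib]
  have s1 := sum_geometric_le (r := 2) (τ := s⁻¹) le_rfl zero_le_one (by positivity) n
  have s2 := sum_geometric_inv_le (τ := s⁻¹) (by positivity) n
  have : 0 < C * s := by positivity
  nlinarith

/-- On the line `Re z = d - 1` the averages of the kernel over rotated curves are bounded. -/
theorem exists_norm_curveAverage_kernelSum_le {a : ℝ} {γ γ' : ℝ → E d} (hd : 2 ≤ d) (ha : 0 < a)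
    (hγ : AdmissibleCurve a γ) (hγ' : Continuous γ') (hγγ' : EqOn γ γ' (Icc (-a) a)) :
    ∃ C > 0, ∀ (n : ℕ) (z : ℂ) (σ : SO d) (x : E d), z.re = d - 1 →
      ‖curveAverage a γ' (kernelSum d n z) σ x‖ ≤ C := by
  obtain ⟨K, hK, hK'⟩ := exists_unitBump_bound (d := d)
  obtain ⟨C, hC, hsum⟩ := hγ.exists_sum_integral_lineDeriv_le ha
    (contDiff_unitBump.of_le (by simp)) hK hK' fun y hy => unitBump_eq_zero hy
  refine ⟨3 * C, by positivity, fun n z σ x hz => ?_⟩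
  set Q : ℕ → ℝ := fun k =>
    4 ^ k * |∫ t in Icc (-a) a, lineDeriv (unitBump d) ((4 : ℝ) ^ k • (x - rotate σ⁻¹ (γ t)))| with hQ
  have hQ0 : ∀ k, 0 ≤ Q k := fun k => by positivity
  have hdil : ∀ k, ‖curveAverage a γ' (dilate k (lineKernel d)) σ x‖ =
      (4 : ℝ) ^ (k * (d - 1 : ℝ)) * Q k := by
    intro k
    have e : curveAverage a γ' (dilate k (lineKernel d)) σ x = (((4 : ℝ) ^ (k * d) *
        ∫ t in Icc (-a) a,
          lineDeriv (unitBump d) ((4 : ℝ) ^ k • (x - rotate σ⁻¹ (γ t))) : ℝ) : ℂ) := by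
      simp only [curveAverage, dilate, lineKernel]
      rw [integral_const_mul, Complex.ofReal_mul, ← integral_complex_ofReal]
      congr 1
      refine setIntegral_congr_fun measurableSet_Icc fun t ht => ?_
      rw [hγγ' ht]
    rw [e, Complex.norm_real, Real.norm_eq_abs, abs_mul, abs_of_pos (by positivity), hQ]
    simp only
    rw [← mul_assoc]
    congr 1
    rw [← Real.rpow_natCast, ← Real.rpow_natCast 4 k, ← Real.rpow_add (by norm_num)]
    congr 1
    push_cast
    ring
  have hint : ∀ {H : E d → ℂ}, Continuous H →
      IntegrableOn (fun t => H (x - rotate σ⁻¹ (γ' t))) (Icc (-a) a) := fun hH =>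
    (hH.comp (continuous_const.sub ((rotateIsometry σ⁻¹).continuous.comp hγ'))).integrableOn_Icc
  have hlin : curveAverage a γ' (kernelSum d n z) σ x = ∑ k ∈ Finset.range n,
      Complex.exp ((-(k * Real.log 4) : ℝ) * z) * curveAverage a γ' (kernelDiff d k) σ x := by
    simp only [curveAverage, kernelSum]
    rw [integral_finsetSum]
    · exact Finset.sum_congr rfl fun k _ => integral_const_mul _ _
    · exact fun k _ => (hint (continuous_kernelDiff k)).const_mul _
  have hterm : ∀ k : ℕ, ‖Complex.exp ((-(k * Real.log 4) : ℝ) * z) *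
      curveAverage a γ' (kernelDiff d k) σ x‖ ≤ Q k + Q (k - 1) := by
    intro k
    have hd' : (0 : ℝ) ≤ d - 1 := by
      have : (2 : ℝ) ≤ d := by exact_mod_cast hd
      linarith
    rw [norm_mul, norm_exp_weight, hz]
    have hcancel : ∀ j : ℕ, j ≤ k →
        (4 : ℝ) ^ (-(k * (d - 1 : ℝ))) * ((4 : ℝ) ^ (j * (d - 1 : ℝ)) * Q j) ≤ Q j := by
      intro j hj
      rw [← mul_assoc, ← Real.rpow_add (by norm_num)]
      refine mul_le_of_le_one_left (hQ0 j) (Real.rpow_le_one_of_one_le_of_nonpos (by norm_num) ?_)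
      have : (j : ℝ) ≤ k := by exact_mod_cast hj
      nlinarith
    cases k with
    | zero =>
      simp only [kernelDiff]
      rw [hdil 0]
      have := hcancel 0 le_rfl
      linarith [hQ0 (0 - 1)]
    | succ k =>
      have e : curveAverage a γ' (kernelDiff d (k + 1)) σ x =
          curveAverage a γ' (dilate (k + 1) (lineKernel d)) σ x -
          curveAverage a γ' (dilate k (lineKernel d)) σ x := by
        simp only [curveAverage, kernelDiff]
        exact integral_sub (hint (continuous_dilate _ contDiff_lineKernel.continuous))
          (hint (continuous_dilate _ contDiff_lineKernel.continuous))
      rw [e]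
      refine (mul_le_mul_of_nonneg_left (norm_sub_le _ _) (by positivity)).trans ?_
      rw [hdil, hdil, mul_add]
      exact add_le_add (hcancel (k + 1) le_rfl) (hcancel k k.le_succ)
  rw [hlin]
  refine (norm_sum_le _ _).trans ((Finset.sum_le_sum fun k _ => hterm k).trans ?_)
  rw [Finset.sum_add_distrib]
  have h1 : ∑ k ∈ Finset.range n, Q k ≤ C := hsum σ⁻¹ x n
  have h2 : ∑ k ∈ Finset.range n, Q (k - 1) ≤ C + Q 0 := by
    cases n with
    | zero => simpa using add_nonneg hC.le (hQ0 0)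
    | succ n =>
      rw [Finset.sum_range_succ']
      exact add_le_add (hsum σ⁻¹ x n) le_rfl
  have h3 : Q 0 ≤ C := by
    have := hsum σ⁻¹ x 1
    simpa [hQ] using this
  linarith

/-! ### Exponential sums and the trilinear form -/

/-- The three lines theorem for exponential sums. -/
theorem norm_expSum_le {ι : Type*} (S : Finset ι) (b : ι → ℂ) (u v : ι → ℝ) {A B θ : ℝ}
    (h0 : ∀ ζ : ℂ, ζ.re = 0 → ‖∑ i ∈ S, b i * Complex.exp (u i + v i * ζ)‖ ≤ A)
    (h1 : ∀ ζ : ℂ, ζ.re = 1 → ‖∑ i ∈ S, b i * Complex.exp (u i + v i * ζ)‖ ≤ B)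
    (hθ : θ ∈ Icc (0 : ℝ) 1) :
    ‖∑ i ∈ S, b i * Complex.exp (u i + v i * (θ : ℂ))‖ ≤ A ^ (1 - θ) * B ^ θ := by
  have hd : Differentiable ℂ fun ζ : ℂ => ∑ i ∈ S, b i * Complex.exp (u i + v i * ζ) := by
    fun_prop
  refine Complex.HadamardThreeLines.norm_le_interp_of_mem_verticalClosedStrip₀₁'
    (fun ζ : ℂ => ∑ i ∈ S, b i * Complex.exp (u i + v i * ζ)) (z := (θ : ℂ)) ?_
    hd.diffContOnCl ?_ h0 h1
  · simpa [Complex.HadamardThreeLines.verticalClosedStrip] using hθ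
  · refine ⟨∑ i ∈ S, ‖b i‖ * Real.exp (u i + |v i|), ?_⟩
    rintro _ ⟨ζ, hζ, rfl⟩
    have hζ' : 0 ≤ ζ.re ∧ ζ.re ≤ 1 := hζ
    refine (norm_sum_le _ _).trans (Finset.sum_le_sum fun i _ => ?_)
    rw [norm_mul, Complex.norm_exp]
    refine mul_le_mul_of_nonneg_left (Real.exp_le_exp.2 ?_) (norm_nonneg _)
    simp only [Complex.add_re, Complex.ofReal_re, Complex.re_ofReal_mul]
    have h2 := abs_nonneg (v i)
    have h3 := le_abs_self (v i)
    nlinarith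

section Trilinear

variable {a : ℝ} {γ : ℝ → E d}

theorem convolution_sum_sum {K R : Type*} (I : Finset K) (J : Finset R) (b : K → ℂ) (c : R → ℂ)
    {D : K → E d → ℂ} {φ : R → E d → ℂ} (hD : ∀ k, Continuous (D k))
    (hDc : ∀ k, HasCompactSupport (D k)) (hφ : ∀ r ∈ J, Integrable (φ r)) (x : E d) :
    ((fun y => ∑ k ∈ I, b k * D k y) ⋆[ContinuousLinearMap.mul ℂ ℂ]
      fun y => ∑ r ∈ J, c r * φ r y) x =
    ∑ k ∈ I, ∑ r ∈ J, b k * c r * (D k ⋆[ContinuousLinearMap.mul ℂ ℂ] φ r) x := by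
  have hi : ∀ k, ∀ r ∈ J, Integrable fun t => D k t * φ r (x - t) := fun k r hr =>
    (hDc k).convolutionExists_left (ContinuousLinearMap.mul ℂ ℂ) (hD k)
      (hφ r hr).locallyIntegrable x
  simp only [convolution_def, ContinuousLinearMap.mul_apply']
  simp_rw [Finset.sum_mul_sum]
  rw [integral_finsetSum]
  · refine Finset.sum_congr rfl fun k _ => ?_
    rw [integral_finsetSum]
    · refine Finset.sum_congr rfl fun r _ => ?_
      rw [← integral_const_mul]
      congr 1
      funext t
      ring
    · intro r hr
      refine ((hi k r hr).const_mul (b k * c r)).congr (Filter.Eventually.of_forall fun t => ?_)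
      simp only
      ring
  · intro k _
    refine integrable_finsetSum _ fun r hr => ?_
    refine ((hi k r hr).const_mul (b k * c r)).congr (Filter.Eventually.of_forall fun t => ?_)
    simp only
    ring

theorem continuous_rotated_arg (hγ : Continuous γ) (σ : SO d) (x : E d) :
    Continuous fun t => x - rotate σ⁻¹ (γ t) :=
  continuous_const.sub ((rotateIsometry σ⁻¹).continuous.comp hγ)

theorem continuous_convolution {M f : E d → ℂ} (hM : Continuous M) (hMc : HasCompactSupport M)
    (hf : Integrable f) : Continuous (M ⋆[ContinuousLinearMap.mul ℂ ℂ] f) :=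
  hMc.continuous_convolution_left _ hM hf.locallyIntegrable

variable [MeasurableSpace (SO d)]

/-- The trilinear form whose kernel is to be interpolated: the kernel `M` is averaged over the
rotated curves, and then applied to `f` and tested against `g`. -/
def kernelForm (a : ℝ) (γ : ℝ → E d) (m : Measure (SO d × E d)) (M f : E d → ℂ)
    (g : SO d × E d → ℂ) : ℂ :=
  ∫ q, g q * curveAverage a γ (M ⋆[ContinuousLinearMap.mul ℂ ℂ] f) q.1 q.2 ∂m

/-- If the averages of the kernel over the rotated curves are bounded, the form is bounded on
`L¹ × L¹`. -/
theorem norm_kernelForm_le_of_bounded (hγ : Continuous γ)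
    {m : Measure (SO d × E d)} {M f : E d → ℂ} {g : SO d × E d → ℂ} (hM : Continuous M)
    (hMc : HasCompactSupport M) (hf : Integrable f) (hg : Integrable g m) {A : ℝ}
    (hA : ∀ σ x, ‖curveAverage a γ M σ x‖ ≤ A) :
    ‖kernelForm a γ m M f g‖ ≤ A * (∫ x, ‖f x‖) * ∫ q, ‖g q‖ ∂m := by
  obtain ⟨B, hB⟩ := hM.bounded_above_of_compact_support hMc
  have key : ∀ (σ : SO d) (x : E d), ‖curveAverage a γ (M ⋆[ContinuousLinearMap.mul ℂ ℂ] f) σ x‖ ≤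
      A * ∫ x, ‖f x‖ := by
    intro σ x
    have e : curveAverage a γ (M ⋆[ContinuousLinearMap.mul ℂ ℂ] f) σ x =
        ∫ y, curveAverage a γ M σ (x - y) * f y := by
      simp only [curveAverage, convolution_eq_swap, ContinuousLinearMap.mul_apply']
      rw [integral_integral_swap]
      · congr 1
        funext y
        rw [← integral_mul_const]
        congr 1
        funext t
        congr 2
        abel
      · have h1 : Integrable (fun q : ℝ × E d => f q.2)
            ((volume.restrict (Icc (-a) a)).prod volume) := hf.comp_snd _
        have hc : Continuous fun q : ℝ × E d => x - rotate σ⁻¹ (γ q.1) - q.2 :=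
          ((continuous_rotated_arg hγ σ x).comp continuous_fst).sub continuous_snd
        exact h1.bdd_mul (hM.comp hc).aestronglyMeasurable
          (Filter.Eventually.of_forall fun q => hB _)
    rw [e, ← integral_const_mul]
    refine norm_integral_le_of_norm_le (hf.norm.const_mul A)
      (Filter.Eventually.of_forall fun y => ?_)
    rw [norm_mul]
    exact mul_le_mul_of_nonneg_right (hA _ _) (norm_nonneg _)
  rw [← integral_const_mul]
  refine norm_integral_le_of_norm_le (hg.norm.const_mul _)
    (Filter.Eventually.of_forall fun q => ?_)
  rw [norm_mul, mul_comm]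
  exact mul_le_mul_of_nonneg_right (key _ _) (norm_nonneg _)

variable [BorelSpace (SO d)]

theorem integrable_kernelForm (ha : 0 < a) (hγ : Continuous γ) {m : Measure (SO d × E d)}
    {M f : E d → ℂ} {g : SO d × E d → ℂ} (hM : Continuous M) (hMc : HasCompactSupport M)
    (hf : Integrable f) (hg : Integrable g m) :
    Integrable (fun q => g q * curveAverage a γ (M ⋆[ContinuousLinearMap.mul ℂ ℂ] f) q.1 q.2)
      m := by
  obtain ⟨B, hB⟩ := hM.bounded_above_of_compact_support hMc
  have hb := norm_convolution_le hB hf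
  have hc := continuous_curveAverage (a := a) hγ (continuous_convolution hM hMc hf) hb
  exact hg.mul_bdd hc.aestronglyMeasurable
    (Filter.Eventually.of_forall fun q => norm_curveAverage_le ha hb q.1 q.2)

theorem kernelForm_sum (ha : 0 < a) (hγ : Continuous γ) {m : Measure (SO d × E d)}
    {K R S : Type*} (I : Finset K) (J : Finset R) (L : Finset S) (b : K → ℂ) (c : R → ℂ)
    (e : S → ℂ) {D : K → E d → ℂ} {φ : R → E d → ℂ} {ψ : S → SO d × E d → ℂ}
    (hD : ∀ k, Continuous (D k)) (hDc : ∀ k, HasCompactSupport (D k))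
    (hφ : ∀ r ∈ J, Integrable (φ r)) (hψ : ∀ s ∈ L, Integrable (ψ s) m) :
    kernelForm a γ m (fun y => ∑ k ∈ I, b k * D k y) (fun y => ∑ r ∈ J, c r * φ r y)
      (fun q => ∑ s ∈ L, e s * ψ s q) =
    ∑ k ∈ I, ∑ r ∈ J, ∑ s ∈ L, b k * c r * e s * kernelForm a γ m (D k) (φ r) (ψ s) := by
  have h1 : ∀ q : SO d × E d, curveAverage a γ ((fun y => ∑ k ∈ I, b k * D k y)
      ⋆[ContinuousLinearMap.mul ℂ ℂ] fun y => ∑ r ∈ J, c r * φ r y) q.1 q.2 =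
      ∑ k ∈ I, ∑ r ∈ J, b k * c r *
        curveAverage a γ (D k ⋆[ContinuousLinearMap.mul ℂ ℂ] φ r) q.1 q.2 := by
    intro q
    have hi : ∀ k, ∀ r ∈ J, IntegrableOn (fun t => b k * c r *
        (D k ⋆[ContinuousLinearMap.mul ℂ ℂ] φ r) (q.2 - rotate q.1⁻¹ (γ t))) (Icc (-a) a) := by
      intro k r hr
      have hc := (continuous_convolution (hD k) (hDc k) (hφ r hr)).comp
        (continuous_rotated_arg hγ q.1 q.2)
      exact (continuous_const.mul hc).integrableOn_Icc
    simp only [curveAverage]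
    simp_rw [fun x => convolution_sum_sum I J b c hD hDc hφ x]
    rw [integral_finsetSum _ fun k _ => integrable_finsetSum _ fun r hr => hi k r hr]
    refine Finset.sum_congr rfl fun k _ => ?_
    rw [integral_finsetSum _ fun r hr => hi k r hr]
    exact Finset.sum_congr rfl fun r _ => integral_const_mul _ _
  simp only [kernelForm]
  simp_rw [h1]
  have h2 : ∀ q : SO d × E d, (∑ s ∈ L, e s * ψ s q) * ∑ k ∈ I, ∑ r ∈ J, b k * c r *
        curveAverage a γ (D k ⋆[ContinuousLinearMap.mul ℂ ℂ] φ r) q.1 q.2 =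
      ∑ k ∈ I, ∑ r ∈ J, ∑ s ∈ L, b k * c r * e s * (ψ s q *
        curveAverage a γ (D k ⋆[ContinuousLinearMap.mul ℂ ℂ] φ r) q.1 q.2) := by
    intro q
    rw [Finset.mul_sum]
    refine Finset.sum_congr rfl fun k _ => ?_
    rw [Finset.mul_sum]
    refine Finset.sum_congr rfl fun r _ => ?_
    rw [Finset.sum_mul]
    refine Finset.sum_congr rfl fun s _ => ?_
    ring
  simp_rw [h2]
  have hi : ∀ k, ∀ r ∈ J, ∀ s ∈ L, Integrable (fun q => b k * c r * e s * (ψ s q *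
        curveAverage a γ (D k ⋆[ContinuousLinearMap.mul ℂ ℂ] φ r) q.1 q.2)) m :=
    fun k r hr s hs =>
      (integrable_kernelForm ha hγ (hD k) (hDc k) (hφ r hr) (hψ s hs)).const_mul _
  rw [integral_finsetSum _ fun k _ => integrable_finsetSum _ fun r hr =>
    integrable_finsetSum _ fun s hs => hi k r hr s hs]
  refine Finset.sum_congr rfl fun k _ => ?_
  rw [integral_finsetSum _ fun r hr => integrable_finsetSum _ fun s hs => hi k r hr s hs]
  refine Finset.sum_congr rfl fun r hr => ?_
  rw [integral_finsetSum _ fun s hs => hi k r hr s hs]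
  exact Finset.sum_congr rfl fun s _ => integral_const_mul _ _

/-- The bound for the form on `L² × L²`. -/
theorem enorm_kernelForm_le_of_sq (ha : 0 < a) (hγ : Continuous γ) {κ : Measure (SO d)}
    [IsFiniteMeasure κ] {M f : E d → ℂ} {g : SO d × E d → ℂ} (hM : Continuous M)
    (hMc : HasCompactSupport M) (hf : Integrable f) (hf2 : MemLp f 2)
    (hg : Integrable g (κ.prod volume)) {A : ℝ≥0∞} (hcF : Continuous (curveFourier a γ))
    (hA : ∀ ξ, ‖𝓕 M ξ‖ₑ ^ 2 * ∫⁻ σ, ‖curveFourier a γ (rotate σ ξ)‖ₑ ^ 2 ∂κ ≤ A) :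
    ‖kernelForm a γ (κ.prod volume) M f g‖ₑ ≤ (A * (∫⁻ x, ‖f x‖ₑ ^ 2)) ^ (1 / 2 : ℝ) *
      (∫⁻ q, ‖g q‖ₑ ^ 2 ∂(κ.prod volume)) ^ (1 / 2 : ℝ) := by
  have hU := integrable_kernelForm ha hγ hM hMc hf hg
  have h2 := lintegral_curveAverage_sq_le ha hγ κ hM hMc hf hf2 hcF hA
  obtain ⟨B, hB⟩ := hM.bounded_above_of_compact_support hMc
  have hc := continuous_curveAverage (a := a) hγ (continuous_convolution hM hMc hf)
    (norm_convolution_le hB hf)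
  refine (enorm_integral_le_lintegral_enorm _).trans ?_
  simp_rw [enorm_mul]
  have h3 := ENNReal.lintegral_mul_le_Lp_mul_Lq (κ.prod (volume : Measure (E d)))
    Real.HolderConjugate.two_two hg.aestronglyMeasurable.enorm hc.enorm.measurable.aemeasurable
  simp only [Pi.mul_apply, ENNReal.rpow_two] at h3
  refine h3.trans ?_
  rw [mul_comm]
  gcongr

end Trilinear

/-! ### Complex powers of simple functions -/

section SimplePowers

variable {X : Type*} [MeasurableSpace X] {μ : Measure X}

theorem ne_zero_of_re_pos {w : ℂ} (hw : 0 < w.re) : w ≠ 0 := by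
  rintro rfl
  simp at hw

theorem enorm_cpow_nnreal (r : ℝ≥0) {w : ℂ} (hw : 0 < w.re) :
    ‖((r : ℝ) : ℂ) ^ w‖ₑ = (r : ℝ≥0∞) ^ w.re := by
  have h := Complex.norm_cpow_eq_rpow_re_of_nonneg (x := (r : ℝ)) r.2 hw.ne'
  rw [← ofReal_norm, h, ← ENNReal.ofReal_rpow_of_nonneg r.coe_nonneg hw.le,
    ENNReal.ofReal_coe_nnreal]

theorem memLp_cpow_simpleFunc {f : SimpleFunc X ℝ≥0} (hf : f.FinMeasSupp μ) {w : ℂ}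
    (hw : 0 < w.re) (q : ℝ≥0∞) : MemLp (fun x => (((f x : ℝ≥0) : ℝ) : ℂ) ^ w) q μ := by
  have h : (f.map fun r : ℝ≥0 => ((r : ℝ) : ℂ) ^ w).FinMeasSupp μ := hf.map (by
    simp [Complex.zero_cpow (ne_zero_of_re_pos hw)])
  exact SimpleFunc.memLp_of_finite_measure_preimage q (SimpleFunc.finMeasSupp_iff.1 h)

/-- A complex power of a simple function, as a finite sum of exponentials. -/
theorem cpow_simpleFunc_eq_sum (f : SimpleFunc X ℝ≥0) {w : ℂ} (hw : 0 < w.re) (x : X) :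
    (((f x : ℝ≥0) : ℝ) : ℂ) ^ w = ∑ r ∈ f.range.filter (· ≠ 0),
      Complex.exp (Real.log r * w) * (f ⁻¹' {r}).indicator (fun _ => (1 : ℂ)) x := by
  by_cases h : f x = 0
  · rw [h, NNReal.coe_zero, Complex.ofReal_zero, Complex.zero_cpow (ne_zero_of_re_pos hw)]
    refine (Finset.sum_eq_zero fun r hr => ?_).symm
    have hr' := (Finset.mem_filter.1 hr).2
    rw [indicator_of_notMem, mul_zero]
    rw [mem_preimage, mem_singleton_iff, h]
    exact fun h' => hr' h'.symm
  · rw [Finset.sum_eq_single (f x)]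
    · rw [indicator_of_mem (by simp), mul_one, Complex.cpow_def_of_ne_zero (by simpa using h),
        Complex.ofReal_log (x := ((f x : ℝ≥0) : ℝ)) (f x).2]
    · intro r _ hr
      rw [indicator_of_notMem, mul_zero]
      rw [mem_preimage, mem_singleton_iff]
      exact fun h' => hr h'.symm
    · intro hx
      exact absurd (Finset.mem_filter.2 ⟨SimpleFunc.mem_range_self f x, h⟩) hx

theorem lintegral_rpow_simpleFunc_ne_top {f : SimpleFunc X ℝ≥0} (hf : f.FinMeasSupp μ) {p : ℝ}
    (hp : 0 < p) : ∫⁻ x, (f x : ℝ≥0∞) ^ p ∂μ ≠ ⊤ := by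
  have h := (memLp_one_iff_integrable.1
    (memLp_cpow_simpleFunc hf (w := (p : ℂ)) (by simpa using hp) 1)).2
  rw [hasFiniteIntegral_iff_enorm] at h
  simp_rw [enorm_cpow_nnreal _ (show 0 < ((p : ℂ)).re by simpa using hp), Complex.ofReal_re] at h
  exact h.ne

end SimplePowers

/-! ### Interpolation of the analytic family -/

/-- Stein's interpolation between the lines `Re z = d - 1` and `Re z = -1/2`, at `z = 0`. -/
theorem enorm_kernelForm_simpleFunc_le {a : ℝ} {γ : ℝ → E d} (hd : 2 ≤ d) (ha : 0 < a)
    (hγ : Continuous γ) [MeasurableSpace (SO d)] [BorelSpace (SO d)] {κ : Measure (SO d)}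
    [IsFiniteMeasure κ] {n : ℕ} {A₀ A₁ p θ : ℝ} (hA₀ : 0 ≤ A₀) (hA₁ : 0 ≤ A₁)
    (hp : p = (2 * d - 1) / d) (hθ : θ = (2 * d - 2) / (2 * d - 1))
    (hcF : Continuous (curveFourier a γ))
    (h0 : ∀ (z : ℂ) (σ : SO d) (x : E d), z.re = d - 1 →
      ‖curveAverage a γ (kernelSum d n z) σ x‖ ≤ A₀)
    (h1 : ∀ (z : ℂ) (ξ : E d), z.re = -(1 / 2) → ‖𝓕 (kernelSum d n z) ξ‖ₑ ^ 2 *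
      ∫⁻ σ, ‖curveFourier a γ (rotate σ ξ)‖ₑ ^ 2 ∂κ ≤ ENNReal.ofReal (A₁ ^ 2))
    {f : SimpleFunc (E d) ℝ≥0} (hf : f.FinMeasSupp volume)
    {g : SimpleFunc (SO d × E d) ℝ≥0} (hg : g.FinMeasSupp (κ.prod volume)) :
    ‖kernelForm a γ (κ.prod volume) (kernelSum d n 0) (fun y => ((f y : ℝ) : ℂ))
      (fun q => ((g q : ℝ) : ℂ))‖ₑ ≤ ENNReal.ofReal (A₀ ^ (1 - θ) * A₁ ^ θ) *
      (∫⁻ y, (f y : ℝ≥0∞) ^ p) ^ (1 / p) *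
      (∫⁻ q, (g q : ℝ≥0∞) ^ p ∂(κ.prod volume)) ^ (1 / p) := by
  have hdr : (2 : ℝ) ≤ d := by exact_mod_cast hd
  have hp0 : 0 < p := by
    rw [hp]
    exact div_pos (by linarith) (by linarith)
  have hθ01 : θ ∈ Icc (0 : ℝ) 1 := by
    rw [hθ]
    exact ⟨div_nonneg (by linarith) (by linarith), (div_le_one (by linarith)).2 (by linarith)⟩
  have hpθ : p * (1 - θ / 2) = 1 := by
    rw [hp, hθ]
    have : (2 : ℝ) * d - 1 ≠ 0 := by linarith
    field_simp
    ring
  have hzθ : ((d : ℝ) - 1) - (d - 1 / 2) * θ = 0 := by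
    have : (2 : ℝ) * d - 1 ≠ 0 := by linarith
    rw [hθ, sub_eq_zero, ← mul_div_assoc, eq_div_iff this]
    ring
  set m := κ.prod (volume : Measure (E d)) with hm
  set Nf := (∫⁻ y, (f y : ℝ≥0∞) ^ p).toReal with hNf
  set Ng := (∫⁻ q, (g q : ℝ≥0∞) ^ p ∂m).toReal with hNg
  have hNf' := ENNReal.ofReal_toReal (lintegral_rpow_simpleFunc_ne_top hf hp0)
  have hNg' := ENNReal.ofReal_toReal (lintegral_rpow_simpleFunc_ne_top hg hp0)
  rw [← hNf] at hNf'
  rw [← hNg] at hNg'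
  have hNf0 : 0 ≤ Nf := ENNReal.toReal_nonneg
  have hNg0 : 0 ≤ Ng := ENNReal.toReal_nonneg
  -- The line `Re ζ = 0` corresponds to `Re z = d - 1` and to `p`-th powers, which are integrable;
  -- the line `Re ζ = 1` to `Re z = -1/2` and to powers `p / 2`, which are square integrable. At
  -- `ζ = θ` both `z = 0` and the power is one.
  set w : ℂ → ℂ := fun ζ => p - (p / 2 : ℝ) * ζ with hw
  set Z : ℂ → ℂ := fun ζ => ((d : ℝ) - 1 : ℝ) - ((d : ℝ) - 1 / 2 : ℝ) * ζ with hZ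
  have hwre : ∀ ζ, (w ζ).re = p - p / 2 * ζ.re := fun ζ => by
    simp only [hw, Complex.sub_re, Complex.ofReal_re, Complex.re_ofReal_mul]
  have hZre : ∀ ζ, (Z ζ).re = (d - 1) - (d - 1 / 2) * ζ.re := fun ζ => by
    simp only [hZ, Complex.sub_re, Complex.ofReal_re, Complex.re_ofReal_mul]
  set φ : ℝ≥0 → E d → ℂ := fun r => (f ⁻¹' {r}).indicator fun _ => (1 : ℂ) with hφ
  set ψ : ℝ≥0 → SO d × E d → ℂ := fun r => (g ⁻¹' {r}).indicator fun _ => (1 : ℂ) with hψ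
  set J := f.range.filter (· ≠ 0) with hJ
  set L := g.range.filter (· ≠ 0) with hL
  have hφi : ∀ r ∈ J, Integrable (φ r) := fun r hr =>
    (integrable_indicator_iff (f.measurableSet_preimage _)).2 (integrableOn_const
      (hf.meas_preimage_singleton_ne_zero (Finset.mem_filter.1 hr).2).ne)
  have hψi : ∀ r ∈ L, Integrable (ψ r) m := fun r hr =>
    (integrable_indicator_iff (g.measurableSet_preimage _)).2 (integrableOn_const
      (hg.meas_preimage_singleton_ne_zero (Finset.mem_filter.1 hr).2).ne)
  set S := Finset.range n ×ˢ J ×ˢ L with hS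
  set b : ℕ × ℝ≥0 × ℝ≥0 → ℂ := fun i => kernelForm a γ m (kernelDiff d i.1) (φ i.2.1) (ψ i.2.2)
    with hb
  set u : ℕ × ℝ≥0 × ℝ≥0 → ℝ := fun i =>
    -(i.1 * Real.log 4) * (d - 1) + (Real.log i.2.1 + Real.log i.2.2) * p with hu
  set v : ℕ × ℝ≥0 × ℝ≥0 → ℝ := fun i =>
    i.1 * Real.log 4 * (d - 1 / 2) - (Real.log i.2.1 + Real.log i.2.2) * (p / 2) with hv
  have hform : ∀ ζ : ℂ, 0 < (w ζ).re → kernelForm a γ m (kernelSum d n (Z ζ))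
      (fun y => ((f y : ℝ) : ℂ) ^ w ζ) (fun q => ((g q : ℝ) : ℂ) ^ w ζ) =
      ∑ i ∈ S, b i * Complex.exp (u i + v i * ζ) := by
    intro ζ hζ
    simp_rw [cpow_simpleFunc_eq_sum f hζ, cpow_simpleFunc_eq_sum g hζ]
    unfold kernelSum
    rw [kernelForm_sum ha hγ _ _ _ _ _ _ continuous_kernelDiff hasCompactSupport_kernelDiff
      hφi hψi, hS, Finset.sum_product]
    refine Finset.sum_congr rfl fun k _ => ?_
    rw [Finset.sum_product]
    refine Finset.sum_congr rfl fun r _ => Finset.sum_congr rfl fun s _ => ?_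
    simp only [hb, hu, hv]
    rw [← Complex.exp_add, ← Complex.exp_add, mul_comm]
    congr 2
    simp only [hw, hZ]
    push_cast
    ring
  have hcs := fun z => continuous_kernelSum (d := d) n z
  have hks := fun z => hasCompactSupport_kernelSum (d := d) n z
  have hfi : ∀ ζ, 0 < (w ζ).re → Integrable fun y => ((f y : ℝ) : ℂ) ^ w ζ := fun ζ hζ =>
    memLp_one_iff_integrable.1 (memLp_cpow_simpleFunc hf hζ 1)
  have hgi : ∀ ζ, 0 < (w ζ).re → Integrable (fun y => ((g y : ℝ) : ℂ) ^ w ζ) m := fun ζ hζ =>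
    memLp_one_iff_integrable.1 (memLp_cpow_simpleFunc hg hζ 1)
  have key := norm_expSum_le S b u v (A := A₀ * Nf * Ng) (B := A₁ * (Nf * Ng) ^ (1 / 2 : ℝ))
    (θ := θ) ?_ ?_ hθ01
  · rw [← hform θ (by
      rw [hwre, Complex.ofReal_re]
      have := hθ01.2
      nlinarith)] at key
    have e1 : w θ = 1 := by
      simp only [hw]
      have : p - p / 2 * θ = 1 := by linarith
      exact_mod_cast this
    have e2 : Z θ = 0 := by
      simp only [hZ]
      exact_mod_cast hzθ
    simp only [e1, e2, Complex.cpow_one] at key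
    have e3 : (A₀ * Nf * Ng) ^ (1 - θ) * (A₁ * (Nf * Ng) ^ (1 / 2 : ℝ)) ^ θ =
        A₀ ^ (1 - θ) * A₁ ^ θ * Nf ^ (1 / p) * Ng ^ (1 / p) := by
      have e4 : 1 / p = (1 - θ) + 1 / 2 * θ := by
        rw [div_eq_iff hp0.ne']
        linarith
      have hX : 0 ≤ Nf * Ng := mul_nonneg hNf0 hNg0
      rw [mul_assoc A₀, Real.mul_rpow hA₀ hX, Real.mul_rpow hA₁ (by positivity),
        ← Real.rpow_mul hX, mul_assoc (_ * _) (Nf ^ _), ← Real.mul_rpow hNf0 hNg0, e4,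
        Real.rpow_add_of_nonneg hX (by linarith [hθ01.2]) (by linarith [hθ01.1])]
      ring
    rw [e3] at key
    rw [← hNf', ← hNg', ENNReal.ofReal_rpow_of_nonneg hNf0 (by positivity),
      ENNReal.ofReal_rpow_of_nonneg hNg0 (by positivity), ← ENNReal.ofReal_mul (by positivity),
      ← ENNReal.ofReal_mul (by positivity), ← ofReal_norm]
    exact ENNReal.ofReal_le_ofReal key
  · intro ζ hζ
    have hwp : (w ζ).re = p := by rw [hwre, hζ]; ring
    have hw0 : 0 < (w ζ).re := by rw [hwp]; exact hp0
    rw [← hform ζ hw0]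
    refine (norm_kernelForm_le_of_bounded hγ (hcs _) (hks _) (hfi ζ hw0) (hgi ζ hw0)
      (fun σ x => h0 (Z ζ) σ x (by rw [hZre, hζ]; ring))).trans (le_of_eq ?_)
    rw [integral_norm_eq_lintegral_enorm (hfi ζ hw0).1,
      integral_norm_eq_lintegral_enorm (hgi ζ hw0).1]
    simp_rw [enorm_cpow_nnreal _ hw0, hwp]
    rw [hNf, hNg]
  · intro ζ hζ
    have hwp : (w ζ).re = p / 2 := by rw [hwre, hζ]; ring
    have hw0 : 0 < (w ζ).re := by rw [hwp]; positivity
    rw [← hform ζ hw0]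
    have h2 := enorm_kernelForm_le_of_sq ha hγ (hcs _) (hks _) (hfi ζ hw0)
      (memLp_cpow_simpleFunc hf hw0 2) (hgi ζ hw0) hcF
      (fun ξ => h1 (Z ζ) ξ (by rw [hZre, hζ]; ring))
    have e : ∀ r : ℝ≥0, ‖((r : ℝ) : ℂ) ^ w ζ‖ₑ ^ 2 = (r : ℝ≥0∞) ^ p := fun r => by
      rw [enorm_cpow_nnreal _ hw0, hwp, ← ENNReal.rpow_natCast, ← ENNReal.rpow_mul]
      congr 1
      push_cast
      ring
    simp_rw [e] at h2
    rw [← hNf', ← hNg', ← ENNReal.ofReal_mul (by positivity),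
      ENNReal.ofReal_rpow_of_nonneg (by positivity) (by norm_num),
      ENNReal.ofReal_rpow_of_nonneg hNg0 (by norm_num), ← ENNReal.ofReal_mul (by positivity),
      ← ofReal_norm, ENNReal.ofReal_le_ofReal_iff (by positivity)] at h2
    refine h2.trans (le_of_eq ?_)
    rw [Real.mul_rpow (by positivity) hNf0, Real.mul_rpow hNf0 hNg0, ← Real.sqrt_eq_rpow (A₁ ^ 2),
      Real.sqrt_sq hA₁]
    ring

open Filter Topology

/-! ### From simple functions to continuous functions -/

theorem exists_simpleFunc_approx {X : Type*} [MeasurableSpace X] {μ : Measure X} {V : X → ℝ≥0∞}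
    (hV : Measurable V) {s : Set X} (hs : μ s ≠ ⊤) (hVs : ∀ x, x ∉ s → V x = 0) :
    ∃ g : ℕ → SimpleFunc X ℝ≥0, (∀ j, (g j).FinMeasSupp μ) ∧
      (∀ x, Monotone fun j => (g j x : ℝ≥0∞)) ∧ (∀ j x, (g j x : ℝ≥0∞) ≤ V x) ∧
      ∀ x, Tendsto (fun j => (g j x : ℝ≥0∞)) atTop (𝓝 (V x)) := by
  have e : ∀ j x, ((((SimpleFunc.eapprox V j).map ENNReal.toNNReal) x : ℝ≥0) : ℝ≥0∞) =
      SimpleFunc.eapprox V j x := fun j x =>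
    ENNReal.coe_toNNReal (SimpleFunc.eapprox_lt_top V j x).ne
  have hle : ∀ j x, SimpleFunc.eapprox V j x ≤ V x := fun j x => by
    rw [← SimpleFunc.iSup_eapprox_apply hV x]
    exact le_iSup (fun n => SimpleFunc.eapprox V n x) j
  refine ⟨fun j => (SimpleFunc.eapprox V j).map ENNReal.toNNReal, fun j => ?_, fun x i j hij => ?_,
    fun j x => ?_, fun x => ?_⟩
  · rw [SimpleFunc.finMeasSupp_iff_support]
    refine (measure_mono fun x hx => ?_).trans_lt hs.lt_top
    by_contra hxs
    refine hx ?_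
    have := hle j x
    rw [hVs x hxs, ← e j x] at this
    simpa using this
  · simp only [e]
    exact SimpleFunc.monotone_eapprox V hij x
  · rw [e]
    exact hle j x
  · simp only [e]
    exact SimpleFunc.tendsto_eapprox hV x

/-- The average of a nonnegative function over a rotated curve. -/
def posAverage (a : ℝ) (γ : ℝ → E d) (F : E d → ℝ≥0∞) (q : SO d × E d) : ℝ≥0∞ :=
  ∫⁻ t in Icc (-a) a, F (q.2 - rotate q.1⁻¹ (γ t))

section

variable {a : ℝ} {γ : ℝ → E d}

theorem posAverage_le {F : E d → ℝ≥0∞} {B : ℝ≥0∞} (hB : ∀ x, F x ≤ B) (q : SO d × E d) :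
    posAverage a γ F q ≤ B * ENNReal.ofReal (2 * a) := by
  refine (lintegral_mono fun t => hB _).trans (le_of_eq ?_)
  rw [setLIntegral_const, Real.volume_Icc]
  congr 2
  ring

theorem curveAverage_coe_eq {f : E d → ℝ≥0} (hf : Continuous f) (hγ : Continuous γ)
    (q : SO d × E d) : curveAverage a γ (fun y => ((f y : ℝ) : ℂ)) q.1 q.2 =
      (((posAverage a γ (fun y => (f y : ℝ≥0∞)) q).toReal : ℝ) : ℂ) := by
  have hc : Continuous fun t => ((f (q.2 - rotate q.1⁻¹ (γ t)) : ℝ≥0) : ℝ) :=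
    NNReal.continuous_coe.comp (hf.comp (continuous_rotated_arg hγ q.1 q.2))
  simp only [curveAverage, posAverage]
  rw [integral_complex_ofReal, integral_eq_lintegral_of_nonneg_ae
    (Eventually.of_forall fun t => NNReal.coe_nonneg _) hc.aestronglyMeasurable]
  simp_rw [ENNReal.ofReal_coe_nnreal]

theorem tendsto_curveAverage (hγ : Continuous γ) {H : ℕ → E d → ℂ} {h : E d → ℂ}
    (hH : ∀ j, Continuous (H j)) {B : ℝ} (hB : ∀ j x, ‖H j x‖ ≤ B)
    (hlim : ∀ x, Tendsto (fun j => H j x) atTop (𝓝 (h x))) (σ : SO d) (x : E d) :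
    Tendsto (fun j => curveAverage a γ (H j) σ x) atTop (𝓝 (curveAverage a γ h σ x)) := by
  refine tendsto_integral_of_dominated_convergence (fun _ => B) (fun j => ?_) (integrable_const _)
    (fun j => Eventually.of_forall fun t => hB _ _) (Eventually.of_forall fun t => hlim _)
  exact ((hH j).comp (continuous_rotated_arg hγ σ x)).aestronglyMeasurable

/-- Approximate identities: the dilates of a kernel concentrate at the origin. -/
theorem tendsto_dilate_convolution {G f : E d → ℂ} (hG : Continuous G) (hGc : HasCompactSupport G)
    (hf : Continuous f) {B : ℝ} (hB : ∀ x, ‖f x‖ ≤ B) :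
    (∀ n x, ‖(dilate n G ⋆[ContinuousLinearMap.mul ℂ ℂ] f) x‖ ≤ (∫ y, ‖G y‖) * B) ∧
    ∀ x, Tendsto (fun n => (dilate n G ⋆[ContinuousLinearMap.mul ℂ ℂ] f) x) atTop
      (𝓝 ((∫ y, G y) * f x)) := by
  have hGi : Integrable G := hG.integrable_of_hasCompactSupport hGc
  have e : ∀ n x, (dilate n G ⋆[ContinuousLinearMap.mul ℂ ℂ] f) x =
      ∫ u, G u * f (x - ((4 : ℝ) ^ n)⁻¹ • u) := by
    intro n x
    have h := Measure.integral_comp_smul (volume : Measure (E d))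
      (fun u => G u * f (x - ((4 : ℝ) ^ n)⁻¹ • u)) ((4 : ℝ) ^ n)
    have h4 : (4 : ℝ) ^ n ≠ 0 := by positivity
    simp only [inv_smul_smul₀ h4] at h
    simp only [convolution_def, ContinuousLinearMap.mul_apply', dilate, mul_assoc]
    rw [integral_const_mul, h, finrank_euclideanSpace, Fintype.card_fin, abs_inv,
      abs_of_pos (by positivity), ← pow_mul, ← Complex.real_smul, smul_smul,
      mul_inv_cancel₀ (by positivity), one_smul]
  have hb : ∀ n x u, ‖G u * f (x - ((4 : ℝ) ^ n)⁻¹ • u)‖ ≤ ‖G u‖ * B := fun n x u => by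
    rw [norm_mul]
    exact mul_le_mul_of_nonneg_left (hB _) (norm_nonneg _)
  refine ⟨fun n x => ?_, fun x => ?_⟩
  · rw [e, ← integral_mul_const]
    exact norm_integral_le_of_norm_le (hGi.norm.mul_const B) (Eventually.of_forall (hb n x))
  · simp_rw [e]
    rw [← integral_mul_const]
    refine tendsto_integral_of_dominated_convergence (fun u => ‖G u‖ * B) (fun n => ?_)
      (hGi.norm.mul_const B) (fun n => Eventually.of_forall (hb n x))
      (Eventually.of_forall fun u => ?_)
    · exact (hG.mul (hf.comp (by fun_prop))).aestronglyMeasurable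
    · refine Tendsto.const_mul _ ((hf.tendsto x).comp ?_)
      have h4 : Tendsto (fun n : ℕ => ((4 : ℝ) ^ n)⁻¹) atTop (𝓝 0) :=
        tendsto_inv_atTop_zero.comp (tendsto_pow_atTop_atTop_of_one_lt (by norm_num))
      have := (tendsto_const_nhds (x := x)).sub (h4.smul_const u)
      simpa using this

variable [MeasurableSpace (SO d)] [BorelSpace (SO d)]

theorem measurable_posAverage (hγ : Continuous γ) {F : E d → ℝ≥0∞} (hF : Measurable F) :
    Measurable (posAverage a γ F) := by
  have h : Measurable fun q : (SO d × E d) × ℝ => F (q.1.2 - rotate q.1.1⁻¹ (γ q.2)) :=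
    hF.comp (continuous_arg hγ).measurable
  exact h.lintegral_prod_right'

theorem tendsto_integral_curveAverage (ha : 0 < a) (hγ : Continuous γ)
    {m : Measure (SO d × E d)} {g : SO d × E d → ℂ} (hg : Integrable g m) {H : ℕ → E d → ℂ}
    {h : E d → ℂ} (hH : ∀ j, Continuous (H j)) {B : ℝ} (hB : ∀ j x, ‖H j x‖ ≤ B)
    (hlim : ∀ x, Tendsto (fun j => H j x) atTop (𝓝 (h x))) :
    Tendsto (fun j => ∫ q, g q * curveAverage a γ (H j) q.1 q.2 ∂m) atTop
      (𝓝 (∫ q, g q * curveAverage a γ h q.1 q.2 ∂m)) := by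
  refine tendsto_integral_of_dominated_convergence (fun q => ‖g q‖ * (2 * a * B)) (fun j => ?_)
    (hg.norm.mul_const _) (fun j => Eventually.of_forall fun q => ?_)
    (Eventually.of_forall fun q => (tendsto_curveAverage hγ hH hB hlim q.1 q.2).const_mul _)
  · exact hg.aestronglyMeasurable.mul
      (continuous_curveAverage hγ (hH j) (hB j)).aestronglyMeasurable
  · rw [norm_mul]
    exact mul_le_mul_of_nonneg_left (norm_curveAverage_le ha (hB j) _ _) (norm_nonneg _)

/-- Bounds for the forms of all the dilates of a kernel pass to the average over rotated curves. -/
theorem lintegral_mul_posAverage_le (ha : 0 < a) (hγ : Continuous γ) {m : Measure (SO d × E d)}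
    {G : E d → ℂ} (hG : Continuous G) (hGc : HasCompactSupport G) {p : ℝ} (hp : 0 < p) {K : ℝ≥0∞}
    (hK : ∀ (n : ℕ) (f : SimpleFunc (E d) ℝ≥0) (g : SimpleFunc (SO d × E d) ℝ≥0),
      f.FinMeasSupp volume → g.FinMeasSupp m →
      ‖kernelForm a γ m (dilate n G) (fun y => ((f y : ℝ) : ℂ)) (fun q => ((g q : ℝ) : ℂ))‖ₑ ≤
        K * (∫⁻ y, (f y : ℝ≥0∞) ^ p) ^ (1 / p) * (∫⁻ q, (g q : ℝ≥0∞) ^ p ∂m) ^ (1 / p))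
    {f : E d → ℝ≥0} (hf : Continuous f) (hfc : HasCompactSupport f)
    {g : SimpleFunc (SO d × E d) ℝ≥0} (hg : g.FinMeasSupp m) :
    ‖∫ y, G y‖ₑ * ∫⁻ q, g q * posAverage a γ (fun y => (f y : ℝ≥0∞)) q ∂m ≤
      K * (∫⁻ y, (f y : ℝ≥0∞) ^ p) ^ (1 / p) * (∫⁻ q, (g q : ℝ≥0∞) ^ p ∂m) ^ (1 / p) := by
  set fc : E d → ℂ := fun y => ((f y : ℝ) : ℂ) with hfcdef
  set gc : SO d × E d → ℂ := fun q => ((g q : ℝ) : ℂ) with hgc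
  have hgi : Integrable gc m := by
    have := memLp_one_iff_integrable.1 (memLp_cpow_simpleFunc hg (w := 1) (by simp) 1)
    simpa only [Complex.cpow_one] using this
  have hfcc : Continuous fc := Complex.continuous_ofReal.comp (NNReal.continuous_coe.comp hf)
  have hfcs : HasCompactSupport fc :=
    hfc.comp_left (g := fun r : ℝ≥0 => ((r : ℝ) : ℂ)) (by simp)
  have hfi : Integrable fc := hfcc.integrable_of_hasCompactSupport hfcs
  obtain ⟨B, hB⟩ := hfcc.bounded_above_of_compact_support hfcs
  -- the estimate for the dilates of the kernel and continuous functions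
  have h1 : ∀ n, ‖kernelForm a γ m (dilate n G) fc gc‖ₑ ≤
      K * (∫⁻ y, (f y : ℝ≥0∞) ^ p) ^ (1 / p) * (∫⁻ q, (g q : ℝ≥0∞) ^ p ∂m) ^ (1 / p) := by
    intro n
    have hD := continuous_dilate n hG
    have hDc := hasCompactSupport_dilate n hGc
    obtain ⟨B', hB'⟩ := hD.bounded_above_of_compact_support hDc
    have hV : Measurable fun y => (f y : ℝ≥0∞) := hf.measurable.coe_nnreal_ennreal
    obtain ⟨φ, hφ1, -, hφ3, hφ4⟩ := exists_simpleFunc_approx (μ := (volume : Measure (E d))) hV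
      (s := tsupport f) hfc.isCompact.measure_lt_top.ne
      (fun x hx => by rw [image_eq_zero_of_notMem_tsupport hx, ENNReal.coe_zero])
    have hφi : ∀ j, Integrable fun y => ((φ j y : ℝ) : ℂ) := fun j => by
      have := memLp_one_iff_integrable.1 (memLp_cpow_simpleFunc (hφ1 j) (w := 1) (by simp) 1)
      simpa only [Complex.cpow_one] using this
    have hφn : ∀ j y, ‖((φ j y : ℝ) : ℂ)‖ ≤ ‖fc y‖ := fun j y => by
      rw [Complex.norm_real, Complex.norm_real, NNReal.norm_eq, NNReal.norm_eq]
      exact_mod_cast hφ3 j y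
    have hlim : Tendsto (fun j => kernelForm a γ m (dilate n G) (fun y => ((φ j y : ℝ) : ℂ)) gc)
        atTop (𝓝 (kernelForm a γ m (dilate n G) fc gc)) := by
      refine tendsto_integral_curveAverage ha hγ hgi (B := B' * ∫ y, ‖fc y‖)
        (fun j => continuous_convolution hD hDc (hφi j)) (fun j x => ?_) (fun x => ?_)
      · refine (norm_convolution_le hB' (hφi j) x).trans
          (mul_le_mul_of_nonneg_left ?_ ((norm_nonneg _).trans (hB' 0)))
        exact integral_mono (hφi j).norm hfi.norm (hφn j)
      · simp only [convolution_eq_swap, ContinuousLinearMap.mul_apply']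
        refine tendsto_integral_of_dominated_convergence (fun y => B' * ‖fc y‖) (fun j => ?_)
          (hfi.norm.const_mul _) (fun j => Eventually.of_forall fun y => ?_)
          (Eventually.of_forall fun y => ?_)
        · exact (hD.comp (continuous_const.sub continuous_id)).aestronglyMeasurable.mul
            (hφi j).aestronglyMeasurable
        · rw [norm_mul]
          exact mul_le_mul (hB' _) (hφn j y) (norm_nonneg _) ((norm_nonneg _).trans (hB' 0))
        · refine Tendsto.const_mul _ ?_
          exact (Complex.continuous_ofReal.tendsto _).comp
            ((NNReal.continuous_coe.tendsto _).comp (ENNReal.tendsto_coe.1 (hφ4 y)))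
    refine le_of_tendsto hlim.enorm
      (Eventually.of_forall fun j => (hK n (φ j) g (hφ1 j) hg).trans ?_)
    gcongr with y
    exact_mod_cast hφ3 j y
  -- the dilates tend to a multiple of the delta measure
  obtain ⟨hb, hl⟩ := tendsto_dilate_convolution hG hGc hfcc hB
  have h2 := tendsto_integral_curveAverage (a := a) ha hγ hgi
    (fun n => continuous_convolution (continuous_dilate n hG) (hasCompactSupport_dilate n hGc) hfi)
    hb hl
  have h3 : ∫ q, gc q * curveAverage a γ (fun x => (∫ y, G y) * fc x) q.1 q.2 ∂m =
      (∫ y, G y) * ((∫ q, (g q : ℝ) * (posAverage a γ (fun y => (f y : ℝ≥0∞)) q).toReal ∂m : ℝ)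
        : ℂ) := by
    rw [← integral_complex_ofReal, ← integral_const_mul]
    congr 1
    funext q
    have : curveAverage a γ (fun x => (∫ y, G y) * fc x) q.1 q.2 =
        (∫ y, G y) * curveAverage a γ fc q.1 q.2 := integral_const_mul _ _
    rw [this, curveAverage_coe_eq hf hγ, hgc]
    push_cast
    ring
  have hB2 : ∀ y, (f y : ℝ≥0∞) ≤ ENNReal.ofReal B := fun y => by
    rw [← ENNReal.ofReal_coe_nnreal]
    refine ENNReal.ofReal_le_ofReal ?_
    have := hB y
    rwa [Complex.norm_real, NNReal.norm_eq] at this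
  have hfin : ∀ q, posAverage a γ (fun y => (f y : ℝ≥0∞)) q ≠ ⊤ := fun q =>
    ((posAverage_le hB2 q).trans_lt
      (ENNReal.mul_lt_top ENNReal.ofReal_lt_top ENNReal.ofReal_lt_top)).ne
  have hmeas := measurable_posAverage (a := a) hγ hf.measurable.coe_nnreal_ennreal
  have h4 : ‖(∫ q, (g q : ℝ) * (posAverage a γ (fun y => (f y : ℝ≥0∞)) q).toReal ∂m : ℝ)‖ₑ =
      ∫⁻ q, g q * posAverage a γ (fun y => (f y : ℝ≥0∞)) q ∂m := by
    have hnn : ∀ q, 0 ≤ (g q : ℝ) * (posAverage a γ (fun y => (f y : ℝ≥0∞)) q).toReal := fun q =>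
      mul_nonneg (NNReal.coe_nonneg _) ENNReal.toReal_nonneg
    have hgi' : Integrable (fun q => (g q : ℝ)) m := by
      have := hgi.re
      simpa [hgc] using this
    have hint : Integrable (fun q => (g q : ℝ) *
        (posAverage a γ (fun y => (f y : ℝ≥0∞)) q).toReal) m := by
      refine hgi'.mul_bdd (c := (ENNReal.ofReal B * ENNReal.ofReal (2 * a)).toReal)
        hmeas.ennreal_toReal.aestronglyMeasurable (Eventually.of_forall fun q => ?_)
      rw [Real.norm_of_nonneg ENNReal.toReal_nonneg]
      exact ENNReal.toReal_mono (ENNReal.mul_ne_top ENNReal.ofReal_ne_top ENNReal.ofReal_ne_top)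
        (posAverage_le hB2 q)
    rw [Real.enorm_of_nonneg (integral_nonneg hnn), ofReal_integral_eq_lintegral_ofReal hint
      (Eventually.of_forall hnn)]
    refine lintegral_congr fun q => ?_
    rw [ENNReal.ofReal_mul (NNReal.coe_nonneg _), ENNReal.ofReal_coe_nnreal,
      ENNReal.ofReal_toReal (hfin q)]
  rw [h3] at h2
  have h5 := le_of_tendsto h2.enorm (Eventually.of_forall h1)
  rw [enorm_mul] at h5
  have h6 : ∀ r : ℝ, ‖(r : ℂ)‖ₑ = ‖r‖ₑ := fun r => by
    rw [← ofReal_norm, ← ofReal_norm, Complex.norm_real]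
  rwa [h6, h4] at h5

end

/-! ### Duality and the choice of the weight -/

theorem exists_posAverage_eq_zero {a : ℝ} {γ : ℝ → E d} (hγ : Continuous γ) {f : E d → ℝ≥0}
    (hfc : HasCompactSupport f) :
    ∃ R : ℝ, ∀ q : SO d × E d, R < ‖q.2‖ → posAverage a γ (fun y => (f y : ℝ≥0∞)) q = 0 := by
  obtain ⟨R₁, h1⟩ := hfc.isCompact.isBounded.exists_norm_le
  obtain ⟨R₂, h2⟩ := (isCompact_Icc (a := -a) (b := a)).exists_bound_of_continuousOn
    hγ.continuousOn
  refine ⟨R₁ + R₂, fun q hq => ?_⟩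
  refine (setLIntegral_congr_fun measurableSet_Icc fun t ht => ?_).trans lintegral_zero
  have h3 : q.2 - rotate q.1⁻¹ (γ t) ∉ tsupport f := by
    intro hmem
    have h4 := h1 _ hmem
    have h5 := norm_sub_norm_le q.2 (rotate q.1⁻¹ (γ t))
    rw [norm_rotate] at h5
    have := h2 t ht
    linarith
  simp only
  rw [image_eq_zero_of_notMem_tsupport h3, ENNReal.coe_zero]

theorem exists_coe_le {f : E d → ℝ≥0} (hf : Continuous f) (hfc : HasCompactSupport f) :
    ∃ B : ℝ≥0, ∀ y, (f y : ℝ≥0∞) ≤ B := by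
  obtain ⟨B, hB⟩ := (hfc.isCompact_range hf).bddAbove
  exact ⟨B, fun y => ENNReal.coe_le_coe.2 (hB (mem_range_self y))⟩

theorem lintegral_posAverage_rpow_ne_top {a : ℝ} {γ : ℝ → E d} (hγ : Continuous γ)
    {f : E d → ℝ≥0} (hf : Continuous f) (hfc : HasCompactSupport f) {q : ℝ} (hq : 0 < q) :
    ∃ B : ℝ≥0, ∀ σ : SO d,
      ∫⁻ x, posAverage a γ (fun y => (f y : ℝ≥0∞)) (σ, x) ^ q ≤ B := by
  obtain ⟨R, hR⟩ := exists_posAverage_eq_zero (a := a) hγ hfc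
  obtain ⟨B, hB⟩ := exists_coe_le hf hfc
  set D : ℝ≥0∞ := (B * ENNReal.ofReal (2 * a)) ^ q with hD
  have hDt : D ≠ ⊤ := ENNReal.rpow_ne_top_of_nonneg hq.le
    (ENNReal.mul_ne_top ENNReal.coe_ne_top ENNReal.ofReal_ne_top)
  have hv : volume (Metric.closedBall (0 : E d) R) ≠ ⊤ := measure_closedBall_lt_top.ne
  refine ⟨(D * volume (Metric.closedBall (0 : E d) R)).toNNReal, fun σ => ?_⟩
  rw [ENNReal.coe_toNNReal (ENNReal.mul_ne_top hDt hv), ← setLIntegral_const,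
    ← lintegral_indicator measurableSet_closedBall]
  refine lintegral_mono fun x => ?_
  by_cases hx : x ∈ Metric.closedBall (0 : E d) R
  · rw [indicator_of_mem hx]
    exact ENNReal.rpow_le_rpow (posAverage_le hB _) hq.le
  · rw [hR (σ, x) (by simpa using hx), ENNReal.zero_rpow_of_pos hq]
    exact zero_le

section

variable {a : ℝ} {γ : ℝ → E d} [MeasurableSpace (SO d)] [BorelSpace (SO d)]

/-- Duality turns bounds for the bilinear forms into a bound for the average. -/
theorem lintegral_posAverage_rpow_le (ha : 0 < a) (hγ : Continuous γ) {κ : Measure (SO d)}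
    [IsFiniteMeasure κ] {G : E d → ℂ} (hG : Continuous G) (hGc : HasCompactSupport G) {p p' : ℝ}
    (hpp : p.HolderConjugate p') {K : ℝ≥0∞}
    (hK : ∀ (n : ℕ) (f : SimpleFunc (E d) ℝ≥0) (g : SimpleFunc (SO d × E d) ℝ≥0),
      f.FinMeasSupp volume → g.FinMeasSupp (κ.prod volume) →
      ‖kernelForm a γ (κ.prod volume) (dilate n G) (fun y => ((f y : ℝ) : ℂ))
        (fun q => ((g q : ℝ) : ℂ))‖ₑ ≤
        K * (∫⁻ y, (f y : ℝ≥0∞) ^ p) ^ (1 / p) *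
          (∫⁻ q, (g q : ℝ≥0∞) ^ p ∂(κ.prod volume)) ^ (1 / p))
    {f : E d → ℝ≥0} (hf : Continuous f) (hfc : HasCompactSupport f) :
    ‖∫ y, G y‖ₑ * (∫⁻ q, posAverage a γ (fun y => (f y : ℝ≥0∞)) q ^ p'
      ∂(κ.prod volume)) ^ (1 / p') ≤ K * (∫⁻ y, (f y : ℝ≥0∞) ^ p) ^ (1 / p) := by
  set m := κ.prod (volume : Measure (E d)) with hm
  set u := posAverage a γ (fun y => (f y : ℝ≥0∞)) with hu
  have hum : Measurable u := measurable_posAverage hγ hf.measurable.coe_nnreal_ennreal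
  have hp0 := hpp.pos
  have hp0' := hpp.symm.pos
  have hp1' := hpp.symm.lt
  set I := ∫⁻ q, u q ^ p' ∂m with hI
  have hIt : I ≠ ⊤ := by
    obtain ⟨B, hB⟩ := lintegral_posAverage_rpow_ne_top (a := a) hγ hf hfc hp0'
    rw [hI, hm, lintegral_prod _ (hum.pow_const _).aemeasurable]
    refine ((lintegral_mono hB).trans_lt ?_).ne
    rw [lintegral_const]
    exact ENNReal.mul_lt_top ENNReal.coe_lt_top (measure_lt_top _ _)
  obtain ⟨R, hR⟩ := exists_posAverage_eq_zero (a := a) hγ hfc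
  obtain ⟨g, hg1, hg2, hg3, hg4⟩ := exists_simpleFunc_approx (μ := m) (V := fun q => u q ^ (p' - 1))
    (hum.pow_const _) (s := univ ×ˢ Metric.closedBall 0 R) (by
      rw [hm, Measure.prod_prod]
      exact ENNReal.mul_ne_top (measure_ne_top _ _) measure_closedBall_lt_top.ne)
    (fun q hq => by
      have : R < ‖q.2‖ := by simpa using hq
      rw [hu, hR q this, ENNReal.zero_rpow_of_pos (by linarith)])
  have h1 : ∀ j, ‖∫ y, G y‖ₑ * ∫⁻ q, g j q * u q ∂m ≤
      K * (∫⁻ y, (f y : ℝ≥0∞) ^ p) ^ (1 / p) * I ^ (1 / p) := by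
    intro j
    refine (lintegral_mul_posAverage_le ha hγ hG hGc hp0 hK hf hfc (hg1 j)).trans ?_
    refine mul_le_mul' le_rfl (ENNReal.rpow_le_rpow (lintegral_mono fun q => ?_) (by positivity))
    refine (ENNReal.rpow_le_rpow (hg3 j q) hp0.le).trans (le_of_eq ?_)
    rw [← ENNReal.rpow_mul]
    congr 1
    have := hpp.symm.sub_one_mul_conj
    exact this
  have h2 : Tendsto (fun j => ∫⁻ q, g j q * u q ∂m) atTop (𝓝 I) := by
    have hlim : ∀ q, Tendsto (fun j => (g j q : ℝ≥0∞) * u q) atTop (𝓝 (u q ^ p')) := by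
      intro q
      obtain ⟨B, hB⟩ := exists_coe_le hf hfc
      have hfin : u q ≠ ⊤ := ((posAverage_le hB q).trans_lt
        (ENNReal.mul_lt_top ENNReal.coe_lt_top ENNReal.ofReal_lt_top)).ne
      have := ENNReal.Tendsto.mul_const (hg4 q) (Or.inr hfin)
      have e : u q ^ (p' - 1) * u q = u q ^ p' := by
        nth_rewrite 2 [← ENNReal.rpow_one (u q)]
        rw [← ENNReal.rpow_add_of_nonneg _ _ (by linarith) zero_le_one, sub_add_cancel]
      rwa [e] at this
    exact lintegral_tendsto_of_tendsto_of_monotone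
      (fun j => ((g j).measurable.coe_nnreal_ennreal.mul hum).aemeasurable)
      (Eventually.of_forall fun q i j hij => mul_le_mul_left (hg2 q hij) _)
      (Eventually.of_forall hlim)
  have h3 : ‖∫ y, G y‖ₑ * I ≤ K * (∫⁻ y, (f y : ℝ≥0∞) ^ p) ^ (1 / p) * I ^ (1 / p) :=
    le_of_tendsto (ENNReal.Tendsto.const_mul h2 (Or.inr enorm_ne_top)) (Eventually.of_forall h1)
  rcases eq_or_ne I 0 with h0 | h0
  · rw [h0, ENNReal.zero_rpow_of_pos (by positivity), mul_zero]
    exact zero_le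
  · have hI1 : I ^ (1 / p) ≠ 0 := by simp [h0, hIt]
    have hI2 : I ^ (1 / p) ≠ ⊤ := ENNReal.rpow_ne_top_of_nonneg (by positivity) hIt
    have e : I = I ^ (1 / p') * I ^ (1 / p) := by
      rw [← ENNReal.rpow_add _ _ h0 hIt, one_div, one_div, add_comm, hpp.inv_add_inv_eq_one,
        ENNReal.rpow_one]
    refine (ENNReal.mul_le_mul_iff_left hI1 hI2).1 ?_
    rwa [mul_assoc, ← e]

end

/-- The mixed norm estimate for averages of continuous functions, with the optimal choice of the
weight on the rotation group. -/
theorem exists_lintegral_posAverage_le (hd : 2 ≤ d) [MeasurableSpace (SO d)] [BorelSpace (SO d)]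
    (ν : Measure (SO d)) [ν.IsHaarMeasure] {a : ℝ} (ha : 0 < a) {γ γ' : ℝ → E d}
    (hγ : AdmissibleCurve a γ) (hγ' : Continuous γ') (hγγ' : EqOn γ γ' (Icc (-a) a))
    {p p' s : ℝ} (hp : p = (2 * d - 1) / d) (hpp : p.HolderConjugate p') (hs : p' < s)
    (hs2 : s < 2 * p') :
    ∃ C : ℝ≥0, ∀ f : E d → ℝ≥0, Continuous f → HasCompactSupport f →
      (∫⁻ σ, (∫⁻ x, posAverage a γ' (fun y => (f y : ℝ≥0∞)) (σ, x) ^ p') ^ (s / p') ∂ν) ^ (1 / s) ≤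
        C * (∫⁻ y, (f y : ℝ≥0∞) ^ p) ^ (1 / p) := by
  have hdr : (2 : ℝ) ≤ d := by exact_mod_cast hd
  have hp0 := hpp.pos
  have hp0' := hpp.symm.pos
  have hs0 : 0 < s := hp0'.trans hs
  have hsp : 0 < s / p' := div_pos hs0 hp0'
  have hcFeq : curveFourier a γ' = curveFourier a γ := by
    funext ξ
    refine setIntegral_congr_fun measurableSet_Icc fun t ht => ?_
    rw [hγγ' ht]
  have hcF : Continuous (curveFourier a γ') := hcFeq ▸ hγ.continuous_curveFourier
  obtain ⟨A₀, hA₀, h0⟩ := exists_norm_curveAverage_kernelSum_le hd ha hγ hγ' hγγ'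
  obtain ⟨C₁, hC₁, hF⟩ := exists_norm_fourier_kernelSum_le (d := d)
  obtain ⟨C₂, hC₂, hν⟩ := hγ.exists_lintegral_curveFourier_le ν hd ha (q := 2 * (s / p'))
    (by positivity) (by
      have : s / p' < 2 := (div_lt_iff₀ hp0').2 hs2
      linarith)
  rw [← hcFeq] at hν
  -- the point of the strip at which the parameter of the kernels vanishes
  set θ : ℝ := (2 * d - 2) / (2 * d - 1) with hθ
  have hθp : θ / 2 = 1 / p' := by
    have h1 := hpp.inv_add_inv_eq_one
    have h2 : p⁻¹ = 1 - θ / 2 := by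
      rw [hp, hθ, inv_div]
      have : (2 : ℝ) * d - 1 ≠ 0 := by linarith
      linear_combination mul_inv_cancel₀ this
    rw [one_div]
    linarith
  set c₀ : ℝ≥0∞ := ‖∫ y, lineKernel d y‖ₑ with hc₀
  have hc₀0 : c₀ ≠ 0 := enorm_ne_zero.2 (integral_lineKernel_ne_zero hd)
  have hc₀t : c₀ ≠ ⊤ := enorm_ne_top
  set K₁ : ℝ := A₀ ^ (1 - θ) * (C₁ ^ 2 * C₂ ^ (p' / s)) ^ (1 / p') with hK₁
  have hK₁0 : 0 ≤ K₁ := by positivity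
  refine ⟨(c₀⁻¹ * ENNReal.ofReal K₁).toNNReal, fun f hf hfc => ?_⟩
  rw [ENNReal.coe_toNNReal (ENNReal.mul_ne_top (ENNReal.inv_ne_top.2 hc₀0) ENNReal.ofReal_ne_top)]
  set u := posAverage a γ' (fun y => (f y : ℝ≥0∞)) with hu
  have hum : Measurable u := measurable_posAverage hγ' hf.measurable.coe_nnreal_ennreal
  set w : SO d → ℝ≥0∞ := fun σ => ∫⁻ x, u (σ, x) ^ p' with hw
  have hwm : Measurable w := (hum.pow_const p').lintegral_prod_right'
  obtain ⟨B, hB⟩ := lintegral_posAverage_rpow_ne_top (a := a) hγ' hf hfc hp0'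
  set I := ∫⁻ σ, w σ ^ (s / p') ∂ν with hI
  have hIt : I ≠ ⊤ := by
    refine ((lintegral_mono fun σ => ENNReal.rpow_le_rpow (hB σ) hsp.le).trans_lt ?_).ne
    rw [lintegral_const]
    exact ENNReal.mul_lt_top (ENNReal.rpow_lt_top_of_nonneg hsp.le ENNReal.coe_ne_top)
      (measure_lt_top _ _)
  rcases eq_or_ne I 0 with hI0 | hI0
  · rw [hI0, ENNReal.zero_rpow_of_pos (by positivity)]
    exact zero_le
  -- the weight `‖u(σ, ·)‖ ^ (s - p')`, which makes the weighted integral of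
  -- `u ^ p'` a power of the mixed norm
  set ρ : ℝ := s / p' - 1 with hρ
  have hρ0 : 0 < ρ := by
    rw [hρ, sub_pos, lt_div_iff₀ hp0', one_mul]
    exact hs
  set W : SO d → ℝ≥0∞ := fun σ => w σ ^ ρ with hW
  have hWm : Measurable W := hwm.pow_const ρ
  set κ := ν.withDensity W with hκ
  have : IsFiniteMeasure κ := by
    refine isFiniteMeasure_withDensity ((lintegral_mono fun σ =>
      ENNReal.rpow_le_rpow (hB σ) hρ0.le).trans_lt ?_).ne
    rw [lintegral_const]
    exact ENNReal.mul_lt_top (ENNReal.rpow_lt_top_of_nonneg hρ0.le ENNReal.coe_ne_top)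
      (measure_lt_top _ _)
  have hIκ : ∫⁻ q, u q ^ p' ∂(κ.prod (volume : Measure (E d))) = I := by
    rw [lintegral_prod _ (hum.pow_const _).aemeasurable, hκ,
      lintegral_withDensity_eq_lintegral_mul _ hWm hwm]
    refine lintegral_congr fun σ => ?_
    simp only [Pi.mul_apply, hW]
    nth_rewrite 2 [← ENNReal.rpow_one (w σ)]
    rw [← ENNReal.rpow_add_of_nonneg _ _ hρ0.le zero_le_one, hρ, sub_add_cancel]
  set Ir := I.toReal with hIr
  have hIr' : ENNReal.ofReal Ir = I := ENNReal.ofReal_toReal hIt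
  have hIr0 : 0 < Ir := ENNReal.toReal_pos hI0 hIt
  have hps1 : 0 < 1 - p' / s := by
    rw [sub_pos, div_lt_one hs0]
    exact hs
  set A₁ : ℝ := Real.sqrt (C₁ ^ 2 * C₂ ^ (p' / s) * Ir ^ (1 - p' / s)) with hA₁
  -- Hölder's inequality for the weighted decay of the Fourier transform
  have hκF : ∀ ξ, ∫⁻ σ, ‖curveFourier a γ' (rotate σ ξ)‖ₑ ^ 2 ∂κ ≤
      ENNReal.ofReal (C₂ ^ (p' / s) * (max 1 ‖ξ‖)⁻¹ * Ir ^ (1 - p' / s)) := by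
    intro ξ
    have hR0 : 0 < max 1 ‖ξ‖ := lt_max_of_lt_left one_pos
    have hcσ : Measurable fun σ : SO d => ‖curveFourier a γ' (rotate σ ξ)‖ₑ ^ 2 :=
      ((hcF.comp (continuous_rotate.comp
        (continuous_id.prodMk continuous_const))).enorm.measurable).pow_const 2
    have hrr : (s / ((s - p'))).HolderConjugate (s / p') := by
      have h1 : 0 < s - p' := sub_pos.2 hs
      refine Real.holderConjugate_iff.2 ⟨(one_lt_div h1).2 (by linarith), ?_⟩
      rw [inv_div, inv_div, ← add_div, sub_add_cancel, div_self hs0.ne']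
    rw [hκ, lintegral_withDensity_eq_lintegral_mul _ hWm hcσ]
    refine (ENNReal.lintegral_mul_le_Lp_mul_Lq ν hrr hWm.aemeasurable hcσ.aemeasurable).trans ?_
    have e1 : ∀ σ, W σ ^ (s / (s - p')) = w σ ^ (s / p') := fun σ => by
      simp only [hW]
      rw [← ENNReal.rpow_mul]
      congr 1
      have h1 : s - p' ≠ 0 := (sub_pos.2 hs).ne'
      rw [hρ]
      field_simp
    have e2 : ∀ σ, (‖curveFourier a γ' (rotate σ ξ)‖ₑ ^ 2) ^ (s / p') =
        ENNReal.ofReal (‖curveFourier a γ' (rotate σ ξ)‖ ^ (2 * (s / p'))) := fun σ => by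
      rw [← ENNReal.ofReal_rpow_of_nonneg (norm_nonneg _) (by positivity), ofReal_norm,
        ← ENNReal.rpow_two, ← ENNReal.rpow_mul]
    simp_rw [e1, e2]
    have h3 := hν ξ
    have e3 : 1 / (s / (s - p')) = 1 - p' / s := by
      rw [one_div_div, sub_div, div_self hs0.ne']
    have e4 : 1 / (s / p') = p' / s := one_div_div _ _
    rw [e3, e4, ← hI, ← hIr', mul_comm]
    refine (mul_le_mul_left (ENNReal.rpow_le_rpow h3 (by positivity)) _).trans (le_of_eq ?_)
    rw [ENNReal.ofReal_rpow_of_nonneg (by positivity) (by positivity),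
      ENNReal.ofReal_rpow_of_nonneg hIr0.le hps1.le, ← ENNReal.ofReal_mul (by positivity),
      Real.mul_rpow hC₂.le (by positivity), ← Real.rpow_mul hR0.le]
    congr 3
    rw [← Real.rpow_neg_one]
    congr 1
    field_simp
  have h1 : ∀ (n : ℕ) (z : ℂ) (ξ : E d), z.re = -(1 / 2) → ‖𝓕 (kernelSum d n z) ξ‖ₑ ^ 2 *
      ∫⁻ σ, ‖curveFourier a γ' (rotate σ ξ)‖ₑ ^ 2 ∂κ ≤ ENNReal.ofReal (A₁ ^ 2) := by
    intro n z ξ hz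
    have hR0 : 0 < max 1 ‖ξ‖ := lt_max_of_lt_left one_pos
    have h2 : ‖𝓕 (kernelSum d n z) ξ‖ₑ ^ 2 ≤ ENNReal.ofReal (C₁ ^ 2 * max 1 ‖ξ‖) := by
      rw [← ofReal_norm, ← ENNReal.ofReal_pow (norm_nonneg _)]
      refine ENNReal.ofReal_le_ofReal ?_
      have := pow_le_pow_left₀ (norm_nonneg _) (hF n z ξ hz) 2
      rwa [mul_pow, Real.sq_sqrt hR0.le] at this
    refine (mul_le_mul' h2 (hκF ξ)).trans (le_of_eq ?_)
    rw [← ENNReal.ofReal_mul (by positivity), hA₁, Real.sq_sqrt (by positivity)]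
    congr 1
    field_simp
  have hmain := lintegral_posAverage_rpow_le ha hγ' (κ := κ) contDiff_lineKernel.continuous
    hasCompactSupport_lineKernel hpp (K := ENNReal.ofReal (A₀ ^ (1 - θ) * A₁ ^ θ))
    (fun n φ g hφ hg => by
      have := enorm_kernelForm_simpleFunc_le hd ha hγ' (n := n + 1) hA₀.le (Real.sqrt_nonneg _) hp
        hθ hcF (fun z σ x hz => h0 (n + 1) z σ x hz) (h1 (n + 1)) hφ hg
      have e : kernelSum d (n + 1) 0 = dilate n (lineKernel d) := funext (kernelSum_zero n)
      rwa [e] at this) hf hfc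
  rw [hIκ, ← hc₀] at hmain
  have hA₁θ : A₀ ^ (1 - θ) * A₁ ^ θ = K₁ * Ir ^ (1 / p' - 1 / s) := by
    have e1 : A₁ ^ θ = (C₁ ^ 2 * C₂ ^ (p' / s)) ^ (1 / p') * Ir ^ (1 / p' - 1 / s) := by
      rw [hA₁, Real.sqrt_eq_rpow, ← Real.rpow_mul (by positivity), one_div_mul_eq_div, hθp,
        Real.mul_rpow (by positivity) (by positivity), ← Real.rpow_mul hIr0.le]
      congr 2
      field_simp
    rw [e1, hK₁]
    ring
  rw [hA₁θ, ENNReal.ofReal_mul hK₁0, ← ENNReal.ofReal_rpow_of_pos hIr0, hIr'] at hmain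
  set N := (∫⁻ y, (f y : ℝ≥0∞) ^ p) ^ (1 / p) with hN
  have e : I ^ (1 / p') = I ^ (1 / s) * I ^ (1 / p' - 1 / s) := by
    rw [← ENNReal.rpow_add _ _ hI0 hIt, add_sub_cancel]
  have hX0 : I ^ (1 / p' - 1 / s) ≠ 0 := by simp [hI0, hIt]
  have hXt : I ^ (1 / p' - 1 / s) ≠ ⊤ := by simp [hI0, hIt]
  have hfin : c₀ * I ^ (1 / s) ≤ ENNReal.ofReal K₁ * N := by
    refine (ENNReal.mul_le_mul_iff_left hX0 hXt).1 ?_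
    rw [mul_assoc, ← e]
    refine hmain.trans (le_of_eq ?_)
    ring
  calc I ^ (1 / s) = c₀⁻¹ * (c₀ * I ^ (1 / s)) := by
        rw [← mul_assoc, ENNReal.inv_mul_cancel hc₀0 hc₀t, one_mul]
    _ ≤ c₀⁻¹ * (ENNReal.ofReal K₁ * N) := by gcongr
    _ = _ := by rw [mul_assoc]

end FourierAnalysis

section Density

open Filter Topology

/-! ### Passage to all functions in `L^p` -/

theorem liminf_rpow {b : ℕ → ℝ≥0∞} {r : ℝ} (hr : 0 < r) :
    (liminf b atTop) ^ r = liminf (fun j => b j ^ r) atTop :=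
  (ENNReal.orderIsoRpow r hr).liminf_apply

/-- Approximation in `L^p`, and almost everywhere along a subsequence `ns`, of the absolute value by
nonnegative continuous functions of compact support. -/
theorem exists_continuous_tendsto_ae {f : E d → ℂ} {p : ℝ} (hp : 1 ≤ p)
    (hf : MemLp f (ENNReal.ofReal p)) {ε : ℕ → ℝ≥0∞} (hε0 : ∀ j, ε j ≠ 0)
    (hε : Tendsto ε atTop (𝓝 0)) :
    ∃ g : ℕ → E d → ℝ≥0, ∃ ns : ℕ → ℕ, StrictMono ns ∧
      (∀ j, Continuous (g j) ∧ HasCompactSupport (g j)) ∧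
      (∀ j, (∫⁻ y, (g j y : ℝ≥0∞) ^ p) ^ (1 / p) ≤ eLpNorm f (ENNReal.ofReal p) + ε (ns j)) ∧
      ∀ᵐ x, Tendsto (fun j => (g j x : ℝ≥0∞)) atTop (𝓝 ‖f x‖ₑ) := by
  have hp0 : 0 < p := by linarith
  have hP0 : ENNReal.ofReal p ≠ 0 := by simpa using hp0
  have hP1 : 1 ≤ ENNReal.ofReal p := ENNReal.one_le_ofReal.2 hp
  set h : E d → ℝ := fun x => ‖f x‖ with hh
  have hm : MemLp h (ENNReal.ofReal p) := hf.norm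
  choose g hgc hgε hgcont hgm using fun j =>
    hm.exists_hasCompactSupport_eLpNorm_sub_le ENNReal.ofReal_ne_top (hε0 j)
  have hlim : Tendsto (fun n => eLpNorm (g n - h) (ENNReal.ofReal p)) atTop (𝓝 0) := by
    refine tendsto_of_tendsto_of_tendsto_of_le_of_le tendsto_const_nhds hε (fun _ => zero_le)
      fun n => ?_
    simp only
    rw [eLpNorm_sub_comm]
    exact hgε n
  obtain ⟨ns, hns, hae⟩ := (tendstoInMeasure_of_tendsto_eLpNorm hP0
    (fun n => (hgm n).1) hm.1 hlim).exists_seq_tendsto_ae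
  refine ⟨fun j x => (g (ns j) x).toNNReal, ns, hns, fun j => ⟨?_, ?_⟩, fun j => ?_, ?_⟩
  · exact continuous_real_toNNReal.comp (hgcont _)
  · exact (hgc _).comp_left (g := Real.toNNReal) Real.toNNReal_zero
  · have h1 : eLpNorm (g (ns j)) (ENNReal.ofReal p) ≤
        eLpNorm f (ENNReal.ofReal p) + ε (ns j) := by
      have e : g (ns j) = h - (h - g (ns j)) := by abel
      rw [e]
      refine (eLpNorm_sub_le hm.1 (hm.1.sub (hgm _).1) hP1).trans ?_
      exact add_le_add (eLpNorm_norm f).le (hgε _)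
    refine le_trans ?_ h1
    rw [eLpNorm_eq_lintegral_rpow_enorm_toReal hP0 ENNReal.ofReal_ne_top,
      ENNReal.toReal_ofReal hp0.le]
    gcongr with y
    exact Real.ofReal_le_enorm _
  · filter_upwards [hae] with x hx
    have h2 := (ENNReal.continuous_ofReal.tendsto _).comp hx
    rwa [hh, ofReal_norm] at h2

section

variable {a : ℝ} {γ : ℝ → E d} [MeasurableSpace (SO d)] [BorelSpace (SO d)]

/-- Null sets of `ℝ^d` are avoided by almost every point of almost every translate of a
rotated curve. -/
theorem quasiMeasurePreserving_arg (hγ : Continuous γ) (ν : Measure (SO d)) [SFinite ν] :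
    Measure.QuasiMeasurePreserving
      (fun q : (SO d × E d) × ℝ => q.1.2 - rotate q.1.1⁻¹ (γ q.2))
      ((ν.prod (volume : Measure (E d))).prod (volume.restrict (Icc (-a) a))) volume := by
  have hm := (continuous_arg (d := d) hγ).measurable
  refine ⟨hm, Measure.AbsolutelyContinuous.mk fun N hN hN0 => ?_⟩
  rw [Measure.map_apply hm hN]
  have hS := hm hN
  rw [← lintegral_indicator_one hS, lintegral_prod_symm' _ (measurable_one.indicator hS)]
  refine (lintegral_congr fun t => ?_).trans lintegral_zero
  have hSt : Measurable fun q : SO d × E d =>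
      ((fun q : (SO d × E d) × ℝ => q.1.2 - rotate q.1.1⁻¹ (γ q.2)) ⁻¹' N).indicator
        (1 : (SO d × E d) × ℝ → ℝ≥0∞) (q, t) :=
    (measurable_one.indicator hS).comp measurable_prodMk_right
  rw [lintegral_prod _ hSt.aemeasurable]
  refine (lintegral_congr fun σ => ?_).trans lintegral_zero
  have h1 := lintegral_sub_right_eq_self (μ := (volume : Measure (E d)))
    (N.indicator (1 : E d → ℝ≥0∞)) (rotate σ⁻¹ (γ t))
  rw [lintegral_indicator_one hN, hN0] at h1
  exact h1

theorem aemeasurable_posAverage (hγ : Continuous γ) (ν : Measure (SO d)) [SFinite ν]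
    {F : E d → ℝ≥0∞} (hF : AEMeasurable F) :
    AEMeasurable (posAverage a γ F) (ν.prod volume) :=
  (hF.comp_quasiMeasurePreserving (quasiMeasurePreserving_arg (a := a) hγ ν)).lintegral_prod_right'

/-- Fatou's lemma for the mixed norms of the averages over rotated curves. -/
theorem lintegral_posAverage_le_of_tendsto (hγ : Continuous γ) (ν : Measure (SO d)) [SFinite ν]
    {g : ℕ → E d → ℝ≥0∞} {F : E d → ℝ≥0∞} (hg : ∀ j, Measurable (g j))
    (hlim : ∀ᵐ x, Tendsto (fun j => g j x) atTop (𝓝 (F x))) {q r s : ℝ} (hq : 0 < q) (hr : 0 < r)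
    (hs : 0 < s) {b : ℕ → ℝ≥0∞} {b₀ : ℝ≥0∞}
    (hb : ∀ j, (∫⁻ σ, (∫⁻ x, posAverage a γ (g j) (σ, x) ^ q) ^ r ∂ν) ^ s ≤ b j)
    (hb0 : Tendsto b atTop (𝓝 b₀)) :
    (∫⁻ σ, (∫⁻ x, posAverage a γ F (σ, x) ^ q) ^ r ∂ν) ^ s ≤ b₀ := by
  have h1 := ((quasiMeasurePreserving_arg (a := a) hγ ν).tendsto_ae).eventually hlim
  have h2 := Measure.ae_ae_of_ae_prod (Measure.ae_ae_of_ae_prod h1 |>.mono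
    fun z hz => (show posAverage a γ F z ≤ liminf (fun j => posAverage a γ (g j) z) atTop from by
      have e : posAverage a γ F z =
          ∫⁻ t in Icc (-a) a, liminf (fun j => g j (z.2 - rotate z.1⁻¹ (γ t))) atTop :=
        lintegral_congr_ae (hz.mono fun t ht => ht.liminf_eq.symm)
      rw [e]
      exact lintegral_liminf_le fun j =>
        (hg j).comp (continuous_rotated_arg hγ z.1 z.2).measurable))
  have hm : ∀ j, Measurable fun z => posAverage a γ (g j) z ^ q := fun j =>
    (measurable_posAverage hγ (hg j)).pow_const q
  have h3 : ∀ᵐ σ ∂ν, ∫⁻ x, posAverage a γ F (σ, x) ^ q ≤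
      liminf (fun j => ∫⁻ x, posAverage a γ (g j) (σ, x) ^ q) atTop := by
    filter_upwards [h2] with σ hσ
    refine le_trans (lintegral_mono_ae ?_) (lintegral_liminf_le fun j =>
      (hm j).comp measurable_prodMk_left)
    filter_upwards [hσ] with x hx
    refine (ENNReal.rpow_le_rpow hx hq.le).trans ?_
    rw [liminf_rpow hq]
  have h4 : ∫⁻ σ, (∫⁻ x, posAverage a γ F (σ, x) ^ q) ^ r ∂ν ≤
      liminf (fun j => ∫⁻ σ, (∫⁻ x, posAverage a γ (g j) (σ, x) ^ q) ^ r ∂ν) atTop := by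
    refine le_trans (lintegral_mono_ae ?_) (lintegral_liminf_le fun j =>
      ((hm j).lintegral_prod_right').pow_const r)
    filter_upwards [h3] with σ hσ
    refine (ENNReal.rpow_le_rpow hσ hr.le).trans ?_
    rw [liminf_rpow hr]
  refine (ENNReal.rpow_le_rpow h4 hs.le).trans ?_
  rw [liminf_rpow hs, ← hb0.liminf_eq]
  exact liminf_le_liminf (Eventually.of_forall hb)

end

/-- The mixed norm estimate for the averages of functions in `L^p`. -/
theorem exists_lintegral_posAverage_enorm_le (hd : 2 ≤ d) [MeasurableSpace (SO d)]
    [BorelSpace (SO d)] (ν : Measure (SO d)) [ν.IsHaarMeasure] {a : ℝ} (ha : 0 < a)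
    {γ γ' : ℝ → E d} (hγ : AdmissibleCurve a γ) (hγ' : Continuous γ')
    (hγγ' : EqOn γ γ' (Icc (-a) a)) {p p' s : ℝ} (hp : p = (2 * d - 1) / d)
    (hpp : p.HolderConjugate p') (hs : p' < s) (hs2 : s < 2 * p') :
    ∃ C : ℝ≥0, ∀ f : E d → ℂ, MemLp f (ENNReal.ofReal p) →
      (∫⁻ σ, (∫⁻ x, posAverage a γ' (fun y => ‖f y‖ₑ) (σ, x) ^ p') ^ (s / p') ∂ν) ^ (1 / s) ≤
        C * eLpNorm f (ENNReal.ofReal p) := by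
  obtain ⟨C, hC⟩ := exists_lintegral_posAverage_le hd ν ha hγ hγ' hγγ' hp hpp hs hs2
  have hs0 : 0 < s := hpp.symm.pos.trans hs
  refine ⟨C, fun f hf => ?_⟩
  set ε : ℕ → ℝ≥0∞ := fun j => ((j : ℝ≥0∞))⁻¹ with hε
  have hε0 : Tendsto ε atTop (𝓝 0) := ENNReal.tendsto_inv_nat_nhds_zero
  obtain ⟨g, ns, hns, hgc, hgb, hlim⟩ := exists_continuous_tendsto_ae hpp.lt.le hf
    (fun j => ENNReal.inv_ne_zero.2 (ENNReal.natCast_ne_top j)) hε0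
  refine lintegral_posAverage_le_of_tendsto hγ' ν
    (fun j => (hgc j).1.measurable.coe_nnreal_ennreal) hlim hpp.symm.pos
    (div_pos hs0 hpp.symm.pos) (one_div_pos.2 hs0)
    (fun j => (hC (g j) (hgc j).1 (hgc j).2).trans (mul_le_mul' le_rfl (hgb j))) ?_
  have h1 := (tendsto_const_nhds (x := eLpNorm f (ENNReal.ofReal p))).add
    (hε0.comp hns.tendsto_atTop)
  rw [add_zero] at h1
  exact ENNReal.Tendsto.const_mul h1 (Or.inr ENNReal.coe_ne_top)

end Density

end RotatedCurve

end

theorem mainTheorem5 {d : ℕ} (hd : 2 < d)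
    [MeasurableSpace (RotatedCurve.SO d)] [BorelSpace (RotatedCurve.SO d)]
    (ν : MeasureTheory.Measure (RotatedCurve.SO d)) [ν.IsHaarMeasure]
    (a : ℝ) (ha : 0 < a) (γ : ℝ → RotatedCurve.E d) (hγ : RotatedCurve.AdmissibleCurve a γ)
    (χ : ℝ → ℂ) (hχ : RotatedCurve.IsCutoff a χ)
    (p p' s : ℝ) (hp : p = (2 * d - 1) / d) (hp' : p' = p / (p - 1))
    (hs0 : 0 < s) (hs : s < (4 * d - 2) / (d - 1)) :
    ∃ C : ℝ≥0, ∀ f : RotatedCurve.E d → ℂ, MemLp f (ENNReal.ofReal p) volume →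
      (∀ᵐ z ∂(ν.prod (volume : Measure (RotatedCurve.E d))),
        IntegrableOn (fun t => f (z.2 - RotatedCurve.rotate z.1⁻¹ (γ t)) * χ t)
          (Icc (-a) a) volume) ∧
      AEStronglyMeasurable
        (fun z : RotatedCurve.SO d × RotatedCurve.E d => RotatedCurve.T a γ χ f z.2 z.1)
        (ν.prod (volume : Measure (RotatedCurve.E d))) ∧
      RotatedCurve.mixedNorm ν (ENNReal.ofReal s) (ENNReal.ofReal p')
          (RotatedCurve.T a γ χ f) ≤
        C * eLpNorm f (ENNReal.ofReal p) volume := by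
  have hdr : (3 : ℝ) ≤ d := by exact_mod_cast hd
  have hp1 : 1 < p := by
    rw [hp, lt_div_iff₀ (by linarith)]
    linarith
  have hpp : p.HolderConjugate p' := by
    rw [hp']
    exact Real.HolderConjugate.conjExponent hp1
  have hp0' : 0 < p' := hpp.symm.pos
  have hsp : s < 2 * p' := by
    refine hs.trans_le (le_of_eq ?_)
    have h1 : (d : ℝ) ≠ 0 := by linarith
    have h2 : (d : ℝ) - 1 ≠ 0 := by linarith
    have h3 : p - 1 = (d - 1) / d := by
      rw [hp]
      field_simp
      ring
    rw [hp', h3, hp]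
    field_simp
    ring
  -- an exponent in the rotations which is strictly between `p'` and `2 p'`, and at least `s`
  set s₁ : ℝ := (max s p' + 2 * p') / 2 with hs₁
  have hm1 : s ≤ max s p' := le_max_left _ _
  have hm2 : p' ≤ max s p' := le_max_right _ _
  have hm3 : max s p' < 2 * p' := max_lt hsp (by linarith)
  have hs1 : p' < s₁ := by linarith
  have hs2 : s₁ < 2 * p' := by linarith
  have hss₁ : s ≤ s₁ := by linarith
  have hs₁0 : 0 < s₁ := by linarith
  -- a continuous extension of the curve to the real line
  set γ' : ℝ → RotatedCurve.E d := IccExtend (by linarith : -a ≤ a) ((Icc (-a) a).domRestrict γ)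
    with hγ'def
  have hγ' : Continuous γ' :=
    (continuousOn_iff_continuous_domRestrict.1 hγ.continuousOn).Icc_extend'
  have hγγ' : EqOn γ γ' (Icc (-a) a) := fun t ht => by
    rw [hγ'def, IccExtend_of_mem _ _ ht]
    rfl
  obtain ⟨B, hB⟩ := isCompact_Icc.exists_bound_of_continuousOn
    (hχ.contDiff.continuous.continuousOn (s := Icc (-a) a))
  obtain ⟨C, hC⟩ := RotatedCurve.exists_lintegral_posAverage_enorm_le (by omega) ν ha hγ hγ' hγγ'
    hp hpp hs1 hs2
  set c : ℝ≥0 := B.toNNReal with hc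
  have hcB : ∀ t ∈ Icc (-a) a, ‖χ t‖ₑ ≤ c := fun t ht => by
    rw [← ofReal_norm]
    exact ENNReal.ofReal_le_ofReal (hB t ht)
  have hνu : ν univ ^ (1 / s - 1 / s₁) ≠ ⊤ := by
    refine ENNReal.rpow_ne_top_of_nonneg ?_ (measure_ne_top ν _)
    rw [sub_nonneg]
    exact one_div_le_one_div_of_le hs0 hss₁
  refine ⟨c * (C * (ν univ ^ (1 / s - 1 / s₁)).toNNReal), fun f hf => ?_⟩
  have hπ := RotatedCurve.quasiMeasurePreserving_arg (a := a) hγ' ν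
  set U := RotatedCurve.posAverage a γ' (fun y => ‖f y‖ₑ) with hU
  have hUm : AEMeasurable U (ν.prod volume) :=
    RotatedCurve.aemeasurable_posAverage hγ' ν hf.1.enorm
  have hwm : AEMeasurable (fun σ => ∫⁻ x, U (σ, x) ^ p') ν :=
    (hUm.pow_const p').lintegral_prod_right'
  have hP0 : ENNReal.ofReal p' ≠ 0 := by simpa using hp0'
  have hS0 : ENNReal.ofReal s₁ ≠ 0 := by simpa using hs₁0
  have hv : (fun σ => eLpNorm (fun x => U (σ, x)) (ENNReal.ofReal p') volume) =
      fun σ => (∫⁻ x, U (σ, x) ^ p') ^ (1 / p') := by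
    funext σ
    rw [eLpNorm_eq_lintegral_rpow_enorm_toReal hP0 ENNReal.ofReal_ne_top,
      ENNReal.toReal_ofReal hp0'.le]
    simp only [enorm_eq_self]
  have hvC : eLpNorm (fun σ => eLpNorm (fun x => U (σ, x)) (ENNReal.ofReal p') volume)
      (ENNReal.ofReal s₁) ν ≤ C * eLpNorm f (ENNReal.ofReal p) volume := by
    refine le_trans (le_of_eq ?_) (hC f hf)
    rw [hv, eLpNorm_eq_lintegral_rpow_enorm_toReal hS0 ENNReal.ofReal_ne_top,
      ENNReal.toReal_ofReal hs₁0.le]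
    congr 1
    refine lintegral_congr fun σ => ?_
    rw [enorm_eq_self, ← ENNReal.rpow_mul, one_div_mul_eq_div]
  have hfm : AEStronglyMeasurable (fun q : (RotatedCurve.SO d × RotatedCurve.E d) × ℝ =>
      f (q.1.2 - RotatedCurve.rotate q.1.1⁻¹ (γ' q.2)) * χ q.2)
      ((ν.prod (volume : Measure (RotatedCurve.E d))).prod (volume.restrict (Icc (-a) a))) :=
    (hf.1.comp_quasiMeasurePreserving hπ).mul
      (hχ.contDiff.continuous.comp continuous_snd).aestronglyMeasurable
  have hT : ∀ z : RotatedCurve.SO d × RotatedCurve.E d, RotatedCurve.T a γ χ f z.2 z.1 =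
      ∫ t in Icc (-a) a, f (z.2 - RotatedCurve.rotate z.1⁻¹ (γ' t)) * χ t := fun z =>
    setIntegral_congr_fun measurableSet_Icc fun t ht => by
      simp only
      rw [hγγ' ht]
  have hle : ∀ z : RotatedCurve.SO d × RotatedCurve.E d,
      ∫⁻ t in Icc (-a) a, ‖f (z.2 - RotatedCurve.rotate z.1⁻¹ (γ' t)) * χ t‖ₑ ≤ c * U z := by
    intro z
    rw [hU, RotatedCurve.posAverage, ← lintegral_const_mul' _ _ ENNReal.coe_ne_top]
    refine setLIntegral_mono' measurableSet_Icc fun t ht => ?_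
    rw [enorm_mul, mul_comm]
    exact mul_le_mul' (hcB t ht) le_rfl
  have hTU : ∀ z : RotatedCurve.SO d × RotatedCurve.E d,
      ‖RotatedCurve.T a γ χ f z.2 z.1‖ₑ ≤ c * ‖U z‖ₑ := fun z => by
    rw [hT, enorm_eq_self]
    exact (enorm_integral_le_lintegral_enorm _).trans (hle z)
  refine ⟨?_, ?_, ?_⟩
  · -- finiteness of the mixed norm makes the average finite almost everywhere
    have hfin : ∀ᵐ σ ∂ν, ∀ᵐ x, U (σ, x) < ⊤ := by
      have hne : ∫⁻ σ, (∫⁻ x, U (σ, x) ^ p') ^ (s₁ / p') ∂ν ≠ ⊤ := by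
        intro htop
        have h1 := hC f hf
        rw [← hU, htop, ENNReal.top_rpow_of_pos (by positivity)] at h1
        exact (ENNReal.mul_ne_top ENNReal.coe_ne_top hf.2.ne) (top_le_iff.1 h1)
      have hpos : 0 < s₁ / p' := div_pos hs₁0 hp0'
      filter_upwards [ae_lt_top' (hwm.pow_const _) hne,
        hUm.aestronglyMeasurable.prodMk_left] with σ hσ hσm
      have h2 : ∫⁻ x, U (σ, x) ^ p' ≠ ⊤ := by
        intro htop
        rw [htop, ENNReal.top_rpow_of_pos hpos] at hσ
        exact lt_irrefl _ hσ
      filter_upwards [ae_lt_top' (hσm.aemeasurable.pow_const p') h2] with x hx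
      by_contra htop
      rw [not_lt, top_le_iff] at htop
      rw [htop, ENNReal.top_rpow_of_pos hp0'] at hx
      exact lt_irrefl _ hx
    have hfin' : ∀ᵐ z ∂(ν.prod (volume : Measure (RotatedCurve.E d))), U z < ⊤ := by
      have h1 : ∀ᵐ z ∂(ν.prod (volume : Measure (RotatedCurve.E d))), hUm.mk U z < ⊤ := by
        rw [Measure.ae_prod_iff_ae_ae (measurableSet_lt hUm.measurable_mk measurable_const)]
        filter_upwards [hfin, Measure.ae_ae_of_ae_prod hUm.ae_eq_mk] with σ h2 h3
        filter_upwards [h2, h3] with x h4 h5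
        rwa [← h5]
      filter_upwards [h1, hUm.ae_eq_mk] with z h2 h3
      rwa [h3]
    filter_upwards [hfin', hfm.prodMk_left] with z hz hzm
    have hcongr : EqOn (fun t => f (z.2 - RotatedCurve.rotate z.1⁻¹ (γ' t)) * χ t)
        (fun t => f (z.2 - RotatedCurve.rotate z.1⁻¹ (γ t)) * χ t) (Icc (-a) a) := fun t ht => by
      simp only
      rw [hγγ' ht]
    refine IntegrableOn.congr_fun ⟨hzm, ?_⟩ hcongr measurableSet_Icc
    rw [hasFiniteIntegral_iff_enorm]
    exact (hle z).trans_lt (ENNReal.mul_lt_top ENNReal.coe_lt_top hz)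
  · have h1 := hfm.integral_prod_right'
    exact h1.congr (Filter.Eventually.of_forall fun z => (hT z).symm)
  · have hvm : AEStronglyMeasurable
        (fun σ => eLpNorm (fun x => U (σ, x)) (ENNReal.ofReal p') volume) ν := by
      rw [hv]
      exact (hwm.pow_const _).aestronglyMeasurable
    have h1 : ∀ σ, eLpNorm (fun x => RotatedCurve.T a γ χ f x σ) (ENNReal.ofReal p') volume ≤
        c * eLpNorm (fun x => U (σ, x)) (ENNReal.ofReal p') volume := fun σ => by
      have := eLpNorm_le_nnreal_smul_eLpNorm_of_ae_le_mul' (μ := volume)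
        (Filter.Eventually.of_forall fun x => hTU (σ, x)) (ENNReal.ofReal p')
      rwa [ENNReal.smul_def, smul_eq_mul] at this
    have h2 := eLpNorm_le_nnreal_smul_eLpNorm_of_ae_le_mul' (μ := ν)
      (f := fun σ => eLpNorm (fun x => RotatedCurve.T a γ χ f x σ) (ENNReal.ofReal p') volume)
      (g := fun σ => eLpNorm (fun x => U (σ, x)) (ENNReal.ofReal p') volume) (c := c)
      (Filter.Eventually.of_forall fun σ => by
        rw [enorm_eq_self, enorm_eq_self]
        exact h1 σ) (ENNReal.ofReal s)
    rw [ENNReal.smul_def, smul_eq_mul] at h2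
    have h3 := eLpNorm_le_eLpNorm_mul_rpow_measure_univ (ENNReal.ofReal_le_ofReal hss₁) hvm
    rw [ENNReal.toReal_ofReal hs0.le, ENNReal.toReal_ofReal hs₁0.le] at h3
    push_cast
    rw [ENNReal.coe_toNNReal hνu]
    calc RotatedCurve.mixedNorm ν (ENNReal.ofReal s) (ENNReal.ofReal p')
          (RotatedCurve.T a γ χ f) ≤ c * _ := h2
      _ ≤ c * (C * eLpNorm f (ENNReal.ofReal p) volume * ν univ ^ (1 / s - 1 / s₁)) :=
          mul_le_mul' le_rfl (h3.trans (mul_le_mul' hvC le_rfl))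
      _ = _ := by ring
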